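/- Let $s\in(1/2,1)$, let $N$ be a positive integer with $N>2s$, let $\mathcal B$ be the open unit ball of $\mathbb R^N$ centered at $0$, and put $2^*_s=\frac{2N}{N-2s}$. For an open set $\Omega\subset\mathbb R^N$ let $$Q_{N,s,\Omega}(u)=\frac{c_{N,s}}{2}\int_\Omega\int_\Omega\frac{(u(x)-u(y))^2}{|x-y|^{N+2s}}\,dx\,dy,\qquad c_{N,s}=\frac{s\,4^s\,\Gamma(\frac N2+s)}{\pi^{N/2}\,\Gamma(1-s)},$$ let $H^s(\Omega)$ be the space of all $u\in L^2(\Omega)$ with $Q_{N,s,\Omega}(u)<\infty$, with norm $\|u\|^2_{H^s(\Omega)}=\|u\|^2_{L^2(\Omega)}+Q_{N,s,\Omega}(u)$, and let $H^s_0(\Omega)$ be the completion of $C^\infty_c(\Omega)$ in this norm. Let $H^s_{0,rad}(\mathcal B)$ be the completion in the $H^s(\mathcal B)$-norm of the space of radial functions in $C_c^\infty(\mathcal B)$; on it $Q_{N,s,\mathcal B}(u)^{1/2}$ is an equivalent norm. Set $$S_{N,s}(\mathbb R^N)=\inf_{0\ne u\in H^s_0(\mathbb R^N)}\frac{Q_{N,s,\mathbb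 R^N}(u)}{\|u\|^2_{L^{2^*_s}(\mathbb R^N)}}$$ and, for a radial function $h\in L^\infty(\mathcal B)$, $$S_{N,s,rad}(\mathcal B,h)=\inf_{0\ne u\in H^s_{0,rad}(\mathcal B)}\frac{Q_{N,s,\mathcal B}(u)+\int_{\mathcal B}hu^2\,dx}{\|u\|^2_{L^{2^*_s}(\mathcal B)}}.$$ Theorem. Let $h\in L^\infty(\mathcal B)$ be radial and suppose that $$0<S_{N,s,rad}(\mathcal B,h)<S_{N,s}(\mathbb R^N).$$ Then every minimizing sequence $(u_k)$ for $S_{N,s,rad}(\mathcal B,h)$ (that is, $0\ne u_k\in H^s_{0,rad}(\mathcal B)$ and the quotients of the $u_k$ converge to the infimum) that is normalized, either by $Q_{N,s,\mathcal B}(u_k)=1$ for all $k$ or by $Q_{N,s,\mathcal B}(u_k)+\int_{\mathcal B}hu_k^2\,dx=1$ for all $k$, is relatively compact in $H^s_{0,rad}(\mathcal B)$. In particular, the infimum $S_{N,s,rad}(\mathcal B,h)$ is achieved by some $0\ne u\in H^s_{0,rad}(\mathcal B)$. -/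

import Mathlib

open MeasureTheory Set Filter Topology
open scoped ContDiff ENNReal

noncomputable section

/-- The Euclidean space `ℝ^N`. -/
abbrev Eucl (N : ℕ) : Type := EuclideanSpace ℝ (Fin N)

/-- The normalization constant `c_{N,s}` of `(-Δ)^s` on `ℝ^N`, i.e. the constant for which
`(-Δ)^s` has Fourier symbol `|ξ|^{2s}`. -/
def fracConst (N : ℕ) (s : ℝ) : ℝ :=
  s * 4 ^ s * Real.Gamma ((N : ℝ) / 2 + s) / (Real.pi ^ ((N : ℝ) / 2) * Real.Gamma (1 - s))

theorem fracConst_pos (N : ℕ) {s : ℝ} (hs0 : 0 < s) (hs1 : s < 1) : 0 < fracConst N s := by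
  have h1 : 0 < Real.Gamma ((N : ℝ) / 2 + s) := Real.Gamma_pos_of_pos (by positivity)
  have h2 : 0 < Real.Gamma (1 - s) := Real.Gamma_pos_of_pos (by linarith)
  have h3 := Real.pi_pos
  unfold fracConst
  positivity

/-- The integrand `(u(x)-u(y))² / |x-y|^{N+2s}` (its value on the diagonal is `0`). -/
def gagliardoIntegrand (N : ℕ) (s : ℝ) (u : Eucl N → ℝ) (p : Eucl N × Eucl N) : ℝ :=
  (u p.1 - u p.2) ^ 2 / ‖p.1 - p.2‖ ^ ((N : ℝ) + 2 * s)

/-- The difference quotient `(u(x)-u(y)) / |x-y|^{(N+2s)/2}`, whose square is the integrand. -/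
def gagliardoQuot (N : ℕ) (s : ℝ) (u : Eucl N → ℝ) (p : Eucl N × Eucl N) : ℝ :=
  (u p.1 - u p.2) / ‖p.1 - p.2‖ ^ (((N : ℝ) + 2 * s) / 2)

theorem gagliardoQuot_sq (N : ℕ) (s : ℝ) (u : Eucl N → ℝ) (p : Eucl N × Eucl N) :
    gagliardoQuot N s u p ^ 2 = gagliardoIntegrand N s u p := by
  unfold gagliardoQuot gagliardoIntegrand
  rw [div_pow, ← Real.rpow_natCast (‖p.1 - p.2‖ ^ (((N : ℝ) + 2 * s) / 2)) 2,
    ← Real.rpow_mul (norm_nonneg _)]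
  congr 2
  push_cast
  ring

section

variable {N : ℕ} {s : ℝ} {Ω : Set (Eucl N)}

theorem ae_eq_fst {f g : Eucl N → ℝ} (h : f =ᵐ[volume.restrict Ω] g) :
    ∀ᵐ p ∂((volume.restrict Ω).prod (volume.restrict Ω)), f p.1 = g p.1 :=
  (Measure.quasiMeasurePreserving_fst (μ := volume.restrict Ω) (ν := volume.restrict Ω)).ae h

theorem ae_eq_snd {f g : Eucl N → ℝ} (h : f =ᵐ[volume.restrict Ω] g) :
    ∀ᵐ p ∂((volume.restrict Ω).prod (volume.restrict Ω)), f p.2 = g p.2 :=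
  (Measure.quasiMeasurePreserving_snd (μ := volume.restrict Ω) (ν := volume.restrict Ω)).ae h

theorem gagliardoQuot_aesm {u : Eucl N → ℝ} (hu : AEStronglyMeasurable u (volume.restrict Ω)) :
    AEStronglyMeasurable (gagliardoQuot N s u)
      ((volume.restrict Ω).prod (volume.restrict Ω)) := by
  have h1 : AEStronglyMeasurable (fun p : Eucl N × Eucl N => u p.1)
      ((volume.restrict Ω).prod (volume.restrict Ω)) := hu.comp_fst
  have h2 : AEStronglyMeasurable (fun p : Eucl N × Eucl N => u p.2)
      ((volume.restrict Ω).prod (volume.restrict Ω)) := hu.comp_snd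
  have h3 : Measurable (fun p : Eucl N × Eucl N =>
      ‖p.1 - p.2‖ ^ (((N : ℝ) + 2 * s) / 2)) := by fun_prop
  exact ((h1.sub h2).aemeasurable.div h3.aemeasurable).aestronglyMeasurable

theorem gagliardoQuot_memLp_iff {u : Eucl N → ℝ}
    (hu : AEStronglyMeasurable u (volume.restrict Ω)) :
    MemLp (gagliardoQuot N s u) 2 ((volume.restrict Ω).prod (volume.restrict Ω)) ↔
      Integrable (gagliardoIntegrand N s u)
        ((volume.restrict Ω).prod (volume.restrict Ω)) := by
  rw [memLp_two_iff_integrable_sq (gagliardoQuot_aesm hu)]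
  simp only [gagliardoQuot_sq]

theorem gagliardoQuot_add_ae (u v : Lp ℝ 2 (volume.restrict Ω)) :
    gagliardoQuot N s (u + v : Lp ℝ 2 (volume.restrict Ω))
      =ᵐ[(volume.restrict Ω).prod (volume.restrict Ω)]
      gagliardoQuot N s u + gagliardoQuot N s v := by
  filter_upwards [ae_eq_fst (Lp.coeFn_add u v), ae_eq_snd (Lp.coeFn_add u v)] with p h1 h2
  simp only [gagliardoQuot, Pi.add_apply] at *
  rw [h1, h2]
  ring

theorem gagliardoQuot_smul_ae (c : ℝ) (u : Lp ℝ 2 (volume.restrict Ω)) :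
    gagliardoQuot N s (c • u : Lp ℝ 2 (volume.restrict Ω))
      =ᵐ[(volume.restrict Ω).prod (volume.restrict Ω)] c • gagliardoQuot N s u := by
  filter_upwards [ae_eq_fst (Lp.coeFn_smul c u), ae_eq_snd (Lp.coeFn_smul c u)] with p h1 h2
  simp only [gagliardoQuot, Pi.smul_apply, smul_eq_mul] at *
  rw [h1, h2]
  ring

theorem gagliardoQuot_zero_ae :
    gagliardoQuot N s (0 : Lp ℝ 2 (volume.restrict Ω))
      =ᵐ[(volume.restrict Ω).prod (volume.restrict Ω)] 0 := by
  have h := gagliardoQuot_smul_ae (N := N) (s := s) (0 : ℝ) (0 : Lp ℝ 2 (volume.restrict Ω))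
  rw [zero_smul, zero_smul] at h
  exact h

end

/-- The functions `u ∈ L²(Ω)` with `∫_Ω ∫_Ω (u(x)-u(y))²/|x-y|^{N+2s} dx dy < ∞`, as a linear
subspace of `L²(Ω)`. -/
def HsSubmodule (N : ℕ) (s : ℝ) (Ω : Set (Eucl N)) :
    Submodule ℝ (Lp ℝ 2 (volume.restrict Ω)) where
  carrier := {u | Integrable (gagliardoIntegrand N s u)
    ((volume.restrict Ω).prod (volume.restrict Ω))}
  add_mem' := by
    intro u v hu hv
    have hu' := (gagliardoQuot_memLp_iff (Lp.aestronglyMeasurable u)).2 hu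
    have hv' := (gagliardoQuot_memLp_iff (Lp.aestronglyMeasurable v)).2 hv
    exact (gagliardoQuot_memLp_iff (Lp.aestronglyMeasurable (u + v))).1
      ((memLp_congr_ae (gagliardoQuot_add_ae u v)).2 (hu'.add hv'))
  zero_mem' := (gagliardoQuot_memLp_iff (Lp.aestronglyMeasurable _)).1
    ((memLp_congr_ae gagliardoQuot_zero_ae).2 MemLp.zero')
  smul_mem' := by
    intro c u hu
    have hu' := (gagliardoQuot_memLp_iff (Lp.aestronglyMeasurable u)).2 hu
    exact (gagliardoQuot_memLp_iff (Lp.aestronglyMeasurable (c • u))).1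
      ((memLp_congr_ae (gagliardoQuot_smul_ae c u)).2 (hu'.const_smul c))

/-- The fractional Sobolev space `H^s(Ω)`; its elements are classes of functions modulo equality
almost everywhere in `Ω`. It is a separate type because it carries the `H^s(Ω)`-norm, not the
`L²`-norm. -/
def Hs (N : ℕ) (s : ℝ) (Ω : Set (Eucl N)) : Type := ↥(HsSubmodule N s Ω)

namespace Hs

variable {N : ℕ} {s : ℝ} {Ω : Set (Eucl N)}

instance : AddCommGroup (Hs N s Ω) := inferInstanceAs (AddCommGroup ↥(HsSubmodule N s Ω))

instance : Module ℝ (Hs N s Ω) := inferInstanceAs (Module ℝ ↥(HsSubmodule N s Ω))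

/-- The underlying element of `L²(Ω)`. -/
def toL2 : Hs N s Ω →ₗ[ℝ] Lp ℝ 2 (volume.restrict Ω) := (HsSubmodule N s Ω).subtype

instance : CoeFun (Hs N s Ω) (fun _ => Eucl N → ℝ) := ⟨fun u => (toL2 u : Eucl N → ℝ)⟩

theorem toL2_injective : Function.Injective (toL2 : Hs N s Ω → Lp ℝ 2 (volume.restrict Ω)) :=
  Subtype.val_injective

theorem integrable_gagliardoIntegrand (u : Hs N s Ω) :
    Integrable (gagliardoIntegrand N s u) ((volume.restrict Ω).prod (volume.restrict Ω)) := u.2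

theorem memLp_gagliardoQuot (u : Hs N s Ω) :
    MemLp (gagliardoQuot N s u) 2 ((volume.restrict Ω).prod (volume.restrict Ω)) :=
  (gagliardoQuot_memLp_iff (Lp.aestronglyMeasurable _)).2 u.integrable_gagliardoIntegrand

/-- The quadratic form `Q_{N,s,Ω}(u) = (c_{N,s}/2) ∫_Ω ∫_Ω (u(x)-u(y))²/|x-y|^{N+2s} dx dy`. -/
def energy (u : Hs N s Ω) : ℝ :=
  fracConst N s / 2 *
    ∫ x in Ω, ∫ y in Ω, (u x - u y) ^ 2 / ‖x - y‖ ^ ((N : ℝ) + 2 * s)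

/-- The linear map `u ↦ (u, √(c_{N,s}/2) (u(x)-u(y))/|x-y|^{(N+2s)/2})` into
`L²(Ω) ⊕ L²(Ω × Ω)`, which is used to put the `H^s`-norm on `H^s(Ω)`. -/
def graphMap : Hs N s Ω →ₗ[ℝ] WithLp 2 (Lp ℝ 2 (volume.restrict Ω) ×
    Lp ℝ 2 ((volume.restrict Ω).prod (volume.restrict Ω))) where
  toFun u := WithLp.toLp 2 (toL2 u,
    Real.sqrt (fracConst N s / 2) • (memLp_gagliardoQuot u).toLp (gagliardoQuot N s u))
  map_add' u v := by
    have h : (memLp_gagliardoQuot (u + v)).toLp (gagliardoQuot N s (u + v : Hs N s Ω)) =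
        (memLp_gagliardoQuot u).toLp (gagliardoQuot N s u) +
          (memLp_gagliardoQuot v).toLp (gagliardoQuot N s v) := by
      rw [← MemLp.toLp_add]
      exact MemLp.toLp_congr _ _ (gagliardoQuot_add_ae (toL2 u) (toL2 v))
    rw [h, smul_add, map_add]
    rfl
  map_smul' c u := by
    have h : (memLp_gagliardoQuot (c • u)).toLp (gagliardoQuot N s (c • u : Hs N s Ω)) =
        c • (memLp_gagliardoQuot u).toLp (gagliardoQuot N s u) := by
      rw [← MemLp.toLp_const_smul]
      exact MemLp.toLp_congr _ _ (gagliardoQuot_smul_ae c (toL2 u))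
    rw [h, smul_comm, map_smul]
    rfl

theorem graphMap_injective : Function.Injective (graphMap : Hs N s Ω → _) := by
  intro u v h
  exact toL2_injective (congrArg (fun z => (WithLp.ofLp z).1) h)

instance : NormedAddCommGroup (Hs N s Ω) :=
  NormedAddCommGroup.induced _ _ (graphMap (N := N) (s := s) (Ω := Ω)) graphMap_injective

instance : NormedSpace ℝ (Hs N s Ω) :=
  NormedSpace.induced ℝ _ _ (graphMap (N := N) (s := s) (Ω := Ω))

/-- The norm of `H^s(Ω)` is `‖u‖² = ‖u‖²_{L²(Ω)} + Q_{N,s,Ω}(u)`. -/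
theorem norm_sq_eq (hs0 : 0 < s) (hs1 : s < 1) (u : Hs N s Ω) :
    ‖u‖ ^ 2 = (∫ x in Ω, u x ^ 2) + energy u := by
  have hc : 0 ≤ fracConst N s / 2 := by
    have := fracConst_pos N hs0 hs1
    positivity
  have key : ∀ {α : Type} [MeasurableSpace α] (μ : Measure α) (f : Lp ℝ 2 μ),
      ‖f‖ ^ 2 = ∫ x, f x ^ 2 ∂μ := by
    intro α _ μ f
    rw [← real_inner_self_eq_norm_sq, L2.inner_def]
    simp [sq]
  have h0 : ‖u‖ = ‖graphMap u‖ := rfl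
  rw [h0, WithLp.prod_norm_sq_eq_of_L2]
  have h1 : (graphMap u).fst = toL2 u := rfl
  have h2 : (graphMap u).snd = Real.sqrt (fracConst N s / 2) •
      (memLp_gagliardoQuot u).toLp (gagliardoQuot N s u) := rfl
  rw [h1, h2, norm_smul, mul_pow, Real.norm_of_nonneg (Real.sqrt_nonneg _), Real.sq_sqrt hc,
    key, key]
  congr 1
  unfold energy
  congr 1
  have h3 : ∫ p, ((memLp_gagliardoQuot u).toLp (gagliardoQuot N s u) p) ^ 2
      ∂((volume.restrict Ω).prod (volume.restrict Ω)) =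
      ∫ p, gagliardoIntegrand N s u p ∂((volume.restrict Ω).prod (volume.restrict Ω)) := by
    apply integral_congr_ae
    filter_upwards [MemLp.coeFn_toLp (memLp_gagliardoQuot u)] with p hp
    rw [hp, gagliardoQuot_sq]
  rw [h3, integral_prod _ u.integrable_gagliardoIntegrand]
  rfl

end Hs

/-- `φ ∈ C^∞_c(Ω)`. -/
def IsTestFunction {N : ℕ} (Ω : Set (Eucl N)) (φ : Eucl N → ℝ) : Prop :=
  ContDiff ℝ ∞ φ ∧ HasCompactSupport φ ∧ tsupport φ ⊆ Ω

/-- `φ(x)` depends only on `|x|`. -/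
def IsRadial {N : ℕ} (φ : Eucl N → ℝ) : Prop := ∀ x y, ‖x‖ = ‖y‖ → φ x = φ y

theorem IsTestFunction.add {N : ℕ} {Ω : Set (Eucl N)} {φ ψ : Eucl N → ℝ}
    (h1 : IsTestFunction Ω φ) (h2 : IsTestFunction Ω ψ) : IsTestFunction Ω (φ + ψ) :=
  ⟨h1.1.add h2.1, h1.2.1.add h2.2.1,
    (tsupport_add φ ψ).trans (union_subset h1.2.2 h2.2.2)⟩

theorem IsTestFunction.smul {N : ℕ} {Ω : Set (Eucl N)} {φ : Eucl N → ℝ} (c : ℝ)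
    (h : IsTestFunction Ω φ) : IsTestFunction Ω (c • φ) :=
  ⟨contDiff_const.smul h.1, h.2.1.mono (Function.support_const_smul_subset c φ),
    (closure_mono (Function.support_const_smul_subset c φ)).trans h.2.2⟩

theorem IsTestFunction.zero {N : ℕ} {Ω : Set (Eucl N)} :
    IsTestFunction Ω (0 : Eucl N → ℝ) :=
  ⟨contDiff_const, HasCompactSupport.zero, by simp [tsupport]⟩

/-- `C^∞_c(Ω)` as a linear subspace of `H^s(Ω)`. -/
def testSubspace (N : ℕ) (s : ℝ) (Ω : Set (Eucl N)) : Submodule ℝ (Hs N s Ω) where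
  carrier := {u | ∃ φ, IsTestFunction Ω φ ∧ u =ᵐ[volume.restrict Ω] φ}
  add_mem' := by
    rintro u v ⟨φ, hφ, hu⟩ ⟨ψ, hψ, hv⟩
    refine ⟨φ + ψ, hφ.add hψ, ?_⟩
    rw [map_add]
    exact (Lp.coeFn_add _ _).trans (hu.add hv)
  zero_mem' := ⟨0, IsTestFunction.zero, by rw [map_zero]; exact Lp.coeFn_zero _ _ _⟩
  smul_mem' := by
    rintro c u ⟨φ, hφ, hu⟩
    refine ⟨c • φ, hφ.smul c, ?_⟩
    rw [map_smul]
    exact (Lp.coeFn_smul _ _).trans (hu.const_smul c)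

/-- The radial functions in `C^∞_c(Ω)` as a linear subspace of `H^s(Ω)`. -/
def radialTestSubspace (N : ℕ) (s : ℝ) (Ω : Set (Eucl N)) : Submodule ℝ (Hs N s Ω) where
  carrier := {u | ∃ φ, IsTestFunction Ω φ ∧ IsRadial φ ∧ u =ᵐ[volume.restrict Ω] φ}
  add_mem' := by
    rintro u v ⟨φ, hφ, hφr, hu⟩ ⟨ψ, hψ, hψr, hv⟩
    refine ⟨φ + ψ, hφ.add hψ, fun x y h => by simp [hφr x y h, hψr x y h], ?_⟩
    rw [map_add]
    exact (Lp.coeFn_add _ _).trans (hu.add hv)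
  zero_mem' := ⟨0, IsTestFunction.zero, fun _ _ _ => rfl, by
    rw [map_zero]; exact Lp.coeFn_zero _ _ _⟩
  smul_mem' := by
    rintro c u ⟨φ, hφ, hφr, hu⟩
    refine ⟨c • φ, hφ.smul c, fun x y h => by simp [hφr x y h], ?_⟩
    rw [map_smul]
    exact (Lp.coeFn_smul _ _).trans (hu.const_smul c)

/-- `H^s_0(Ω)`: the completion (closure in `H^s(Ω)`) of `C^∞_c(Ω)` for the `H^s(Ω)`-norm. -/
def Hs0 (N : ℕ) (s : ℝ) (Ω : Set (Eucl N)) : Submodule ℝ (Hs N s Ω) :=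
  (testSubspace N s Ω).topologicalClosure

/-- `H^s_{0,rad}(Ω)`: the completion (closure in `H^s(Ω)`) of the radial functions of
`C^∞_c(Ω)` for the `H^s(Ω)`-norm. -/
def Hs0rad (N : ℕ) (s : ℝ) (Ω : Set (Eucl N)) : Submodule ℝ (Hs N s Ω) :=
  (radialTestSubspace N s Ω).topologicalClosure

/-- The open unit ball of `ℝ^N` centered at the origin. -/
def unitBall (N : ℕ) : Set (Eucl N) := Metric.ball 0 1

/-- The critical exponent `2^*_s = 2N/(N-2s)`. -/
def critExp (N : ℕ) (s : ℝ) : ℝ := 2 * N / (N - 2 * s)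

/-- The norm of `u` in `L^{2^*_s}(Ω)`. -/
def critNorm {N : ℕ} {s : ℝ} {Ω : Set (Eucl N)} (u : Hs N s Ω) : ℝ :=
  (eLpNorm u (ENNReal.ofReal (critExp N s)) (volume.restrict Ω)).toReal

/-- The quadratic form `Q_{N,s,Ω}(u) + ∫_Ω h u² dx`. -/
def energyWith {N : ℕ} {s : ℝ} {Ω : Set (Eucl N)} (h : Eucl N → ℝ) (u : Hs N s Ω) : ℝ :=
  u.energy + ∫ x in Ω, h x * u x ^ 2

/-- The quotient `(Q_{N,s,Ω}(u) + ∫_Ω h u² dx) / ‖u‖²_{L^{2^*_s}(Ω)}`. -/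
def sobolevQuotient {N : ℕ} {s : ℝ} {Ω : Set (Eucl N)} (h : Eucl N → ℝ) (u : Hs N s Ω) : ℝ :=
  energyWith h u / critNorm u ^ 2

/-- `S_{N,s}(Ω)`, the infimum of `Q_{N,s,Ω}(u) / ‖u‖²_{L^{2^*_s}(Ω)}` over `0 ≠ u ∈ H^s_0(Ω)`. -/
def sobolevConst (N : ℕ) (s : ℝ) (Ω : Set (Eucl N)) : ℝ :=
  sInf {q | ∃ u ∈ Hs0 N s Ω, u ≠ 0 ∧ q = u.energy / critNorm u ^ 2}

/-- `S_{N,s,rad}(Ω,h)`, the infimum of `(Q_{N,s,Ω}(u) + ∫_Ω h u² dx) / ‖u‖²_{L^{2^*_s}(Ω)}` over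
`0 ≠ u ∈ H^s_{0,rad}(Ω)`. -/
def sobolevConstRad (N : ℕ) (s : ℝ) (Ω : Set (Eucl N)) (h : Eucl N → ℝ) : ℝ :=
  sInf {q | ∃ u ∈ Hs0rad N s Ω, u ≠ 0 ∧ q = sobolevQuotient h u}

/-- `(u_k)` is a sequence of nonzero elements of `H^s_{0,rad}(Ω)` along which the quotient tends to
the infimum `S_{N,s,rad}(Ω,h)`. -/
def IsMinimizingSeq {N : ℕ} {s : ℝ} {Ω : Set (Eucl N)} (h : Eucl N → ℝ)
    (u : ℕ → Hs0rad N s Ω) : Prop :=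
  (∀ k, u k ≠ 0) ∧
    Tendsto (fun k => sobolevQuotient h (u k : Hs N s Ω)) atTop (𝓝 (sobolevConstRad N s Ω h))

/-- `h ∈ L^∞(Ω)` and `h` is (almost everywhere in `Ω`) a function of `|x|`. -/
def IsRadialLInfty {N : ℕ} (Ω : Set (Eucl N)) (h : Eucl N → ℝ) : Prop :=
  MemLp h ⊤ (volume.restrict Ω) ∧
    ∃ g : ℝ → ℝ, h =ᵐ[volume.restrict Ω] fun x => g ‖x‖

end

/-! Write S for the radial infimum on the ball and S₀ for the Sobolev constant of the whole space. A
normalized minimizing family is bounded in `H^s`, so along an ultrafilter it converges weakly to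
some z; put v = u - z. Everything rests on the fact that v can lose compactness only at the origin.
Let L and a be the limits of the critical norms of u and v, and q the limit of the energy of v.
Three relations decide the matter.

First, v → 0 in L², so the energy and potential terms split and S L² = E(z) + q, where E is the form
including h, with E(z) ≥ S ‖z‖² in the critical norm. Second, q ≥ S₀ a²: a cutoff moves v to the
whole space, and the errors contain the L² norm of v. Third, L² ≤ a² + ‖z‖²: near the origin z
carries little critical mass, away from it v carries little, and the ℓ^p norm is below the ℓ² norm
for p ≥ 2; this replaces a Brezis–Lieb splitting. Together they give (S₀ - S) a² ≤ 0, hence a = 0,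
then q = 0, and the convergence is strong (`exists_tendsto_of_minimizing`).

The behaviour away from the origin comes from radial symmetry and s > 1/2. For radial functions,
averaging over a thin shell costs no more than averaging over its part near a given point
(`setLIntegral_shell_le`), so the energy controls oscillation as in dimension one. Comparing means
over shrinking shells gives a Hölder bound (`sub_sq_le_morrey`). Since test functions vanish on the
unit sphere, this yields a uniform bound away from the origin, a Poincaré inequality and compactness
in L² (`exists_norm_toL2_sq_le_sum`). Interpolating the uniform bound with L² handles the critical
norm there (`exists_outer_norm_le`), and `exists_sqrt_sobolevConst_mul_critNorm_le` compares with
S₀.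

The Sobolev inequalities themselves are consequences of S > 0 and S₀ > 0: the conventions for
`sInf`, division by zero and `toReal` make a positive infimum exclude every degenerate case. -/

noncomputable section

/-! ### Hilbert space structure of `H^s` and weak limits -/

namespace Hs

variable {N : ℕ} {s : ℝ} {Ω : Set (Eucl N)}

/-- `graphMap` is isometric. -/
def graphIsometry : Hs N s Ω →ₗᵢ[ℝ] WithLp 2 (Lp ℝ 2 (volume.restrict Ω) ×
    Lp ℝ 2 ((volume.restrict Ω).prod (volume.restrict Ω))) where
  toLinearMap := graphMap
  norm_map' _ := rfl

theorem graphIsometry_fst (u : Hs N s Ω) : (graphIsometry u).fst = toL2 u := rfl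

theorem graphIsometry_snd (u : Hs N s Ω) :
    (graphIsometry u).snd = Real.sqrt (fracConst N s / 2) •
      (memLp_gagliardoQuot u).toLp (gagliardoQuot N s u) := rfl

theorem norm_sq_eq_toL2_add (u : Hs N s Ω) :
    ‖u‖ ^ 2 = ‖toL2 u‖ ^ 2 + ‖(graphIsometry u).snd‖ ^ 2 := by
  rw [← graphIsometry.norm_map u, WithLp.prod_norm_sq_eq_of_L2, graphIsometry_fst]

theorem _root_.Lp_two_norm_sq {α : Type*} [MeasurableSpace α] {μ : Measure α} (f : Lp ℝ 2 μ) :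
    ‖f‖ ^ 2 = ∫ x, f x ^ 2 ∂μ := by
  rw [← real_inner_self_eq_norm_sq, L2.inner_def]
  simp [sq]

theorem energy_eq_norm_sq (hs0 : 0 < s) (hs1 : s < 1) (u : Hs N s Ω) :
    energy u = ‖(graphIsometry u).snd‖ ^ 2 := by
  have h1 := norm_sq_eq hs0 hs1 u
  have h2 := norm_sq_eq_toL2_add u
  rw [Lp_two_norm_sq (toL2 u)] at h2
  linarith

theorem energy_nonneg (hs0 : 0 < s) (hs1 : s < 1) (u : Hs N s Ω) : 0 ≤ energy u := by
  rw [energy_eq_norm_sq hs0 hs1]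
  positivity

theorem norm_sq_eq_toL2_add_energy (hs0 : 0 < s) (hs1 : s < 1) (u : Hs N s Ω) :
    ‖u‖ ^ 2 = ‖toL2 u‖ ^ 2 + energy u := by
  rw [energy_eq_norm_sq hs0 hs1, norm_sq_eq_toL2_add]

theorem norm_toL2_le (u : Hs N s Ω) : ‖toL2 u‖ ≤ ‖u‖ := by
  rw [← graphIsometry.norm_map u, ← graphIsometry_fst]
  exact WithLp.norm_fst_le _ _

theorem energy_le_norm_sq (hs0 : 0 < s) (hs1 : s < 1) (u : Hs N s Ω) : energy u ≤ ‖u‖ ^ 2 := by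
  rw [norm_sq_eq_toL2_add_energy hs0 hs1]
  nlinarith [sq_nonneg ‖toL2 u‖]

theorem continuous_toL2 : Continuous (toL2 : Hs N s Ω → _) := by
  have h : (toL2 : Hs N s Ω → _) = fun u => (graphIsometry u).fst := rfl
  rw [h]
  exact (WithLp.prod_continuous_ofLp 2 _ _).fst.comp graphIsometry.continuous

theorem continuous_graphIsometry_snd :
    Continuous (fun u : Hs N s Ω => (graphIsometry u).snd) :=
  (WithLp.prod_continuous_ofLp 2 _ _).snd.comp graphIsometry.continuous

theorem continuous_energy (hs0 : 0 < s) (hs1 : s < 1) :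
    Continuous (energy : Hs N s Ω → ℝ) := by
  have h : (energy : Hs N s Ω → ℝ) = fun u => ‖(graphIsometry u).snd‖ ^ 2 :=
    funext (energy_eq_norm_sq hs0 hs1)
  rw [h]
  exact continuous_graphIsometry_snd.norm.pow 2

theorem energy_smul (c : ℝ) (hs0 : 0 < s) (hs1 : s < 1) (u : Hs N s Ω) :
    energy (c • u) = c ^ 2 * energy u := by
  rw [energy_eq_norm_sq hs0 hs1, energy_eq_norm_sq hs0 hs1, map_smul, WithLp.smul_snd, norm_smul,
    mul_pow, Real.norm_eq_abs, sq_abs]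

theorem energy_add (hs0 : 0 < s) (hs1 : s < 1) (u v : Hs N s Ω) :
    energy (u + v) = energy u +
      2 * inner ℝ (graphIsometry u).snd (graphIsometry v).snd + energy v := by
  rw [energy_eq_norm_sq hs0 hs1, energy_eq_norm_sq hs0 hs1, energy_eq_norm_sq hs0 hs1, map_add,
    WithLp.add_snd, norm_add_sq_real]

/-- The image of `H^s(Ω)` under the graph map is closed. -/
theorem isClosed_range_graphIsometry (hs0 : 0 < s) (hs1 : s < 1) :
    IsClosed (range (graphIsometry : Hs N s Ω →ₗᵢ[ℝ] _)) := by
  have hc : 0 < Real.sqrt (fracConst N s / 2) := Real.sqrt_pos.2 (half_pos (fracConst_pos N hs0 hs1))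
  refine isSeqClosed_iff_isClosed.1 ?_
  intro x z hx hz
  choose u hu using hx
  have h1 : Tendsto (fun n => toL2 (u n)) atTop (𝓝 z.fst) := by
    have := ((WithLp.prod_continuous_ofLp 2 _ _).fst.tendsto z).comp hz
    refine this.congr fun n => ?_
    rw [← graphIsometry_fst, hu]
    rfl
  have h2 : Tendsto (fun n => (graphIsometry (u n)).snd) atTop (𝓝 z.snd) := by
    have := ((WithLp.prod_continuous_ofLp 2 _ _).snd.tendsto z).comp hz
    refine this.congr fun n => ?_
    rw [hu]
    rfl
  -- Along a common subsequence both components converge almost everywhere, which identifies the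
  -- second component of the limit with the scaled difference quotient of the first.
  obtain ⟨φ, hφ, hφa⟩ := (tendstoInMeasure_of_tendsto_Lp h1).exists_seq_tendsto_ae
  obtain ⟨ψ, hψ, hψa⟩ := (tendstoInMeasure_of_tendsto_Lp
    (h2.comp hφ.tendsto_atTop)).exists_seq_tendsto_ae
  have e1 := (Measure.quasiMeasurePreserving_fst
    (μ := volume.restrict Ω) (ν := volume.restrict Ω)).ae hφa
  have e2 := (Measure.quasiMeasurePreserving_snd
    (μ := volume.restrict Ω) (ν := volume.restrict Ω)).ae hφa
  have e3 : ∀ᵐ p ∂((volume.restrict Ω).prod (volume.restrict Ω)), ∀ n,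
      (graphIsometry (u n)).snd p =
        Real.sqrt (fracConst N s / 2) * gagliardoQuot N s (u n) p := by
    refine ae_all_iff.2 fun n => ?_
    rw [graphIsometry_snd]
    filter_upwards [Lp.coeFn_smul (Real.sqrt (fracConst N s / 2))
      ((memLp_gagliardoQuot (u n)).toLp (gagliardoQuot N s (u n))),
      MemLp.coeFn_toLp (memLp_gagliardoQuot (u n))] with p hp hp'
    rw [hp, Pi.smul_apply, hp', smul_eq_mul]
  have key : gagliardoQuot N s z.fst =ᵐ[(volume.restrict Ω).prod (volume.restrict Ω)]
      (Real.sqrt (fracConst N s / 2))⁻¹ • z.snd := by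
    filter_upwards [e1, e2, e3, hψa] with p p1 p2 p3 p4
    have l1 : Tendsto (fun n => Real.sqrt (fracConst N s / 2) *
        gagliardoQuot N s (u (φ (ψ n))) p) atTop
        (𝓝 (Real.sqrt (fracConst N s / 2) * gagliardoQuot N s z.fst p)) :=
      (((p1.comp hψ.tendsto_atTop).sub (p2.comp hψ.tendsto_atTop)).div_const _).const_mul _
    have l2 : Tendsto (fun n => Real.sqrt (fracConst N s / 2) *
        gagliardoQuot N s (u (φ (ψ n))) p) atTop (𝓝 (z.snd p)) := by
      refine p4.congr fun n => ?_
      exact p3 _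
    have := tendsto_nhds_unique l1 l2
    rw [Pi.smul_apply, smul_eq_mul, ← this]
    field_simp
  have hmem : MemLp (gagliardoQuot N s z.fst) 2
      ((volume.restrict Ω).prod (volume.restrict Ω)) :=
    (memLp_congr_ae key).2 ((Lp.memLp z.snd).const_smul _)
  let w : Hs N s Ω := ⟨z.fst, (gagliardoQuot_memLp_iff (Lp.aestronglyMeasurable _)).1 hmem⟩
  refine ⟨w, ?_⟩
  have hsnd : (graphIsometry w).snd = z.snd := by
    rw [graphIsometry_snd]
    apply Lp.ext
    filter_upwards [Lp.coeFn_smul (Real.sqrt (fracConst N s / 2))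
      ((memLp_gagliardoQuot w).toLp (gagliardoQuot N s w)),
      MemLp.coeFn_toLp (memLp_gagliardoQuot w), key] with p hp hp' hp''
    rw [hp, Pi.smul_apply, hp', smul_eq_mul]
    have : gagliardoQuot N s w p = gagliardoQuot N s z.fst p := rfl
    rw [this, hp'', Pi.smul_apply, smul_eq_mul]
    field_simp
  have hfst : (graphIsometry w).fst = z.fst := rfl
  exact WithLp.ofLp_injective 2 (Prod.ext hfst hsnd)

theorem completeSpace (hs0 : 0 < s) (hs1 : s < 1) : CompleteSpace (Hs N s Ω) :=
  (completeSpace_iff_isComplete_range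
    (graphIsometry (N := N) (s := s) (Ω := Ω)).isometry.isUniformInducing).2
    (isClosed_range_graphIsometry hs0 hs1).isComplete

end Hs

/-- Bounded families in a Hilbert space converge weakly along ultrafilters. -/
theorem Ultrafilter.exists_weak_limit {ι X : Type*} [NormedAddCommGroup X] [InnerProductSpace ℝ X]
    [CompleteSpace X] (U : Ultrafilter ι) (x : ι → X) (R : ℝ) (hx : ∀ i, ‖x i‖ ≤ R) :
    ∃ z : X, ∀ y, Tendsto (fun i => inner ℝ (x i) y) U (𝓝 (inner ℝ z y)) := by
  -- By Riesz the family lies in a closed ball of the dual, which is weak-* compact by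
  -- Banach–Alaoglu.
  let f : ι → WeakDual ℝ X := fun i => StrongDual.toWeakDual (InnerProductSpace.toDual ℝ X (x i))
  have hK := WeakDual.isCompact_closedBall (𝕜 := ℝ) (E := X) 0 R
  obtain ⟨g, -, hg⟩ := hK.ultrafilter_le_nhds (U.map f) (by
    refine tendsto_principal.2 (Eventually.of_forall fun i => ?_)
    change InnerProductSpace.toDual ℝ X (x i) ∈ Metric.closedBall 0 R
    rw [mem_closedBall_zero_iff, LinearIsometryEquiv.norm_map]
    exact hx i)
  refine ⟨(InnerProductSpace.toDual ℝ X).symm (WeakDual.toStrongDual g), fun y => ?_⟩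
  have h1 : Tendsto f U (𝓝 g) := hg
  have h2 : Tendsto (fun i => f i y) U (𝓝 (g y)) :=
    ((WeakDual.eval_continuous y).tendsto g).comp h1
  rw [InnerProductSpace.toDual_symm_apply]
  exact h2

/-- Bounded families in a complete subspace of `H^s(Ω)` converge weakly along ultrafilters. -/
theorem Hs.exists_weak_limit {N : ℕ} {s : ℝ} {Ω : Set (Eucl N)} (hs0 : 0 < s) (hs1 : s < 1)
    {V : Submodule ℝ (Hs N s Ω)} (hV : IsClosed (V : Set (Hs N s Ω))) {ι : Type*}
    (U : Ultrafilter ι) (x : ι → Hs N s Ω) (hxV : ∀ i, x i ∈ V) (R : ℝ) (hx : ∀ i, ‖x i‖ ≤ R) :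
    ∃ z ∈ V, ∀ y, Tendsto (fun i => inner ℝ (Hs.graphIsometry (x i - z)) y) U (𝓝 0) := by
  obtain ⟨w, hw⟩ := U.exists_weak_limit (fun i => Hs.graphIsometry (x i)) R
    (fun i => by rw [LinearIsometry.norm_map]; exact hx i)
  let K := V.map (Hs.graphIsometry (N := N) (s := s) (Ω := Ω)).toLinearMap
  have := Hs.completeSpace (N := N) (Ω := Ω) hs0 hs1
  have hK : IsClosed (SetLike.coe K) := by
    exact Hs.graphIsometry.isometry.isClosedEmbedding.isClosedMap _ hV
  -- A norm-closed subspace is weakly closed: w is orthogonal to the orthogonal complement of `K`,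
  -- as a limit of vanishing inner products.
  have hwK : w ∈ K := by
    have hc : CompleteSpace K := hK.completeSpace_coe
    rw [← Submodule.orthogonal_orthogonal K, Submodule.mem_orthogonal]
    intro y hy
    have h1 := hw y
    have h2 : ∀ i, inner ℝ (Hs.graphIsometry (x i)) y = 0 := fun i =>
      (Submodule.mem_orthogonal K y).1 hy _ ⟨x i, hxV i, rfl⟩
    simp only [h2] at h1
    rw [real_inner_comm]
    exact tendsto_nhds_unique h1 tendsto_const_nhds
  obtain ⟨z, hz, rfl⟩ := hwK
  refine ⟨z, hz, fun y => ?_⟩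
  have h3 := (hw y).sub_const (inner ℝ (Hs.graphIsometry z) y)
  simp only [LinearIsometry.coe_toLinearMap, sub_self] at h3
  refine h3.congr fun i => ?_
  rw [map_sub, inner_sub_left]


/-! ### Radial integrals over cones, caps and thin shells -/

section Cones

variable {E : Type*} [NormedAddCommGroup E] [NormedSpace ℝ E] [MeasurableSpace E] [BorelSpace E]
  [FiniteDimensional ℝ E] (μ : Measure E) [μ.IsAddHaarMeasure]

/-- The cone of vectors whose direction is at distance less than `ℓ` from `e`. -/
def coneAt (e : E) (ℓ : ℝ) : Set E := {y | y ≠ 0 ∧ ‖‖y‖⁻¹ • y - e‖ < ℓ}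

omit [FiniteDimensional ℝ E] in
theorem measurableSet_coneAt (e : E) (ℓ : ℝ) : MeasurableSet (coneAt e ℓ) := by
  have h1 : MeasurableSet {y : E | y ≠ 0} := (measurableSet_singleton (0 : E)).compl
  have h2 : MeasurableSet {y : E | ‖‖y‖⁻¹ • y - e‖ < ℓ} := by
    have : Measurable fun y : E => ‖‖y‖⁻¹ • y - e‖ := by
      have h3 : Measurable fun y : E => ‖y‖⁻¹ • y := by
        have := (continuous_norm (E := E)).measurable
        exact this.inv.smul measurable_id
      exact (continuous_norm.comp (continuous_id.sub continuous_const)).measurable.comp h3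
    exact measurableSet_lt this measurable_const
  exact h1.inter h2

/-- Polar coordinates in a cone. -/
theorem setLIntegral_coneAt_norm (e : E) (ℓ : ℝ) {f : ℝ → ℝ≥0∞} (hf : Measurable f) :
    ∫⁻ y in coneAt e ℓ, f ‖y‖ ∂μ =
      μ.toSphere {z | ‖(z : E) - e‖ < ℓ} *
        ∫⁻ t in Ioi (0 : ℝ), ENNReal.ofReal (t ^ (Module.finrank ℝ E - 1)) * f t := by
  set K : Set (Metric.sphere (0 : E) 1) := {z | ‖(z : E) - e‖ < ℓ} with hK
  have hKm : MeasurableSet K := by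
    apply measurableSet_lt _ measurable_const
    fun_prop
  have hpow : Measurable fun t : Ioi (0 : ℝ) =>
      ENNReal.ofReal ((t : ℝ) ^ (Module.finrank ℝ E - 1)) := by fun_prop
  have hft : Measurable fun t : Ioi (0 : ℝ) => f t := hf.comp measurable_subtype_coe
  calc ∫⁻ y in coneAt e ℓ, f ‖y‖ ∂μ
      = ∫⁻ y in ({0}ᶜ : Set E), (coneAt e ℓ).indicator (fun y => f ‖y‖) y ∂μ := by
        rw [lintegral_indicator (measurableSet_coneAt e ℓ),
          Measure.restrict_restrict (measurableSet_coneAt e ℓ)]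
        congr 2
        exact (inter_eq_left.2 fun y hy => hy.1).symm
    _ = ∫⁻ y : ({0}ᶜ : Set E), (coneAt e ℓ).indicator (fun y => f ‖y‖) y ∂(μ.comap (↑)) :=
        (lintegral_subtype_comap (measurableSet_singleton (0 : E)).compl _).symm
    _ = ∫⁻ p, K.indicator 1 p.1 * f p.2 ∂(μ.toSphere.prod
          (Measure.volumeIoiPow (Module.finrank ℝ E - 1))) := by
        rw [← μ.measurePreserving_homeomorphUnitSphereProd.lintegral_comp_emb
          (Homeomorph.measurableEmbedding _)]
        refine lintegral_congr fun y => ?_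
        have hy : (y : E) ≠ 0 := y.2
        have hy2 : ((homeomorphUnitSphereProd E y).1 : E) = ‖(y : E)‖⁻¹ • (y : E) := by simp
        by_cases h : ‖‖(y : E)‖⁻¹ • (y : E) - e‖ < ℓ
        · rw [indicator_of_mem (show (y : E) ∈ coneAt e ℓ from ⟨hy, h⟩),
            indicator_of_mem (show (homeomorphUnitSphereProd E y).1 ∈ K by
              rw [hK, mem_ofPred_eq, hy2]; exact h)]
          simp
        · rw [indicator_of_notMem (show (y : E) ∉ coneAt e ℓ from fun h' => h h'.2),
            indicator_of_notMem (show (homeomorphUnitSphereProd E y).1 ∉ K by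
              rw [hK, mem_ofPred_eq, hy2]; exact h)]
          simp
    _ = μ.toSphere K * ∫⁻ t, f t ∂(Measure.volumeIoiPow (Module.finrank ℝ E - 1)) := by
        rw [lintegral_prod_mul (f := K.indicator 1) (g := fun t : Ioi (0 : ℝ) => f t)
          (measurable_one.indicator hKm).aemeasurable hft.aemeasurable, lintegral_indicator_one hKm]
    _ = _ := by
        congr 1
        rw [Measure.volumeIoiPow, lintegral_withDensity_eq_lintegral_mul _ hpow hft,
          ← lintegral_subtype_comap measurableSet_Ioi]
        rfl

/-- Caps of radius `ℓ` on the unit sphere have measure at least of order `ℓ ^ (dim E - 1)`. -/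
theorem cap_measure_ge [Nontrivial E] {e : E} (he : ‖e‖ = 1) {ℓ : ℝ} (h0 : 0 < ℓ) (h1 : ℓ ≤ 1) :
    ENNReal.ofReal (ℓ ^ (Module.finrank ℝ E - 1)) * μ (Metric.ball 0 1) ≤
      ENNReal.ofReal (4 ^ Module.finrank ℝ E) * μ.toSphere {z | ‖(z : E) - e‖ < ℓ} := by
  set d := Module.finrank ℝ E with hd
  have hdpos : 0 < d := Module.finrank_pos
  -- Projecting y to the sphere moves it by |‖y‖ - 1| ≤ ‖y - e‖. The volume of this ball, of order
  -- ℓ^d, is then at most the cap measure times a radial integral of order ℓ; dividing by ℓ leaves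
  -- ℓ^(d-1).
  have hsub : Metric.ball e (ℓ / 2) ⊆ coneAt e ℓ ∩ {y | ‖y‖ ∈ Ioo (1 - ℓ / 2) (1 + ℓ / 2)} := by
    intro y hy
    rw [mem_ball_iff_norm] at hy
    have h2 : |‖y‖ - 1| ≤ ‖y - e‖ := by rw [← he]; exact abs_norm_sub_norm_le y e
    have h3 := abs_le.1 (h2.trans hy.le)
    have h2' := abs_lt.1 (h2.trans_lt hy)
    have hy0 : 0 < ‖y‖ := by linarith
    refine ⟨⟨norm_pos_iff.1 hy0, ?_⟩, ⟨by linarith, by linarith⟩⟩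
    have h4 : ‖‖y‖⁻¹ • y - y‖ = |‖y‖ - 1| := by
      have : ‖y‖⁻¹ • y - y = (‖y‖⁻¹ - 1) • y := by rw [sub_smul, one_smul]
      rw [this, norm_smul, Real.norm_eq_abs, ← abs_of_pos hy0, ← abs_mul, abs_of_pos hy0, sub_mul,
        inv_mul_cancel₀ hy0.ne', one_mul, abs_sub_comm]
    calc ‖‖y‖⁻¹ • y - e‖ ≤ ‖‖y‖⁻¹ • y - y‖ + ‖y - e‖ := norm_sub_le_norm_sub_add_norm_sub _ _ _
      _ < ℓ := by rw [h4]; linarith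
  set f : ℝ → ℝ≥0∞ := (Ioo (1 - ℓ / 2) (1 + ℓ / 2)).indicator 1 with hf
  have hfm : Measurable f := measurable_one.indicator measurableSet_Ioo
  have hA : MeasurableSet {y : E | ‖y‖ ∈ Ioo (1 - ℓ / 2) (1 + ℓ / 2)} :=
    measurableSet_Ioo.preimage continuous_norm.measurable
  have h5 : μ (Metric.ball e (ℓ / 2)) ≤ ∫⁻ y in coneAt e ℓ, f ‖y‖ ∂μ := by
    calc μ (Metric.ball e (ℓ / 2))
        ≤ μ (coneAt e ℓ ∩ {y | ‖y‖ ∈ Ioo (1 - ℓ / 2) (1 + ℓ / 2)}) := measure_mono hsub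
      _ = ∫⁻ y in coneAt e ℓ, {y : E | ‖y‖ ∈ Ioo (1 - ℓ / 2) (1 + ℓ / 2)}.indicator 1 y ∂μ := by
          rw [lintegral_indicator_one hA, Measure.restrict_apply hA, inter_comm]
      _ = _ := rfl
  have h6 : ∫⁻ t in Ioi (0 : ℝ), ENNReal.ofReal (t ^ (d - 1)) * f t ≤
      ENNReal.ofReal (2 ^ (d - 1) * ℓ) := by
    calc ∫⁻ t in Ioi (0 : ℝ), ENNReal.ofReal (t ^ (d - 1)) * f t
        ≤ ∫⁻ t, (Ioo (1 - ℓ / 2) (1 + ℓ / 2)).indicator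
            (fun _ => ENNReal.ofReal (2 ^ (d - 1))) t := by
          refine (setLIntegral_le_lintegral _ _).trans (lintegral_mono fun t => ?_)
          by_cases ht : t ∈ Ioo (1 - ℓ / 2) (1 + ℓ / 2)
          · simp only [hf, indicator_of_mem ht, Pi.one_apply, mul_one]
            refine ENNReal.ofReal_le_ofReal (pow_le_pow_left₀ ?_ ?_ _)
            · linarith [ht.1]
            · linarith [ht.2]
          · simp [hf, indicator_of_notMem ht]
      _ = _ := by
          rw [lintegral_indicator_const measurableSet_Ioo, Real.volume_Ioo,
            ← ENNReal.ofReal_mul (by positivity)]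
          congr 2
          ring
  rw [setLIntegral_coneAt_norm μ e ℓ hfm, Measure.addHaar_ball μ e (by positivity)] at h5
  have h7 := h5.trans (mul_le_mul_right h6 _)
  have h8 : ℓ ^ d = ℓ ^ (d - 1) * ℓ := by rw [← pow_succ, Nat.sub_add_cancel hdpos]
  have h9 : (2 : ℝ) ^ d = 2 ^ (d - 1) * 2 := by rw [← pow_succ, Nat.sub_add_cancel hdpos]
  have h10 : ENNReal.ofReal (ℓ ^ (d - 1)) =
      ENNReal.ofReal (2 ^ d / ℓ) * ENNReal.ofReal ((ℓ / 2) ^ d) := by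
    rw [← ENNReal.ofReal_mul (by positivity)]
    congr 1
    rw [div_pow, h8]
    field_simp
  calc ENNReal.ofReal (ℓ ^ (d - 1)) * μ (Metric.ball 0 1)
      = ENNReal.ofReal (2 ^ d / ℓ) * (ENNReal.ofReal ((ℓ / 2) ^ d) * μ (Metric.ball 0 1)) := by
        rw [h10, mul_assoc]
    _ ≤ ENNReal.ofReal (2 ^ d / ℓ) * (μ.toSphere {z | ‖(z : E) - e‖ < ℓ} *
          ENNReal.ofReal (2 ^ (d - 1) * ℓ)) := mul_le_mul_right h7 _
    _ = ENNReal.ofReal (2 ^ d * 2 ^ (d - 1)) * μ.toSphere {z | ‖(z : E) - e‖ < ℓ} := by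
        rw [mul_comm (μ.toSphere _), ← mul_assoc, ← ENNReal.ofReal_mul (by positivity)]
        congr 2
        field_simp
    _ ≤ _ := by
        gcongr
        rw [show (4 : ℝ) = 2 * 2 by norm_num, mul_pow]
        gcongr
        · norm_num
        · omega

/-- The shell `{a ≤ ‖y‖ < b}`. -/
def shell (E : Type*) [NormedAddCommGroup E] (a b : ℝ) : Set E := {y | a ≤ ‖y‖ ∧ ‖y‖ < b}

omit [NormedSpace ℝ E] [FiniteDimensional ℝ E] in
theorem measurableSet_shell (a b : ℝ) : MeasurableSet (shell E a b) :=
  measurableSet_Ico.preimage continuous_norm.measurable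

/-- The integral of a radial function over a thin shell is controlled by its integral over the
part of the shell that is close to a given point of the shell. -/
theorem setLIntegral_shell_le [Nontrivial E] {a b : ℝ} (ha : 0 < a) (hb : b ≤ 1) {x : E}
    (hx : x ∈ shell E a b) {f : ℝ → ℝ≥0∞} (hf : Measurable f) :
    ENNReal.ofReal ((b - a) ^ (Module.finrank ℝ E - 1)) * ∫⁻ y in shell E a b, f ‖y‖ ∂μ ≤
      ENNReal.ofReal (4 ^ Module.finrank ℝ E * Module.finrank ℝ E) *
        ∫⁻ y in shell E a b ∩ Metric.ball x (2 * (b - a)), f ‖y‖ ∂μ := by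
  set d := Module.finrank ℝ E with hd
  have hx0 : 0 < ‖x‖ := ha.trans_le hx.1
  have hℓ : 0 < b - a := by linarith [hx.1, hx.2]
  set e : E := ‖x‖⁻¹ • x with he_def
  have he : ‖e‖ = 1 := by rw [he_def, norm_smul, norm_inv, norm_norm, inv_mul_cancel₀ hx0.ne']
  set F : ℝ → ℝ≥0∞ := (Ico a b).indicator f with hF
  have hFm : Measurable F := hf.indicator measurableSet_Ico
  set I := ∫⁻ t in Ioi (0 : ℝ), ENNReal.ofReal (t ^ (d - 1)) * F t with hI
  have hFs : ∀ y : E, F ‖y‖ = (shell E a b).indicator (fun y => f ‖y‖) y := fun y => rfl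
  have hcone : ∀ ℓ, ∫⁻ y in coneAt e ℓ ∩ shell E a b, f ‖y‖ ∂μ =
      μ.toSphere {z | ‖(z : E) - e‖ < ℓ} * I := by
    intro ℓ
    rw [← setLIntegral_coneAt_norm μ e ℓ hFm]
    simp only [hFs]
    rw [lintegral_indicator (measurableSet_shell a b),
      Measure.restrict_restrict (measurableSet_shell a b), inter_comm]
  have h1 : ∫⁻ y in shell E a b, f ‖y‖ ∂μ ≤ μ.toSphere univ * I := by
    -- Two unit vectors are at distance at most 2, so aperture 3 captures all directions.
    have hsub : shell E a b ⊆ coneAt e 3 ∩ shell E a b := by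
      intro y hy
      have hy0 : 0 < ‖y‖ := ha.trans_le hy.1
      refine ⟨⟨norm_pos_iff.1 hy0, ?_⟩, hy⟩
      calc ‖‖y‖⁻¹ • y - e‖ ≤ ‖‖y‖⁻¹ • y‖ + ‖e‖ := norm_sub_le _ _
        _ = 2 := by
          rw [he, norm_smul, norm_inv, norm_norm, inv_mul_cancel₀ hy0.ne']; norm_num
        _ < 3 := by norm_num
    calc ∫⁻ y in shell E a b, f ‖y‖ ∂μ ≤ ∫⁻ y in coneAt e 3 ∩ shell E a b, f ‖y‖ ∂μ :=
          lintegral_mono_set hsub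
      _ ≤ _ := by
          rw [hcone]
          gcongr
          exact subset_univ _
  -- With aperture b - a, the angular displacement from x is below b - a because ‖y‖ ≤ 1, and so is
  -- the radial one; hence the radius 2(b - a).
  have h2 : μ.toSphere {z | ‖(z : E) - e‖ < b - a} * I ≤
      ∫⁻ y in shell E a b ∩ Metric.ball x (2 * (b - a)), f ‖y‖ ∂μ := by
    rw [← hcone]
    refine lintegral_mono_set ?_
    rintro y ⟨hy, hys⟩
    refine ⟨hys, ?_⟩
    rw [mem_ball_iff_norm]
    have hy0 : 0 < ‖y‖ := ha.trans_le hys.1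
    have e1 : y - x = ‖y‖ • (‖y‖⁻¹ • y - e) + (‖y‖ - ‖x‖) • e := by
      rw [smul_sub, smul_smul, mul_inv_cancel₀ hy0.ne', one_smul, sub_smul, he_def, smul_smul ‖x‖,
        mul_inv_cancel₀ hx0.ne', one_smul]
      abel
    have e2 : |‖y‖ - ‖x‖| < b - a := by
      rw [abs_lt]
      constructor <;> linarith [hys.1, hys.2, hx.1, hx.2]
    calc ‖y - x‖ ≤ ‖y‖ * ‖‖y‖⁻¹ • y - e‖ + |‖y‖ - ‖x‖| * ‖e‖ := by
          rw [e1]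
          refine (norm_add_le _ _).trans ?_
          rw [norm_smul, norm_smul, norm_norm, Real.norm_eq_abs]
      _ < 2 * (b - a) := by
          rw [he]
          have := hy.2
          have h3 : ‖y‖ * ‖‖y‖⁻¹ • y - e‖ ≤ 1 * ‖‖y‖⁻¹ • y - e‖ := by
            gcongr
            linarith [hys.2]
          linarith
  -- The full sphere has measure d times that of the unit ball, which accounts for the factor d.
  have h3 : ENNReal.ofReal ((b - a) ^ (d - 1)) * μ.toSphere univ ≤
      ENNReal.ofReal (4 ^ d * d) * μ.toSphere {z | ‖(z : E) - e‖ < b - a} := by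
    rw [Measure.toSphere_apply_univ, ← hd, mul_left_comm, ENNReal.ofReal_mul (by positivity),
      ENNReal.ofReal_natCast, mul_comm (ENNReal.ofReal _) (d : ℝ≥0∞), mul_assoc]
    exact mul_le_mul_right (cap_measure_ge μ he hℓ (by linarith)) _
  calc _ ≤ ENNReal.ofReal ((b - a) ^ (d - 1)) * (μ.toSphere univ * I) := by gcongr
    _ ≤ ENNReal.ofReal (4 ^ d * d) * (μ.toSphere {z | ‖(z : E) - e‖ < b - a} * I) := by
        rw [← mul_assoc, ← mul_assoc]
        gcongr
    _ ≤ _ := by gcongr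

end Cones


/-! ### Mean oscillation of radial functions on thin shells -/

/-- The double integral of the Gagliardo integrand over the unit ball. -/
def gagliardoSq (N : ℕ) (s : ℝ) (φ : Eucl N → ℝ) : ℝ :=
  ∫ p, gagliardoIntegrand N s φ p
    ∂((volume.restrict (unitBall N)).prod (volume.restrict (unitBall N)))

theorem gagliardoIntegrand_nonneg (N : ℕ) (s : ℝ) (φ : Eucl N → ℝ) (p : Eucl N × Eucl N) :
    0 ≤ gagliardoIntegrand N s φ p := by
  unfold gagliardoIntegrand
  positivity

theorem gagliardoSq_nonneg (N : ℕ) (s : ℝ) (φ : Eucl N → ℝ) : 0 ≤ gagliardoSq N s φ :=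
  integral_nonneg (gagliardoIntegrand_nonneg N s φ)

theorem measurable_gagliardoIntegrand {N : ℕ} {s : ℝ} {φ : Eucl N → ℝ} (hφ : Measurable φ) :
    Measurable (gagliardoIntegrand N s φ) := by
  unfold gagliardoIntegrand
  fun_prop

theorem nontrivial_eucl {N : ℕ} (hN : 0 < N) : Nontrivial (Eucl N) := by
  have : Nonempty (Fin N) := ⟨⟨0, hN⟩⟩
  infer_instance

/-- Turns φ into a function of one real variable on a fixed ray, from which continuity and
measurability in the radius are inherited. -/
theorem IsRadial.exists_profile {N : ℕ} (hN : 0 < N) {φ : Eucl N → ℝ} (hr : IsRadial φ) :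
    ∃ e : Eucl N, ‖e‖ = 1 ∧ ∀ x, φ x = φ (‖x‖ • e) := by
  have := nontrivial_eucl hN
  obtain ⟨e, he⟩ := exists_norm_eq (Eucl N) zero_le_one
  refine ⟨e, he, fun x => hr _ _ ?_⟩
  rw [norm_smul, he, mul_one, norm_norm]

theorem ENNReal.le_ofReal_inv_mul {p : ℝ} (hp : 0 < p) {X Y : ℝ≥0∞}
    (h : ENNReal.ofReal p * X ≤ Y) : X ≤ ENNReal.ofReal p⁻¹ * Y := by
  calc X = ENNReal.ofReal p⁻¹ * (ENNReal.ofReal p * X) := by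
        rw [← mul_assoc, ← ENNReal.ofReal_mul (by positivity), inv_mul_cancel₀ hp.ne',
          ENNReal.ofReal_one, one_mul]
    _ ≤ _ := mul_le_mul_right h _

theorem sq_le_rpow_mul_gagliardoIntegrand {N : ℕ} {s : ℝ} (hs : 0 ≤ s) (φ : Eucl N → ℝ) {R : ℝ}
    (x y : Eucl N) (hR : ‖x - y‖ ≤ R) :
    (φ x - φ y) ^ 2 ≤ R ^ ((N : ℝ) + 2 * s) * gagliardoIntegrand N s φ (x, y) := by
  rcases eq_or_ne x y with rfl | hxy
  · have : 0 ≤ R := (norm_nonneg _).trans hR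
    rw [sub_self, zero_pow two_ne_zero]
    have := gagliardoIntegrand_nonneg N s φ (x, x)
    positivity
  · have h0 : 0 < ‖x - y‖ := norm_pos_iff.2 (sub_ne_zero.2 hxy)
    have h1 : 0 < ‖x - y‖ ^ ((N : ℝ) + 2 * s) := by positivity
    unfold gagliardoIntegrand
    rw [mul_div_assoc', le_div_iff₀ h1, mul_comm]
    gcongr

section Shells

variable {N : ℕ} {s : ℝ} {φ : Eucl N → ℝ}

theorem shell_subset_unitBall {a b : ℝ} (hb : b ≤ 1) : shell (Eucl N) a b ⊆ unitBall N := by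
  intro x hx
  rw [unitBall, mem_ball_zero_iff]
  exact hx.2.trans_le hb

/-- A direct kernel bound on the shell would be useless, since its points may be antipodal. By
radiality only y within 2(b - a) of x matter; there the kernel bound gives (b - a)^(N+2s), and the
shell-to-cap ratio costs (b - a)^(1-N). The remaining power 1 + 2s is that of dimension one. -/
theorem lintegral_shell_sq_le (hN : 0 < N) (hs : 0 ≤ s) (hc : Continuous φ) (hr : IsRadial φ)
    {a b : ℝ} (ha : 0 < a) (hab : a < b) (hb : b ≤ 1) {x : Eucl N}
    (hx : x ∈ shell (Eucl N) a b) :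
    ∫⁻ y in shell (Eucl N) a b, ENNReal.ofReal ((φ x - φ y) ^ 2) ≤
      ENNReal.ofReal (4 ^ N * N * 2 ^ ((N : ℝ) + 2 * s) * (b - a) ^ (1 + 2 * s)) *
        ∫⁻ y in shell (Eucl N) a b, ENNReal.ofReal (gagliardoIntegrand N s φ (x, y)) := by
  have := nontrivial_eucl hN
  have hℓ : 0 < b - a := sub_pos.2 hab
  obtain ⟨e, he, hφe⟩ := hr.exists_profile hN
  set f : ℝ → ℝ≥0∞ := fun t => ENNReal.ofReal ((φ x - φ (t • e)) ^ 2) with hf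
  have hfm : Measurable f := by
    have : Continuous fun t : ℝ => (φ x - φ (t • e)) ^ 2 := by fun_prop
    exact this.measurable.ennreal_ofReal
  have hfe : ∀ y, f ‖y‖ = ENNReal.ofReal ((φ x - φ y) ^ 2) := fun y => by
    rw [hf]; simp only [← hφe]
  have h1 := setLIntegral_shell_le (volume : Measure (Eucl N)) ha hb hx hfm
  simp only [hfe, finrank_euclideanSpace_fin] at h1
  have h2 : ∫⁻ y in shell (Eucl N) a b ∩ Metric.ball x (2 * (b - a)),
      ENNReal.ofReal ((φ x - φ y) ^ 2) ≤ ENNReal.ofReal ((2 * (b - a)) ^ ((N : ℝ) + 2 * s)) *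
        ∫⁻ y in shell (Eucl N) a b, ENNReal.ofReal (gagliardoIntegrand N s φ (x, y)) := by
    rw [← lintegral_const_mul' _ _ ENNReal.ofReal_ne_top]
    refine (setLIntegral_mono' ((measurableSet_shell a b).inter measurableSet_ball)
      fun y hy => ?_).trans (lintegral_mono_set inter_subset_left)
    rw [← ENNReal.ofReal_mul (by positivity)]
    refine ENNReal.ofReal_le_ofReal (sq_le_rpow_mul_gagliardoIntegrand hs φ x y ?_)
    rw [norm_sub_rev]
    exact (mem_ball_iff_norm.1 hy.2).le
  have h3 := ENNReal.le_ofReal_inv_mul (by positivity) (h1.trans (mul_le_mul_right h2 _))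
  refine h3.trans (le_of_eq ?_)
  rw [← mul_assoc, ← mul_assoc, ← ENNReal.ofReal_mul (by positivity),
    ← ENNReal.ofReal_mul (by positivity)]
  congr 2
  rw [Real.mul_rpow (by norm_num) hℓ.le]
  have h4 : (b - a) ^ ((N : ℝ) + 2 * s) = (b - a) ^ (N - 1) * (b - a) ^ (1 + 2 * s) := by
    rw [← Real.rpow_natCast (b - a) (N - 1), ← Real.rpow_add hℓ, Nat.cast_sub hN]
    congr 1
    push_cast
    ring
  rw [h4]
  field_simp

theorem integral_shell_prod_sq_le (hN : 0 < N) (hs : 0 ≤ s) (hc : Continuous φ) (hr : IsRadial φ)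
    (hI : Integrable (gagliardoIntegrand N s φ)
      ((volume.restrict (unitBall N)).prod (volume.restrict (unitBall N))))
    {a b : ℝ} (ha : 0 < a) (hab : a < b) (hb : b ≤ 1) :
    ∫ p, (φ p.1 - φ p.2) ^ 2 ∂((volume.restrict (shell (Eucl N) a b)).prod
        (volume.restrict (shell (Eucl N) a b))) ≤
      4 ^ N * N * 2 ^ ((N : ℝ) + 2 * s) * (b - a) ^ (1 + 2 * s) * gagliardoSq N s φ := by
  have hℓ : 0 < b - a := sub_pos.2 hab
  set A := shell (Eucl N) a b with hA
  have hcont : Continuous fun p : Eucl N × Eucl N => (φ p.1 - φ p.2) ^ 2 := by fun_prop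
  rw [integral_eq_lintegral_of_nonneg_ae (Eventually.of_forall fun p => sq_nonneg _)
    hcont.aestronglyMeasurable]
  refine ENNReal.toReal_le_of_le_ofReal
    (mul_nonneg (by positivity) (gagliardoSq_nonneg N s φ)) ?_
  have hFm := (measurable_gagliardoIntegrand (s := s) hc.measurable).ennreal_ofReal
  rw [lintegral_prod _ hcont.measurable.ennreal_ofReal.aemeasurable]
  calc ∫⁻ x in A, ∫⁻ y in A, ENNReal.ofReal ((φ x - φ y) ^ 2)
      ≤ ∫⁻ x in A, ENNReal.ofReal (4 ^ N * N * 2 ^ ((N : ℝ) + 2 * s) * (b - a) ^ (1 + 2 * s)) *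
        ∫⁻ y in A, ENNReal.ofReal (gagliardoIntegrand N s φ (x, y)) :=
        setLIntegral_mono' (measurableSet_shell a b) fun x hx =>
          lintegral_shell_sq_le hN hs hc hr ha hab hb hx
    _ = ENNReal.ofReal (4 ^ N * N * 2 ^ ((N : ℝ) + 2 * s) * (b - a) ^ (1 + 2 * s)) *
        ∫⁻ p, ENNReal.ofReal (gagliardoIntegrand N s φ p)
          ∂((volume.restrict A).prod (volume.restrict A)) := by
        rw [lintegral_const_mul' _ _ ENNReal.ofReal_ne_top, lintegral_prod _ hFm.aemeasurable]
    _ ≤ ENNReal.ofReal (4 ^ N * N * 2 ^ ((N : ℝ) + 2 * s) * (b - a) ^ (1 + 2 * s)) *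
        ∫⁻ p, ENNReal.ofReal (gagliardoIntegrand N s φ p)
          ∂((volume.restrict (unitBall N)).prod (volume.restrict (unitBall N))) := by
        rw [Measure.prod_restrict, Measure.prod_restrict]
        exact mul_le_mul_right (lintegral_mono_set
          (prod_mono (shell_subset_unitBall hb) (shell_subset_unitBall hb))) _
    _ = _ := by
        rw [← ofReal_integral_eq_lintegral_ofReal hI
          (Eventually.of_forall (gagliardoIntegrand_nonneg N s φ)),
          ← ENNReal.ofReal_mul (by positivity)]
        rfl

theorem volume_real_ball (hN : 0 < N) {r : ℝ} (hr : 0 ≤ r) :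
    (volume : Measure (Eucl N)).real (Metric.ball 0 r) =
      r ^ N * (volume : Measure (Eucl N)).real (unitBall N) := by
  have := nontrivial_eucl hN
  rw [Measure.real, Measure.addHaar_ball _ _ hr, ENNReal.toReal_mul,
    ENNReal.toReal_ofReal (by positivity), finrank_euclideanSpace_fin]
  rfl

theorem volume_real_unitBall_pos : 0 < (volume : Measure (Eucl N)).real (unitBall N) :=
  ENNReal.toReal_pos (Metric.measure_ball_pos volume _ one_pos).ne' measure_ball_lt_top.ne

theorem shell_eq_diff (a b : ℝ) :
    shell (Eucl N) a b = Metric.ball 0 b \ Metric.ball 0 a := by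
  ext x
  simp [shell, and_comm]

theorem volume_real_shell (hN : 0 < N) {a b : ℝ} (ha : 0 ≤ a) (hab : a ≤ b) :
    (volume : Measure (Eucl N)).real (shell (Eucl N) a b) =
      (b ^ N - a ^ N) * (volume : Measure (Eucl N)).real (unitBall N) := by
  rw [shell_eq_diff, measureReal_sdiff (Metric.ball_subset_ball hab) measurableSet_ball
    measure_ball_lt_top.ne, volume_real_ball hN ha, volume_real_ball hN (ha.trans hab), sub_mul]

theorem volume_real_shell_ge (hN : 0 < N) {a b : ℝ} (ha : 0 ≤ a) (hab : a ≤ b) :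
    a ^ (N - 1) * (b - a) * (volume : Measure (Eucl N)).real (unitBall N) ≤
      (volume : Measure (Eucl N)).real (shell (Eucl N) a b) := by
  rw [volume_real_shell hN ha hab]
  gcongr
  obtain ⟨n, rfl⟩ : ∃ n, N = n + 1 := ⟨N - 1, by omega⟩
  have hb : 0 ≤ b := ha.trans hab
  have h1 : a ^ n * b ≤ b ^ n * b := by gcongr
  rw [Nat.add_sub_cancel, pow_succ, pow_succ]
  linarith

theorem volume_shell_lt_top (a b : ℝ) : volume (shell (Eucl N) a b) < ⊤ :=
  (measure_mono (by rw [shell_eq_diff]; exact sdiff_subset)).trans_lt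
    (measure_ball_lt_top (x := (0 : Eucl N)) (r := b))

end Shells

/-- Cauchy–Schwarz against the constant 1, obtained by expanding ∫ (m g - I)² ≥ 0 with m the total
mass and I the integral of g. -/
theorem MeasureTheory.sq_integral_le {α : Type*} [MeasurableSpace α] {ν : Measure α}
    [IsFiniteMeasure ν] {g : α → ℝ} (hg : MemLp g 2 ν) :
    (∫ x, g x ∂ν) ^ 2 ≤ ν.real univ * ∫ x, g x ^ 2 ∂ν := by
  have h1 : Integrable g ν := hg.integrable (by norm_num)
  have h2 : Integrable (fun x => g x ^ 2) ν := hg.integrable_sq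
  set m := ν.real univ with hm
  set I := ∫ x, g x ∂ν with hI
  have h0 : 0 ≤ ∫ x, (m * g x - I) ^ 2 ∂ν := integral_nonneg fun x => sq_nonneg _
  have h3 : ∫ x, (m * g x - I) ^ 2 ∂ν = m * (m * (∫ x, g x ^ 2 ∂ν) - I ^ 2) := by
    have : ∀ x, (m * g x - I) ^ 2 = m ^ 2 * g x ^ 2 - 2 * m * I * g x + I ^ 2 := fun x => by ring
    simp only [this]
    rw [integral_add (f := fun x => m ^ 2 * g x ^ 2 - 2 * m * I * g x)
      ((h2.const_mul _).sub (h1.const_mul _)) (integrable_const _), integral_sub (h2.const_mul _) (h1.const_mul _), integral_const_mul, integral_const_mul,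
      integral_const, ← hI, ← hm, smul_eq_mul]
    ring
  rcases (measureReal_nonneg : 0 ≤ m).eq_or_lt with h | h
  · have : ν = 0 := by
      rw [← Measure.measure_univ_eq_zero, ← measureReal_eq_zero_iff, ← h]
    simp [hI, this]
  · rw [h3] at h0
    linarith [nonneg_of_mul_nonneg_right h0 h]

/-! ### Shell means and a Morrey estimate away from the origin -/

section Morrey

variable {N : ℕ} {s : ℝ} {φ : Eucl N → ℝ}

/-- The mean of `φ` over a shell. -/
def shellMean (φ : Eucl N → ℝ) (a b : ℝ) : ℝ :=
  (∫ x in shell (Eucl N) a b, φ x) / (volume : Measure (Eucl N)).real (shell (Eucl N) a b)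

/-- The difference of the two means is the average of φ(x) - φ(y) over the product of the shells, so
Cauchy–Schwarz applies; enlarging the product to the square of the outer shell brings in the
oscillation bound. -/
theorem shellMean_sub_sq_le (hN : 0 < N) (hs : 0 ≤ s) (hc : Continuous φ)
    (hcs : HasCompactSupport φ) (hr : IsRadial φ)
    (hI : Integrable (gagliardoIntegrand N s φ)
      ((volume.restrict (unitBall N)).prod (volume.restrict (unitBall N))))
    {a b a' b' : ℝ} (ha : 0 < a) (haa : a ≤ a') (hab : a' < b') (hbb : b' ≤ b) (hb : b ≤ 1) :
    (volume : Measure (Eucl N)).real (shell (Eucl N) a b) *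
      (volume : Measure (Eucl N)).real (shell (Eucl N) a' b') *
      (shellMean φ a b - shellMean φ a' b') ^ 2 ≤
      4 ^ N * N * 2 ^ ((N : ℝ) + 2 * s) * (b - a) ^ (1 + 2 * s) * gagliardoSq N s φ := by
  have hab' : a < b := by linarith
  refine le_trans ?_ (integral_shell_prod_sq_le hN hs hc hr hI ha hab' hb)
  set A := shell (Eucl N) a b with hA
  set A' := shell (Eucl N) a' b' with hA'
  have hsub : A' ⊆ A := fun x hx => ⟨haa.trans hx.1, hx.2.trans_le hbb⟩
  have : IsFiniteMeasure (volume.restrict A) := ⟨by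
    rw [Measure.restrict_apply_univ]; exact volume_shell_lt_top a b⟩
  have : IsFiniteMeasure (volume.restrict A') := ⟨by
    rw [Measure.restrict_apply_univ]; exact volume_shell_lt_top a' b'⟩
  have hv1 : 0 < a ^ (N - 1) * (b - a) * (volume : Measure (Eucl N)).real (unitBall N) := by
    have := volume_real_unitBall_pos (N := N)
    have : 0 < b - a := by linarith
    positivity
  have hv2 : 0 < a' ^ (N - 1) * (b' - a') * (volume : Measure (Eucl N)).real (unitBall N) := by
    have := volume_real_unitBall_pos (N := N)
    have : 0 < b' - a' := by linarith
    have : 0 < a' := by linarith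
    positivity
  have hVA : 0 < (volume : Measure (Eucl N)).real A :=
    hv1.trans_le (volume_real_shell_ge hN ha.le hab'.le)
  have hVA' : 0 < (volume : Measure (Eucl N)).real A' :=
    hv2.trans_le (volume_real_shell_ge hN (by linarith) hab.le)
  obtain ⟨M, hM⟩ := hcs.exists_bound_of_continuous hc
  have hcont : Continuous fun p : Eucl N × Eucl N => φ p.1 - φ p.2 := by fun_prop
  have hbd : ∀ p : Eucl N × Eucl N, ‖φ p.1 - φ p.2‖ ≤ M + M := fun p =>
    (norm_sub_le _ _).trans (add_le_add (hM _) (hM _))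
  have hmem : ∀ ν : Measure (Eucl N × Eucl N), IsFiniteMeasure ν →
      MemLp (fun p : Eucl N × Eucl N => φ p.1 - φ p.2) 2 ν := fun ν _ =>
    MemLp.of_bound hcont.aestronglyMeasurable (M + M) (Eventually.of_forall hbd)
  have hφA : Integrable φ (volume.restrict A) :=
    Integrable.of_bound hc.aestronglyMeasurable M (Eventually.of_forall hM)
  have hφA' : Integrable φ (volume.restrict A') :=
    Integrable.of_bound hc.aestronglyMeasurable M (Eventually.of_forall hM)
  have h1 := sq_integral_le (hmem ((volume.restrict A).prod (volume.restrict A')) inferInstance)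
  have h2 : ∫ p, (φ p.1 - φ p.2) ∂((volume.restrict A).prod (volume.restrict A')) =
      (volume : Measure (Eucl N)).real A * (volume : Measure (Eucl N)).real A' *
        (shellMean φ a b - shellMean φ a' b') := by
    rw [integral_sub (hφA.comp_fst _) (hφA'.comp_snd _), integral_fun_fst, integral_fun_snd,
      shellMean, shellMean, measureReal_restrict_apply_univ, measureReal_restrict_apply_univ,
      smul_eq_mul, smul_eq_mul, ← hA, ← hA']
    field_simp
  have h3 : ((volume.restrict A).prod (volume.restrict A')).real univ =
      (volume : Measure (Eucl N)).real A * (volume : Measure (Eucl N)).real A' := by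
    rw [← univ_prod_univ, measureReal_prod_prod, measureReal_restrict_apply_univ,
      measureReal_restrict_apply_univ]
  rw [h2, h3] at h1
  have h4 : ∫ p, (φ p.1 - φ p.2) ^ 2 ∂((volume.restrict A).prod (volume.restrict A')) ≤
      ∫ p, (φ p.1 - φ p.2) ^ 2 ∂((volume.restrict A).prod (volume.restrict A)) := by
    refine integral_mono_measure ?_ (Eventually.of_forall fun p => sq_nonneg _)
      (hmem _ inferInstance).integrable_sq
    exact Measure.prod_mono le_rfl (Measure.restrict_mono hsub le_rfl)
  have h5 := mul_pos hVA hVA'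
  refine le_trans ?_ h4
  have h6 : (volume.real A * volume.real A') *
      (volume.real A * volume.real A' * (shellMean φ a b - shellMean φ a' b') ^ 2) ≤
      (volume.real A * volume.real A') *
        ∫ p, (φ p.1 - φ p.2) ^ 2 ∂((volume.restrict A).prod (volume.restrict A')) := by
    refine le_trans (le_of_eq ?_) h1
    ring
  exact le_of_mul_le_mul_left h6 h5

/-- The means of `φ` over nested shells of geometrically decreasing width shrinking to the sphere
of radius `r` converge geometrically fast. -/
theorem abs_shellMean_sub_le (hN : 0 < N) (hs : 1 / 2 < s) (hc : Continuous φ)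
    (hcs : HasCompactSupport φ) (hr : IsRadial φ)
    (hI : Integrable (gagliardoIntegrand N s φ)
      ((volume.restrict (unitBall N)).prod (volume.restrict (unitBall N))))
    {δ L : ℝ} (hδ : 0 < δ) (hL : 0 < L) {a b : ℕ → ℝ} (ha : ∀ n, δ ≤ a n) (hb : ∀ n, b n ≤ 1)
    (hab : ∀ n, b n - a n = L * (1 / 2) ^ n) (hamono : Monotone a) (hbmono : Antitone b)
    {x : Eucl N} (hax : ∀ n, a n ≤ ‖x‖) (hxb : ∀ n, ‖x‖ ≤ b n) :
    |shellMean φ (a 0) (b 0) - φ x| ≤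
      Real.sqrt (4 ^ N * N * 2 ^ ((N : ℝ) + 2 * s) * 2 * gagliardoSq N s φ /
        (δ ^ (N - 1) * (volume : Measure (Eucl N)).real (unitBall N)) ^ 2 * L ^ (2 * s - 1)) /
        (1 - (1 / 2) ^ (s - 1 / 2)) := by
  set v := (volume : Measure (Eucl N)).real (unitBall N) with hv
  have hv0 : 0 < v := volume_real_unitBall_pos
  set K : ℝ := 4 ^ N * N * 2 ^ ((N : ℝ) + 2 * s) with hK
  have hK0 : 0 ≤ K := by positivity
  have hD := gagliardoSq_nonneg N s φ
  set m : ℕ → ℝ := fun n => shellMean φ (a n) (b n) with hm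
  have hlen : ∀ n, 0 < b n - a n := fun n => by rw [hab]; positivity
  have hvol : ∀ n, δ ^ (N - 1) * (b n - a n) * v ≤
      (volume : Measure (Eucl N)).real (shell (Eucl N) (a n) (b n)) := fun n => by
    refine le_trans ?_ (volume_real_shell_ge hN (hδ.le.trans (ha n)) (by linarith [hlen n]))
    have := hlen n
    have := ha n
    gcongr
  -- Both shell volumes are at least of order ℓ, so ℓ^(1+2s) drops to ℓ^(2s-1). This decays
  -- geometrically exactly because s > 1/2, and its square root gives the ratio (1/2)^(s-1/2).
  have hstep : ∀ n, dist (m n) (m (n + 1)) ≤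
      Real.sqrt (K * 2 * gagliardoSq N s φ / (δ ^ (N - 1) * v) ^ 2 * L ^ (2 * s - 1)) *
        ((1 / 2) ^ (s - 1 / 2)) ^ n := by
    intro n
    have h1 := shellMean_sub_sq_le hN (by linarith) hc hcs hr hI (hδ.trans_le (ha n))
      (hamono n.le_succ) (by linarith [hlen (n + 1)]) (hbmono n.le_succ) (hb n)
    set ℓ := b n - a n with hℓ
    have hℓ0 : 0 < ℓ := hlen n
    have hℓ1 : b (n + 1) - a (n + 1) = ℓ / 2 := by
      rw [hab, hℓ, hab, pow_succ]; ring
    have hw : 0 < δ ^ (N - 1) * v := by positivity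
    have h2 : (δ ^ (N - 1) * ℓ * v) * (δ ^ (N - 1) * (ℓ / 2) * v) * (m n - m (n + 1)) ^ 2 ≤
        K * ℓ ^ (1 + 2 * s) * gagliardoSq N s φ := by
      refine le_trans ?_ h1
      have e1 := hvol n
      have e2 := hvol (n + 1)
      rw [hℓ1] at e2
      gcongr
    have h3 : ℓ ^ (1 + 2 * s) = ℓ ^ (2 * s - 1) * ℓ ^ 2 := by
      rw [← Real.rpow_natCast ℓ 2, ← Real.rpow_add hℓ0]
      congr 1
      push_cast
      ring
    have h4 : (m n - m (n + 1)) ^ 2 ≤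
        K * 2 * gagliardoSq N s φ / (δ ^ (N - 1) * v) ^ 2 * ℓ ^ (2 * s - 1) := by
      rw [h3] at h2
      rw [div_mul_eq_mul_div, le_div_iff₀ (by positivity)]
      have h5 : ℓ ^ 2 * ((m n - m (n + 1)) ^ 2 * (δ ^ (N - 1) * v) ^ 2) ≤
          ℓ ^ 2 * (K * 2 * gagliardoSq N s φ * ℓ ^ (2 * s - 1)) := by linarith
      exact le_of_mul_le_mul_left h5 (by positivity)
    have h6 : ℓ ^ (2 * s - 1) = L ^ (2 * s - 1) * (((1 / 2 : ℝ) ^ (s - 1 / 2)) ^ n) ^ 2 := by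
      rw [hℓ, hab, Real.mul_rpow hL.le (by positivity)]
      congr 1
      rw [← pow_mul, ← Real.rpow_mul_natCast (by norm_num), ← Real.rpow_natCast_mul (by norm_num)]
      congr 1
      push_cast
      ring
    rw [Real.dist_eq]
    refine abs_le_of_sq_le_sq ?_ (by positivity)
    rw [mul_pow, Real.sq_sqrt (by positivity)]
    refine h4.trans (le_of_eq ?_)
    rw [h6]
    ring
  have hq : ((1 / 2 : ℝ) ^ (s - 1 / 2)) < 1 :=
    Real.rpow_lt_one (by norm_num) (by norm_num) (by linarith)
  -- The shells shrink to the sphere through x, on which φ is constant, and the radial profile is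
  -- continuous.
  have hlim : Tendsto m atTop (𝓝 (φ x)) := by
    obtain ⟨e, he, hφe⟩ := hr.exists_profile hN
    have hg : Continuous fun t : ℝ => φ (t • e) := by fun_prop
    rw [Metric.tendsto_atTop]
    intro ε hε
    obtain ⟨η, hη, hηg⟩ := Metric.continuous_iff.1 hg ‖x‖ (ε / 2) (half_pos hε)
    have hl : Tendsto (fun n : ℕ => L * (1 / 2 : ℝ) ^ n) atTop (𝓝 (L * 0)) :=
      (tendsto_pow_atTop_nhds_zero_of_lt_one (by norm_num) (by norm_num)).const_mul L
    rw [mul_zero] at hl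
    obtain ⟨n₀, hn₀⟩ := eventually_atTop.1 (hl.eventually (gt_mem_nhds hη))
    refine ⟨n₀, fun n hn => ?_⟩
    have hlen' : b n - a n < η := by rw [hab]; exact hn₀ n hn
    set A := shell (Eucl N) (a n) (b n) with hA
    have hfin : IsFiniteMeasure (volume.restrict A) := ⟨by
      rw [Measure.restrict_apply_univ]; exact volume_shell_lt_top _ _⟩
    have hVA : 0 < (volume : Measure (Eucl N)).real A := by
      refine lt_of_lt_of_le ?_ (hvol n)
      have := hlen n
      positivity
    obtain ⟨M, hM⟩ := hcs.exists_bound_of_continuous hc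
    have hφA : Integrable φ (volume.restrict A) :=
      Integrable.of_bound hc.aestronglyMeasurable M (Eventually.of_forall hM)
    have h1 : m n - φ x = (∫ y in A, (φ y - φ x)) / (volume : Measure (Eucl N)).real A := by
      rw [integral_sub hφA (integrable_const _), integral_const, measureReal_restrict_apply_univ,
        smul_eq_mul, hm]
      simp only [shellMean]
      rw [← hA]
      field_simp
    have h2 : ‖∫ y in A, (φ y - φ x)‖ ≤ ε / 2 * (volume : Measure (Eucl N)).real A := by
      refine norm_setIntegral_le_of_norm_le_const (volume_shell_lt_top _ _) fun y hy => ?_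
      rw [hφe y, hφe x, ← dist_eq_norm]
      refine (hηg ‖y‖ ?_).le
      rw [Real.dist_eq, abs_lt]
      constructor <;> linarith [hy.1, hy.2, hax n, hxb n]
    rw [Real.dist_eq, h1, abs_div, abs_of_pos hVA, div_lt_iff₀ hVA]
    rw [Real.norm_eq_abs] at h2
    have : ε / 2 * volume.real A < ε * volume.real A := by
      gcongr
      linarith
    linarith
  have := dist_le_of_le_geometric_of_tendsto₀ _ _ hq hstep hlim
  rwa [Real.dist_eq] at this

/-- The constant in the Morrey-type estimate away from the origin. -/
def morreyConst (N : ℕ) (s δ : ℝ) : ℝ :=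
  (2 / (1 - (1 / 2) ^ (s - 1 / 2))) ^ 2 * (4 ^ N * N * 2 ^ ((N : ℝ) + 2 * s) * 2 /
    (δ ^ (N - 1) * (volume : Measure (Eucl N)).real (unitBall N)) ^ 2)

theorem morreyConst_nonneg (N : ℕ) (s δ : ℝ) : 0 ≤ morreyConst N s δ := by
  unfold morreyConst
  positivity

/-- Radial functions of finite Gagliardo energy, with `s > 1/2`, are Hölder continuous away from
the origin. -/
theorem sub_sq_le_morrey (hN : 0 < N) (hs : 1 / 2 < s) (hc : Continuous φ)
    (hcs : HasCompactSupport φ) (hr : IsRadial φ)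
    (hI : Integrable (gagliardoIntegrand N s φ)
      ((volume.restrict (unitBall N)).prod (volume.restrict (unitBall N))))
    {δ : ℝ} (hδ : 0 < δ) {x y : Eucl N} (hx : δ ≤ ‖x‖) (hxy : ‖x‖ ≤ ‖y‖) (hy : ‖y‖ ≤ 1) :
    (φ x - φ y) ^ 2 ≤
      morreyConst N s δ * gagliardoSq N s φ * (‖y‖ - ‖x‖) ^ (2 * s - 1) := by
  have hD := gagliardoSq_nonneg N s φ
  rcases hxy.eq_or_lt with h | h
  · rw [hr x y h, sub_self, zero_pow two_ne_zero]
    have := morreyConst_nonneg N s δ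
    have : 0 ≤ ‖y‖ - ‖x‖ := by linarith
    positivity
  set L := ‖y‖ - ‖x‖ with hL
  have hL0 : 0 < L := sub_pos.2 h
  have hpow : ∀ n : ℕ, (1 / 2 : ℝ) ^ n ≤ 1 := fun n => pow_le_one₀ (by norm_num) (by norm_num)
  have hanti : Antitone fun n : ℕ => L * (1 / 2 : ℝ) ^ n := fun i j hij => by
    have := pow_le_pow_of_le_one (by norm_num : (0 : ℝ) ≤ 1 / 2) (by norm_num) hij
    simp only
    gcongr
  have hnn : ∀ n : ℕ, 0 ≤ L * (1 / 2 : ℝ) ^ n := fun n => by positivity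
  have hle : ∀ n : ℕ, L * (1 / 2 : ℝ) ^ n ≤ L := fun n => by
    nlinarith [hpow n]
  -- Two nested sequences start from the same shell between ‖x‖ and ‖y‖; one shrinks to the inner
  -- sphere, the other to the outer one. Both values are thereby compared with one common mean.
  have h1 := abs_shellMean_sub_le hN hs hc hcs hr hI hδ hL0
    (a := fun _ => ‖x‖) (b := fun n => ‖x‖ + L * (1 / 2) ^ n) (x := x) (fun _ => hx)
    (fun n => by linarith [hle n]) (fun n => by ring) monotone_const
    (fun i j hij => by have := hanti hij; simp only at this ⊢; linarith) (fun _ => le_rfl)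
    (fun n => by linarith [hnn n])
  have h2 := abs_shellMean_sub_le hN hs hc hcs hr hI hδ hL0
    (a := fun n => ‖y‖ - L * (1 / 2) ^ n) (b := fun _ => ‖y‖) (x := y)
    (fun n => by linarith [hle n]) (fun _ => hy) (fun n => by ring)
    (fun i j hij => by have := hanti hij; simp only at this ⊢; linarith) antitone_const
    (fun n => by linarith [hnn n]) (fun _ => le_rfl)
  have e1 : ‖x‖ + L * (1 / 2) ^ 0 = ‖y‖ := by rw [pow_zero]; linarith
  have e2 : ‖y‖ - L * (1 / 2) ^ 0 = ‖x‖ := by rw [pow_zero]; linarith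
  simp only [e1] at h1
  simp only [e2] at h2
  set R := Real.sqrt (4 ^ N * N * 2 ^ ((N : ℝ) + 2 * s) * 2 * gagliardoSq N s φ /
        (δ ^ (N - 1) * (volume : Measure (Eucl N)).real (unitBall N)) ^ 2 * L ^ (2 * s - 1)) with hR
  have h3 : |φ x - φ y| ≤ 2 / (1 - (1 / 2) ^ (s - 1 / 2)) * R := by
    have e3 : φ x - φ y = (shellMean φ ‖x‖ ‖y‖ - φ y) - (shellMean φ ‖x‖ ‖y‖ - φ x) := by ring
    rw [e3]
    refine (abs_sub _ _).trans ((add_le_add h2 h1).trans (le_of_eq ?_))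
    ring
  rw [← sq_abs]
  refine (pow_le_pow_left₀ (abs_nonneg _) h3 2).trans (le_of_eq ?_)
  rw [mul_pow, hR, Real.sq_sqrt (by positivity), morreyConst]
  ring

end Morrey


/-! ### Bounds for radial test functions of the ball -/

section TestFunctions

variable {N : ℕ} {s : ℝ} {φ : Eucl N → ℝ}

theorem IsTestFunction.eq_zero_of_one_le (hφ : IsTestFunction (unitBall N) φ) {x : Eucl N}
    (hx : 1 ≤ ‖x‖) : φ x = 0 := by
  by_contra h
  have h1 : x ∈ unitBall N := hφ.2.2 (subset_tsupport φ h)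
  rw [unitBall, mem_ball_zero_iff] at h1
  linarith

theorem gagliardoIntegrand_congr_ae {Ω : Set (Eucl N)} {f g : Eucl N → ℝ}
    (h : f =ᵐ[volume.restrict Ω] g) :
    gagliardoIntegrand N s f =ᵐ[(volume.restrict Ω).prod (volume.restrict Ω)]
      gagliardoIntegrand N s g := by
  filter_upwards [ae_eq_fst h, ae_eq_snd h] with p h1 h2
  simp only [gagliardoIntegrand, h1, h2]

theorem Hs.integrable_gagliardoIntegrand_of_ae {Ω : Set (Eucl N)} {u : Hs N s Ω}
    (h : u =ᵐ[volume.restrict Ω] φ) :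
    Integrable (gagliardoIntegrand N s φ) ((volume.restrict Ω).prod (volume.restrict Ω)) :=
  u.integrable_gagliardoIntegrand.congr (gagliardoIntegrand_congr_ae h)

theorem Hs.energy_eq_integral_prod {Ω : Set (Eucl N)} {u : Hs N s Ω}
    (h : u =ᵐ[volume.restrict Ω] φ) :
    u.energy = fracConst N s / 2 * ∫ p, gagliardoIntegrand N s φ p
      ∂((volume.restrict Ω).prod (volume.restrict Ω)) := by
  rw [← integral_congr_ae (gagliardoIntegrand_congr_ae h),
    integral_prod _ u.integrable_gagliardoIntegrand]
  rfl

theorem Hs.norm_toL2_sq_of_ae {Ω : Set (Eucl N)} {u : Hs N s Ω}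
    (h : u =ᵐ[volume.restrict Ω] φ) : ‖Hs.toL2 u‖ ^ 2 = ∫ x in Ω, φ x ^ 2 := by
  rw [Lp_two_norm_sq]
  refine integral_congr_ae ?_
  filter_upwards [h] with x hx
  rw [hx]

/-- Radial functions of finite energy that vanish on the boundary are bounded away from the
origin. -/
theorem IsTestFunction.sq_le_gagliardoSq (hN : 0 < N) (hs : 1 / 2 < s)
    (hφ : IsTestFunction (unitBall N) φ) (hr : IsRadial φ)
    (hI : Integrable (gagliardoIntegrand N s φ)
      ((volume.restrict (unitBall N)).prod (volume.restrict (unitBall N))))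
    {δ : ℝ} (hδ : 0 < δ) {x : Eucl N} (hx : δ ≤ ‖x‖) :
    φ x ^ 2 ≤ morreyConst N s δ * gagliardoSq N s φ := by
  have h0 := mul_nonneg (morreyConst_nonneg N s δ) (gagliardoSq_nonneg N s φ)
  rcases le_total 1 ‖x‖ with h | h
  · rw [hφ.eq_zero_of_one_le h]
    simpa using h0
  · have := nontrivial_eucl hN
    -- The boundary value is 0, so the Hölder bound between x and a unit vector bounds φ(x) itself.
    obtain ⟨y, hy⟩ := exists_norm_eq (Eucl N) zero_le_one
    have h1 := sub_sq_le_morrey hN hs hφ.1.continuous hφ.2.1 hr hI hδ hx (by rw [hy]; exact h) hy.le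
    rw [hφ.eq_zero_of_one_le hy.ge, sub_zero, hy] at h1
    refine h1.trans (mul_le_of_le_one_right h0 ?_)
    exact Real.rpow_le_one (by linarith) (by linarith [norm_nonneg x]) (by linarith)

theorem IsTestFunction.memLp {Ω : Set (Eucl N)} (hφ : IsTestFunction Ω φ) (p : ℝ≥0∞)
    (ν : Measure (Eucl N)) [IsFiniteMeasure ν] : MemLp φ p ν := by
  obtain ⟨M, hM⟩ := hφ.2.1.exists_bound_of_continuous hφ.1.continuous
  exact MemLp.of_bound hφ.1.continuous.aestronglyMeasurable M (Eventually.of_forall hM)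

instance isFiniteMeasure_restrict_shell (a b : ℝ) :
    IsFiniteMeasure ((volume : Measure (Eucl N)).restrict (shell (Eucl N) a b)) :=
  ⟨by rw [Measure.restrict_apply_univ]; exact volume_shell_lt_top a b⟩

instance isFiniteMeasure_restrict_unitBall :
    IsFiniteMeasure ((volume : Measure (Eucl N)).restrict (unitBall N)) :=
  ⟨by rw [Measure.restrict_apply_univ]; exact measure_ball_lt_top⟩

instance isFiniteMeasure_restrict_ball (r : ℝ) :
    IsFiniteMeasure ((volume : Measure (Eucl N)).restrict (Metric.ball 0 r)) :=
  ⟨by rw [Measure.restrict_apply_univ]; exact measure_ball_lt_top⟩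

/-- The `L²` mass near the origin is controlled by the energy and the mass in a shell. -/
theorem IsTestFunction.integral_ball_sq_le (hN : 0 < N) (hs : 0 ≤ s)
    (hφ : IsTestFunction (unitBall N) φ)
    (hI : Integrable (gagliardoIntegrand N s φ)
      ((volume.restrict (unitBall N)).prod (volume.restrict (unitBall N))))
    {δ : ℝ} (hδ : 0 < δ) (hδ2 : δ ≤ 1 / 2) :
    ∫ x in Metric.ball (0 : Eucl N) δ, φ x ^ 2 ≤
      2 * 3 ^ ((N : ℝ) + 2 * s) / (volume : Measure (Eucl N)).real (unitBall N) *
        δ ^ (2 * s) * gagliardoSq N s φ + 2 * ∫ x in shell (Eucl N) δ 1, φ x ^ 2 := by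
  set v := (volume : Measure (Eucl N)).real (unitBall N) with hv
  have hv0 : 0 < v := volume_real_unitBall_pos
  set A := shell (Eucl N) δ (2 * δ) with hA
  set Bδ := Metric.ball (0 : Eucl N) δ with hBδ
  have hBs : Bδ ⊆ unitBall N := Metric.ball_subset_ball (by linarith)
  have hAs : A ⊆ unitBall N := shell_subset_unitBall (by linarith)
  have hφ2 : ∀ ν : Measure (Eucl N), IsFiniteMeasure ν → Integrable (fun x => φ x ^ 2) ν :=
    fun ν _ => (hφ.memLp 2 ν).integrable_sq
  have hle : (volume.restrict Bδ).prod (volume.restrict A) ≤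
      (volume.restrict (unitBall N)).prod (volume.restrict (unitBall N)) :=
    Measure.prod_mono (Measure.restrict_mono hBs le_rfl) (Measure.restrict_mono hAs le_rfl)
  have hF := hI.mono_measure hle
  -- Average φ(x)² ≤ 2(φ(x) - φ(y))² + 2φ(y)² over y in the shell from δ to 2δ, where ‖x - y‖ ≤ 3δ.
  -- The shell has volume at least v δ^N, and dividing by it turns (3δ)^(N+2s) into a multiple of
  -- δ^(2s).
  have h1 : ∫ p, φ p.1 ^ 2 ∂((volume.restrict Bδ).prod (volume.restrict A)) ≤
      ∫ p, (2 * (3 * δ) ^ ((N : ℝ) + 2 * s) * gagliardoIntegrand N s φ p + 2 * φ p.2 ^ 2)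
        ∂((volume.restrict Bδ).prod (volume.restrict A)) := by
    refine integral_mono_ae ((hφ2 _ inferInstance).comp_fst _)
      ((hF.const_mul _).add (((hφ2 _ inferInstance).comp_snd _).const_mul _)) ?_
    rw [Measure.prod_restrict]
    refine (ae_restrict_iff' (measurableSet_ball.prod (measurableSet_shell _ _))).2
      (Eventually.of_forall ?_)
    rintro ⟨x, y⟩ ⟨hx, hy⟩
    have hx' : ‖x‖ < δ := mem_ball_zero_iff.1 hx
    have h2 := sq_le_rpow_mul_gagliardoIntegrand hs φ (R := 3 * δ) x y
      ((norm_sub_le _ _).trans (by linarith [hy.2]))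
    simp only
    nlinarith [sq_nonneg (φ x - 2 * φ y)]
  have h2 : ∫ p, φ p.1 ^ 2 ∂((volume.restrict Bδ).prod (volume.restrict A)) =
      (volume : Measure (Eucl N)).real A * ∫ x in Bδ, φ x ^ 2 := by
    rw [integral_fun_fst (fun x => φ x ^ 2), measureReal_restrict_apply_univ, smul_eq_mul]
  have h3 : ∫ p, (2 * (3 * δ) ^ ((N : ℝ) + 2 * s) * gagliardoIntegrand N s φ p + 2 * φ p.2 ^ 2)
        ∂((volume.restrict Bδ).prod (volume.restrict A)) ≤
      2 * (3 * δ) ^ ((N : ℝ) + 2 * s) * gagliardoSq N s φ +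
        2 * (v * δ ^ N * ∫ x in shell (Eucl N) δ 1, φ x ^ 2) := by
    rw [integral_add (hF.const_mul _) (((hφ2 _ inferInstance).comp_snd _).const_mul _),
      integral_const_mul, integral_const_mul, integral_fun_snd (fun x => φ x ^ 2),
      measureReal_restrict_apply_univ, smul_eq_mul, volume_real_ball hN hδ.le]
    have e1 : ∫ p, gagliardoIntegrand N s φ p ∂((volume.restrict Bδ).prod (volume.restrict A)) ≤
        gagliardoSq N s φ :=
      integral_mono_measure hle (Eventually.of_forall (gagliardoIntegrand_nonneg N s φ)) hI
    have e2 : ∫ x in A, φ x ^ 2 ≤ ∫ x in shell (Eucl N) δ 1, φ x ^ 2 :=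
      setIntegral_mono_set (hφ2 _ inferInstance) (Eventually.of_forall fun x => sq_nonneg _)
        (LE.le.eventuallyLE fun x hx => ⟨hx.1, hx.2.trans_le (by linarith)⟩)
    rw [mul_comm (δ ^ N)]
    gcongr
  have hX : 0 ≤ ∫ x in Bδ, φ x ^ 2 := integral_nonneg fun x => sq_nonneg _
  have h4 : v * δ ^ N ≤ (volume : Measure (Eucl N)).real A := by
    rw [volume_real_shell hN hδ.le (by linarith), mul_pow, mul_comm v]
    gcongr
    have : (2 : ℝ) ≤ 2 ^ N := by
      calc (2 : ℝ) = 2 ^ 1 := by norm_num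
        _ ≤ 2 ^ N := pow_le_pow_right₀ (by norm_num) hN
    nlinarith [pow_pos hδ N]
  have h5 : v * δ ^ N * ∫ x in Bδ, φ x ^ 2 ≤ v * δ ^ N *
      (2 * 3 ^ ((N : ℝ) + 2 * s) / v * δ ^ (2 * s) * gagliardoSq N s φ +
        2 * ∫ x in shell (Eucl N) δ 1, φ x ^ 2) := by
    refine (mul_le_mul_of_nonneg_right h4 hX).trans ?_
    rw [← h2]
    refine h1.trans (h3.trans (le_of_eq ?_))
    rw [Real.mul_rpow (by norm_num) hδ.le, Real.rpow_add hδ, Real.rpow_natCast]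
    field_simp
  exact le_of_mul_le_mul_left h5 (by positivity)

theorem IsTestFunction.integral_unitBall_sq_le (hN : 0 < N) (hs : 0 ≤ s)
    (hφ : IsTestFunction (unitBall N) φ)
    (hI : Integrable (gagliardoIntegrand N s φ)
      ((volume.restrict (unitBall N)).prod (volume.restrict (unitBall N))))
    {δ : ℝ} (hδ : 0 < δ) (hδ2 : δ ≤ 1 / 2) :
    ∫ x in unitBall N, φ x ^ 2 ≤
      2 * 3 ^ ((N : ℝ) + 2 * s) / (volume : Measure (Eucl N)).real (unitBall N) *
        δ ^ (2 * s) * gagliardoSq N s φ + 3 * ∫ x in shell (Eucl N) δ 1, φ x ^ 2 := by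
  have h1 := hφ.integral_ball_sq_le hN hs hI hδ hδ2
  have h2 : ∫ x in shell (Eucl N) δ 1, φ x ^ 2 =
      (∫ x in unitBall N, φ x ^ 2) - ∫ x in Metric.ball (0 : Eucl N) δ, φ x ^ 2 := by
    rw [shell_eq_diff]
    exact setIntegral_sdiff measurableSet_ball (hφ.memLp 2 _).integrable_sq
      (Metric.ball_subset_ball (by linarith))
  linarith

/-- The `L²` mass in a shell is controlled by the mean and the oscillation. -/
theorem IsTestFunction.integral_shell_sq_le (hN : 0 < N) (hs : 1 / 2 < s)
    (hφ : IsTestFunction (unitBall N) φ) (hr : IsRadial φ)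
    (hI : Integrable (gagliardoIntegrand N s φ)
      ((volume.restrict (unitBall N)).prod (volume.restrict (unitBall N))))
    {δ a b : ℝ} (hδ : 0 < δ) (ha : δ ≤ a) (hab : a < b) (hb : b ≤ 1) :
    ∫ x in shell (Eucl N) a b, φ x ^ 2 ≤
      2 * (∫ x in shell (Eucl N) a b, φ x) ^ 2 /
        (volume : Measure (Eucl N)).real (shell (Eucl N) a b) +
      (volume : Measure (Eucl N)).real (shell (Eucl N) a b) *
        (2 * (morreyConst N s δ * gagliardoSq N s φ * (b - a) ^ (2 * s - 1))) := by
  set A := shell (Eucl N) a b with hA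
  set κ := morreyConst N s δ * gagliardoSq N s φ * (b - a) ^ (2 * s - 1) with hκ
  have hD0 := mul_nonneg (morreyConst_nonneg N s δ) (gagliardoSq_nonneg N s φ)
  have hκ0 : 0 ≤ κ := mul_nonneg hD0 (Real.rpow_nonneg (by linarith) _)
  have hVA : 0 < (volume : Measure (Eucl N)).real A := by
    refine lt_of_lt_of_le ?_ (volume_real_shell_ge hN (hδ.le.trans ha) hab.le)
    have := volume_real_unitBall_pos (N := N)
    have : 0 < b - a := by linarith
    have : 0 < a := by linarith
    positivity
  have hosc : ∀ y ∈ A, ∀ z ∈ A, (φ y - φ z) ^ 2 ≤ κ := by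
    have key : ∀ y ∈ A, ∀ z ∈ A, ‖y‖ ≤ ‖z‖ → (φ y - φ z) ^ 2 ≤ κ := by
      intro y hy z hz hyz
      refine (sub_sq_le_morrey hN hs hφ.1.continuous hφ.2.1 hr hI hδ (ha.trans hy.1) hyz
        (hz.2.le.trans hb)).trans ?_
      refine mul_le_mul_of_nonneg_left ?_ hD0
      exact Real.rpow_le_rpow (by linarith) (by linarith [hz.2, hy.1]) (by linarith)
    intro y hy z hz
    rcases le_total ‖y‖ ‖z‖ with h | h
    · exact key y hy z hz h
    · rw [← neg_sub, neg_sq]; exact key z hz y hy h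
  have hφA : Integrable φ (volume.restrict A) := (hφ.memLp 1 _).integrable le_rfl
  set m := (∫ x in A, φ x) / (volume : Measure (Eucl N)).real A with hm
  -- The values of φ differ from its mean m by at most √κ, and φ² ≤ 2m² + 2(φ - m)².
  have hpt : ∀ y ∈ A, φ y ^ 2 ≤ 2 * m ^ 2 + 2 * κ := by
    intro y hy
    have h1 : φ y - m = (∫ z in A, (φ y - φ z)) / (volume : Measure (Eucl N)).real A := by
      rw [integral_sub (integrable_const _) hφA, integral_const, measureReal_restrict_apply_univ,
        smul_eq_mul, hm]
      field_simp
    have h2 : ‖∫ z in A, (φ y - φ z)‖ ≤ Real.sqrt κ * (volume : Measure (Eucl N)).real A :=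
      norm_setIntegral_le_of_norm_le_const (volume_shell_lt_top _ _) fun z hz =>
        Real.abs_le_sqrt (hosc y hy z hz)
    have h3 : |φ y - m| ≤ Real.sqrt κ := by
      rw [h1, abs_div, abs_of_pos hVA, div_le_iff₀ hVA]
      exact h2
    have h4 : (φ y - m) ^ 2 ≤ κ := by
      rw [← sq_abs, ← Real.sq_sqrt hκ0]
      gcongr
    nlinarith [sq_nonneg (φ y - 2 * m)]
  calc ∫ x in A, φ x ^ 2 ≤ ∫ _ in A, (2 * m ^ 2 + 2 * κ) :=
        setIntegral_mono_on (hφ.memLp 2 _).integrable_sq (integrable_const _)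
          (measurableSet_shell _ _) hpt
    _ = _ := by
        rw [integral_const, measureReal_restrict_apply_univ, smul_eq_mul, hm]
        field_simp

/-- On each of n thin shells φ is its mean up to a small oscillation. The oscillation errors add up
to a multiple of the energy that vanishes as n → ∞, because s > 1/2; what remains involves only
finitely many linear functionals of φ. -/
theorem IsTestFunction.integral_shell_sq_le_sum (hN : 0 < N) (hs : 1 / 2 < s)
    (hφ : IsTestFunction (unitBall N) φ) (hr : IsRadial φ)
    (hI : Integrable (gagliardoIntegrand N s φ)
      ((volume.restrict (unitBall N)).prod (volume.restrict (unitBall N))))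
    {δ : ℝ} (hδ : 0 < δ) (hδ1 : δ < 1) {n : ℕ} (hn : 0 < n) {r : ℕ → ℝ}
    (hr' : r = fun i : ℕ => δ + i * ((1 - δ) / n)) :
    ∫ x in shell (Eucl N) δ 1, φ x ^ 2 ≤
      (∑ i ∈ Finset.range n, 2 / (volume : Measure (Eucl N)).real (shell (Eucl N) (r i) (r (i + 1)))
        * (∫ x in shell (Eucl N) (r i) (r (i + 1)), φ x) ^ 2) +
      (volume : Measure (Eucl N)).real (unitBall N) *
        (2 * (morreyConst N s δ * gagliardoSq N s φ * (1 / (n : ℝ)) ^ (2 * s - 1))) := by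
  have hn' : (0 : ℝ) < n := Nat.cast_pos.2 hn
  have hh : 0 < (1 - δ) / n := div_pos (by linarith) hn'
  have hr0 : r 0 = δ := by simp [hr']
  have hrn : r n = 1 := by rw [hr']; field_simp; ring
  have hstep : ∀ i, r (i + 1) - r i = (1 - δ) / n := fun i => by
    rw [hr']; push_cast; ring
  have hge : ∀ i, δ ≤ r i := fun i => by
    rw [hr']; simp only; have : 0 ≤ (i : ℝ) * ((1 - δ) / n) := by positivity
    linarith
  have hle : ∀ i, i ≤ n → r i ≤ 1 := fun i hi => by
    rw [← hrn, hr']; simp only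
    gcongr
  set κ := 2 * (morreyConst N s δ * gagliardoSq N s φ * (1 / (n : ℝ)) ^ (2 * s - 1)) with hκ
  set Φ : ℝ → ℝ := fun t => ∫ x in Metric.ball (0 : Eucl N) t, φ x ^ 2 with hΦ
  have hshell : ∀ a b, a ≤ b → ∫ x in shell (Eucl N) a b, φ x ^ 2 = Φ b - Φ a := by
    intro a b hab
    rw [shell_eq_diff]
    exact setIntegral_sdiff measurableSet_ball (hφ.memLp 2 _).integrable_sq
      (Metric.ball_subset_ball hab)
  have hsum : ∫ x in shell (Eucl N) δ 1, φ x ^ 2 =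
      ∑ i ∈ Finset.range n, ∫ x in shell (Eucl N) (r i) (r (i + 1)), φ x ^ 2 := by
    rw [hshell _ _ hδ1.le, ← hr0, ← hrn, ← Finset.sum_range_sub (fun i => Φ (r i))]
    refine Finset.sum_congr rfl fun i _ => ?_
    rw [hshell _ _ (by linarith [hstep i])]
  have hvol : ∑ i ∈ Finset.range n,
      (volume : Measure (Eucl N)).real (shell (Eucl N) (r i) (r (i + 1))) ≤
      (volume : Measure (Eucl N)).real (unitBall N) := by
    have : ∀ i ∈ Finset.range n,
        (volume : Measure (Eucl N)).real (shell (Eucl N) (r i) (r (i + 1))) =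
        r (i + 1) ^ N * (volume : Measure (Eucl N)).real (unitBall N) -
          r i ^ N * (volume : Measure (Eucl N)).real (unitBall N) := fun i _ => by
      rw [volume_real_shell hN (hδ.le.trans (hge i)) (by linarith [hstep i]), sub_mul]
    rw [Finset.sum_congr rfl this,
      Finset.sum_range_sub (fun i => r i ^ N * (volume : Measure (Eucl N)).real (unitBall N)), hr0,
      hrn, one_pow, one_mul]
    have := volume_real_unitBall_pos (N := N)
    have : 0 ≤ δ ^ N * (volume : Measure (Eucl N)).real (unitBall N) := by positivity
    linarith
  have hκ0 : 0 ≤ κ := by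
    have := mul_nonneg (morreyConst_nonneg N s δ) (gagliardoSq_nonneg N s φ)
    positivity
  rw [hsum]
  refine le_trans (Finset.sum_le_sum (g := fun i =>
    2 / (volume : Measure (Eucl N)).real (shell (Eucl N) (r i) (r (i + 1)))
        * (∫ x in shell (Eucl N) (r i) (r (i + 1)), φ x) ^ 2 +
      (volume : Measure (Eucl N)).real (shell (Eucl N) (r i) (r (i + 1))) * κ)
    fun i hi => ?_) ?_
  · have hi' : i + 1 ≤ n := Finset.mem_range.1 hi
    refine (hφ.integral_shell_sq_le hN hs hr hI hδ (hge i) (by linarith [hstep i])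
      (hle _ hi')).trans ?_
    rw [hstep, mul_div_right_comm]
    have e0 := mul_nonneg (morreyConst_nonneg N s δ) (gagliardoSq_nonneg N s φ)
    have e1 : ((1 - δ) / n) ^ (2 * s - 1) ≤ (1 / (n : ℝ)) ^ (2 * s - 1) := by
      refine Real.rpow_le_rpow hh.le ?_ (by linarith)
      gcongr
      linarith
    rw [hκ]
    gcongr
  · rw [Finset.sum_add_distrib, ← Finset.sum_mul]
    gcongr

end TestFunctions

/-! ### From test functions to `Hs0rad`: pointwise bound, Poincaré, compactness in L² -/

section Closure

variable {N : ℕ} {s : ℝ}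

/-- The density principle: an estimate between continuous quantities need only be proved for smooth
radial representatives. -/
theorem Hs0rad_induction {Ω : Set (Eucl N)} {P : Hs N s Ω → Prop} (hP : IsClosed {u | P u})
    (h : ∀ (u : Hs N s Ω) (φ : Eucl N → ℝ), IsTestFunction Ω φ → IsRadial φ → u =ᵐ[volume.restrict Ω] φ → P u)
    {u : Hs N s Ω} (hu : u ∈ Hs0rad N s Ω) : P u := by
  have h1 : (radialTestSubspace N s Ω : Set (Hs N s Ω)) ⊆ {u | P u} := by
    rintro v ⟨φ, h1, h2, h3⟩
    exact h v φ h1 h2 h3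
  exact closure_minimal h1 hP hu

/-- Elements of `H^s_{0,rad}` are bounded away from the origin by their energy. -/
theorem exists_ae_sq_le_energy (hN : 0 < N) (hs : 1 / 2 < s) (hs1 : s < 1) {δ : ℝ} (hδ : 0 < δ) :
    ∃ C, 0 ≤ C ∧ ∀ u ∈ Hs0rad N s (unitBall N),
      ∀ᵐ x ∂(volume.restrict (unitBall N)), δ ≤ ‖x‖ → u x ^ 2 ≤ C * u.energy := by
  have hs0 : 0 < s := by linarith
  have hc := fracConst_pos N hs0 hs1
  refine ⟨morreyConst N s δ * (2 / fracConst N s),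
    mul_nonneg (morreyConst_nonneg N s δ) (by positivity), fun u hu => ?_⟩
  refine Hs0rad_induction (P := fun u => ∀ᵐ x ∂(volume.restrict (unitBall N)),
    δ ≤ ‖x‖ → u x ^ 2 ≤ morreyConst N s δ * (2 / fracConst N s) * u.energy) ?_ ?_ hu
  · refine isSeqClosed_iff_isClosed.1 ?_
    intro w z hw hz
    -- A pointwise bound is closed under convergence in `H^s`, since L² convergence gives almost
    -- everywhere convergence of a subsequence.
    obtain ⟨ψ, hψ, hψa⟩ := (tendstoInMeasure_of_tendsto_Lp
      ((Hs.continuous_toL2.tendsto z).comp hz)).exists_seq_tendsto_ae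
    filter_upwards [hψa, ae_all_iff.2 hw] with x hx hwx hδx
    refine le_of_tendsto_of_tendsto (hx.pow 2)
      ((((Hs.continuous_energy hs0 hs1).tendsto z).comp (hz.comp hψ.tendsto_atTop)).const_mul _)
      (Eventually.of_forall fun n => ?_)
    exact hwx (ψ n) hδx
  · intro w φ hφ hr hw
    filter_upwards [hw] with x hx hδx
    rw [hx, Hs.energy_eq_integral_prod hw]
    refine (hφ.sq_le_gagliardoSq hN hs hr (Hs.integrable_gagliardoIntegrand_of_ae hw) hδ
      hδx).trans (le_of_eq ?_)
    rw [gagliardoSq]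
    field_simp

/-- The Poincaré inequality on `H^s_{0,rad}` of the unit ball, `s > 1/2`. -/
theorem exists_poincare (hN : 0 < N) (hs : 1 / 2 < s) (hs1 : s < 1) :
    ∃ C, 0 ≤ C ∧ ∀ u ∈ Hs0rad N s (unitBall N), ‖Hs.toL2 u‖ ^ 2 ≤ C * u.energy := by
  have hs0 : 0 < s := by linarith
  have hc := fracConst_pos N hs0 hs1
  set v := (volume : Measure (Eucl N)).real (unitBall N) with hv
  have hv0 : 0 < v := volume_real_unitBall_pos
  have hM := morreyConst_nonneg N s (1 / 2)
  set K := 2 * 3 ^ ((N : ℝ) + 2 * s) / v * (1 / 2) ^ (2 * s) +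
    3 * (v * morreyConst N s (1 / 2)) with hK
  have hK0 : 0 ≤ K := by positivity
  refine ⟨K * (2 / fracConst N s), by positivity, fun u hu => ?_⟩
  refine Hs0rad_induction (P := fun u => ‖Hs.toL2 u‖ ^ 2 ≤ K * (2 / fracConst N s) * u.energy)
    (isClosed_le (Hs.continuous_toL2.norm.pow 2) ((Hs.continuous_energy hs0 hs1).const_mul _)) ?_ hu
  intro w φ hφ hr hw
  have hI := Hs.integrable_gagliardoIntegrand_of_ae hw
  have h1 := hφ.integral_unitBall_sq_le hN hs0.le hI (δ := 1 / 2) (by norm_num) le_rfl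
  have hD := gagliardoSq_nonneg N s φ
  have h2 : ∫ x in shell (Eucl N) (1 / 2) 1, φ x ^ 2 ≤
      v * (morreyConst N s (1 / 2) * gagliardoSq N s φ) := by
    calc ∫ x in shell (Eucl N) (1 / 2) 1, φ x ^ 2
        ≤ ∫ _ in shell (Eucl N) (1 / 2) 1, morreyConst N s (1 / 2) * gagliardoSq N s φ :=
          setIntegral_mono_on (hφ.memLp 2 _).integrable_sq (integrable_const _)
            (measurableSet_shell _ _) fun x hx =>
              hφ.sq_le_gagliardoSq hN hs hr hI (by norm_num) hx.1
      _ ≤ _ := by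
          rw [integral_const, measureReal_restrict_apply_univ, smul_eq_mul]
          gcongr
          exact measureReal_mono (shell_subset_unitBall le_rfl) measure_ball_lt_top.ne
  rw [Hs.norm_toL2_sq_of_ae hw, Hs.energy_eq_integral_prod hw]
  have h3 : K * (2 / fracConst N s) * (fracConst N s / 2 * ∫ p, gagliardoIntegrand N s φ p
      ∂((volume.restrict (unitBall N)).prod (volume.restrict (unitBall N)))) =
      K * gagliardoSq N s φ := by
    rw [gagliardoSq]; field_simp
  rw [h3, hK]
  linarith

/-- A quantitative form of the compactness of the embedding of `H^s_{0,rad}` into `L²`. -/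
theorem exists_norm_toL2_sq_le_sum (hN : 0 < N) (hs : 1 / 2 < s) (hs1 : s < 1) {ε : ℝ}
    (hε : 0 < ε) :
    ∃ (n : ℕ) (w : ℕ → ℝ) (y : ℕ → Lp ℝ 2 (volume.restrict (unitBall N))),
      ∀ u ∈ Hs0rad N s (unitBall N),
        ‖Hs.toL2 u‖ ^ 2 ≤ ε * u.energy +
          ∑ i ∈ Finset.range n, w i * (inner ℝ (y i) (Hs.toL2 u)) ^ 2 := by
  have hs0 : 0 < s := by linarith
  have hc := fracConst_pos N hs0 hs1
  set v := (volume : Measure (Eucl N)).real (unitBall N) with hv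
  have hv0 : 0 < v := volume_real_unitBall_pos
  -- The allowance ε, rewritten in terms of `gagliardoSq`, is shared equally: one η pays for the
  -- mass in the inner ball through the choice of δ, the other for the oscillation on the shells
  -- through the choice of n.
  set η := ε * (fracConst N s / 2) / 2 with hη
  have hη0 : 0 < η := by positivity
  obtain ⟨δ, hδ, hδ2, hδη⟩ : ∃ δ : ℝ, 0 < δ ∧ δ ≤ 1 / 2 ∧
      2 * 3 ^ ((N : ℝ) + 2 * s) / v * δ ^ (2 * s) < η := by
    have h1 : Tendsto (fun δ : ℝ => 2 * 3 ^ ((N : ℝ) + 2 * s) / v * δ ^ (2 * s)) (𝓝[>] 0)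
        (𝓝 (2 * 3 ^ ((N : ℝ) + 2 * s) / v * 0 ^ (2 * s))) :=
      (((Real.continuousAt_rpow_const 0 (2 * s) (Or.inr (by linarith))).tendsto).const_mul
        _).mono_left nhdsWithin_le_nhds
    rw [Real.zero_rpow (by linarith), mul_zero] at h1
    have h2 : ∀ᶠ δ : ℝ in 𝓝[>] 0, δ ≤ 1 / 2 :=
      nhdsWithin_le_nhds (eventually_le_nhds (by norm_num))
    obtain ⟨δ, h3, h4, h5⟩ := ((h1.eventually (gt_mem_nhds hη0)).and
      (h2.and self_mem_nhdsWithin)).exists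
    exact ⟨δ, h5, h4, h3⟩
  obtain ⟨n, hn, hnη⟩ : ∃ n : ℕ, 0 < n ∧
      3 * (v * (2 * (morreyConst N s δ * (1 / (n : ℝ)) ^ (2 * s - 1)))) < η := by
    have h1 : Tendsto (fun n : ℕ => 3 * (v * (2 * (morreyConst N s δ *
        (1 / (n : ℝ)) ^ (2 * s - 1))))) atTop
        (𝓝 (3 * (v * (2 * (morreyConst N s δ * 0 ^ (2 * s - 1)))))) :=
      ((((((Real.continuousAt_rpow_const 0 (2 * s - 1) (Or.inr (by linarith))).tendsto).comp
        tendsto_one_div_atTop_nhds_zero_nat).const_mul _).const_mul _).const_mul _).const_mul _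
    rw [Real.zero_rpow (by linarith), mul_zero, mul_zero, mul_zero, mul_zero] at h1
    obtain ⟨n, h2, h3⟩ := ((h1.eventually (gt_mem_nhds hη0)).and (eventually_gt_atTop 0)).exists
    exact ⟨n, h3, h2⟩
  set r : ℕ → ℝ := fun i : ℕ => δ + i * ((1 - δ) / n) with hr'
  have hn' : (0 : ℝ) < n := Nat.cast_pos.2 hn
  have hmeas : ∀ i, MeasurableSet (shell (Eucl N) (r i) (r (i + 1))) := fun i =>
    measurableSet_shell _ _
  -- The test vectors are the indicators of the shells, so the inner products are the integrals of u
  -- over them.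
  refine ⟨n, fun i => 3 * (2 / (volume : Measure (Eucl N)).real (shell (Eucl N) (r i) (r (i + 1)))),
    fun i => indicatorConstLp 2 (hmeas i) (measure_ne_top _ _) 1, fun u hu => ?_⟩
  refine Hs0rad_induction (P := fun u => ‖Hs.toL2 u‖ ^ 2 ≤ ε * u.energy +
    ∑ i ∈ Finset.range n,
      3 * (2 / (volume : Measure (Eucl N)).real (shell (Eucl N) (r i) (r (i + 1)))) *
      (inner ℝ (indicatorConstLp 2 (hmeas i) (measure_ne_top _ _) 1) (Hs.toL2 u)) ^ 2)
    (isClosed_le (Hs.continuous_toL2.norm.pow 2)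
      (((Hs.continuous_energy hs0 hs1).const_mul _).add (continuous_finsetSum _ fun i _ =>
        ((continuous_const.inner Hs.continuous_toL2).pow 2).const_mul _))) ?_ hu
  intro w φ hφ hr hw
  have hI := Hs.integrable_gagliardoIntegrand_of_ae hw
  have hD := gagliardoSq_nonneg N s φ
  have h1 := hφ.integral_unitBall_sq_le hN hs0.le hI hδ hδ2
  have h2 := hφ.integral_shell_sq_le_sum hN hs hr hI hδ (by linarith) hn hr'
  have h3 : ∀ i ∈ Finset.range n, inner ℝ (indicatorConstLp 2 (hmeas i) (measure_ne_top _ _) 1)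
      (Hs.toL2 w) = ∫ x in shell (Eucl N) (r i) (r (i + 1)), φ x := by
    intro i hi
    rw [L2.inner_indicatorConstLp_one]
    have hsub : shell (Eucl N) (r i) (r (i + 1)) ⊆ unitBall N := by
      refine shell_subset_unitBall ?_
      have h4 : ((i + 1 : ℕ) : ℝ) ≤ n := by exact_mod_cast Finset.mem_range.1 hi
      have h5 : ((i + 1 : ℕ) : ℝ) * ((1 - δ) / n) ≤ n * ((1 - δ) / n) := by
        exact mul_le_mul_of_nonneg_right h4 (div_nonneg (by linarith) hn'.le)
      rw [hr']
      simp only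
      have h6 : (n : ℝ) * ((1 - δ) / n) = 1 - δ := by field_simp
      linarith
    rw [Measure.restrict_restrict (hmeas i), inter_eq_left.2 hsub]
    exact integral_congr_ae (ae_restrict_of_ae_restrict_of_subset hsub hw)
  have h4 : ∑ i ∈ Finset.range n,
      3 * (2 / (volume : Measure (Eucl N)).real (shell (Eucl N) (r i) (r (i + 1)))) *
      (inner ℝ (indicatorConstLp 2 (hmeas i) (measure_ne_top _ _) 1) (Hs.toL2 w)) ^ 2 =
      3 * ∑ i ∈ Finset.range n,
        2 / (volume : Measure (Eucl N)).real (shell (Eucl N) (r i) (r (i + 1))) *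
        (∫ x in shell (Eucl N) (r i) (r (i + 1)), φ x) ^ 2 := by
    rw [Finset.mul_sum]
    refine Finset.sum_congr rfl fun i hi => ?_
    rw [h3 i hi]
    ring
  rw [Hs.norm_toL2_sq_of_ae hw, Hs.energy_eq_integral_prod hw, h4]
  change _ ≤ ε * (fracConst N s / 2 * gagliardoSq N s φ) + _
  have h5 := mul_le_mul_of_nonneg_right hδη.le hD
  have h6 := mul_le_mul_of_nonneg_right hnη.le hD
  have h7 : ε * (fracConst N s / 2 * gagliardoSq N s φ) =
      η * gagliardoSq N s φ + η * gagliardoSq N s φ := by rw [hη]; ring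
  rw [h7]
  linarith

end Closure


/-! ### Interpolation and the potential term in L² -/

section Lebesgue

variable {α : Type*} [MeasurableSpace α] {ν : Measure α}

/-- Interpolation between `L²` and `L^∞`. -/
theorem MeasureTheory.toReal_eLpNorm_le_of_bound {f : α → ℝ} {K p : ℝ} (hK : 0 ≤ K) (hp : 2 < p)
    (hf : ∀ᵐ x ∂ν, |f x| ≤ K) (hf2 : eLpNorm f 2 ν ≠ ⊤) :
    (eLpNorm f (ENNReal.ofReal p) ν).toReal ≤
      K ^ (1 - 2 / p) * (eLpNorm f 2 ν).toReal ^ (2 / p) := by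
  have hp0 : 0 < p := by linarith
  have e2 : eLpNorm f 2 ν ^ (2 / p) = (∫⁻ x, ‖f x‖ₑ ^ (2 : ℝ) ∂ν) ^ (1 / p) := by
    rw [eLpNorm_eq_lintegral_rpow_enorm_toReal (by norm_num) (by norm_num), ← ENNReal.rpow_mul]
    simp only [ENNReal.toReal_ofNat]
    congr 1
    field_simp
  have h1 : eLpNorm f (ENNReal.ofReal p) ν ≤
      ENNReal.ofReal K ^ (1 - 2 / p) * eLpNorm f 2 ν ^ (2 / p) := by
    rw [e2, eLpNorm_eq_lintegral_rpow_enorm_toReal (by simpa using hp0) ENNReal.ofReal_ne_top,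
      ENNReal.toReal_ofReal hp0.le]
    have h2 : ∫⁻ x, ‖f x‖ₑ ^ p ∂ν ≤
        ENNReal.ofReal K ^ (p - 2) * ∫⁻ x, ‖f x‖ₑ ^ (2 : ℝ) ∂ν := by
      rw [← lintegral_const_mul' _ _ (ENNReal.rpow_ne_top_of_nonneg (by linarith)
        ENNReal.ofReal_ne_top)]
      refine lintegral_mono_ae ?_
      filter_upwards [hf] with x hx
      have h3 : ‖f x‖ₑ ≤ ENNReal.ofReal K := by
        rw [Real.enorm_eq_ofReal_abs]
        exact ENNReal.ofReal_le_ofReal hx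
      calc ‖f x‖ₑ ^ p = ‖f x‖ₑ ^ (p - 2) * ‖f x‖ₑ ^ (2 : ℝ) := by
            rw [← ENNReal.rpow_add_of_nonneg _ _ (by linarith) (by norm_num)]
            congr 1
            ring
        _ ≤ _ := by gcongr
    calc (∫⁻ x, ‖f x‖ₑ ^ p ∂ν) ^ (1 / p)
        ≤ (ENNReal.ofReal K ^ (p - 2) * ∫⁻ x, ‖f x‖ₑ ^ (2 : ℝ) ∂ν) ^ (1 / p) := by gcongr
      _ = _ := by
          rw [ENNReal.mul_rpow_of_nonneg _ _ (by positivity), ← ENNReal.rpow_mul]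
          congr 2
          field_simp
  have hq : 0 ≤ 1 - 2 / p := by
    rw [sub_nonneg, div_le_one hp0]
    exact hp.le
  refine (ENNReal.toReal_mono (ENNReal.mul_ne_top (ENNReal.rpow_ne_top_of_nonneg hq
    ENNReal.ofReal_ne_top) (ENNReal.rpow_ne_top_of_nonneg (by positivity) hf2)) h1).trans_eq ?_
  rw [ENNReal.toReal_mul, ← ENNReal.toReal_rpow, ← ENNReal.toReal_rpow, ENNReal.toReal_ofReal hK]

theorem MeasureTheory.integrable_bdd_mul_sq {h : α → ℝ} (hh : MemLp h ⊤ ν) (f : Lp ℝ 2 ν) :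
    Integrable (fun x => h x * f x ^ 2) ν :=
  (Lp.memLp f).integrable_sq.bdd_mul hh.1 (ae_le_lpNorm_exponent_top hh)

/-- Factor f² - g² = (f - g)(f + g) and apply Cauchy–Schwarz. This gives continuity of the potential
term in L² and, for g = 0, its bound by ‖f‖². -/
theorem MeasureTheory.abs_integral_mul_sq_sub_le {h : α → ℝ} (hh : MemLp h ⊤ ν) (f g : Lp ℝ 2 ν) :
    |(∫ x, h x * f x ^ 2 ∂ν) - ∫ x, h x * g x ^ 2 ∂ν| ≤
      lpNorm h ⊤ ν * (‖f - g‖ * ‖f + g‖) := by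
  have h1 : Integrable (fun x => |(f - g : Lp ℝ 2 ν) x| * |(f + g : Lp ℝ 2 ν) x|) ν :=
    (Lp.memLp (f - g)).abs.integrable_mul (Lp.memLp (f + g)).abs
  rw [← integral_sub (integrable_bdd_mul_sq hh f) (integrable_bdd_mul_sq hh g), ← Real.norm_eq_abs]
  have h2 : ∫ x, |(f - g : Lp ℝ 2 ν) x| * |(f + g : Lp ℝ 2 ν) x| ∂ν ≤ ‖f - g‖ * ‖f + g‖ := by
    have h3 := real_inner_le_norm |f - g| |f + g|
    rw [norm_abs_eq_norm, norm_abs_eq_norm, L2.inner_def] at h3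
    refine le_trans (le_of_eq (integral_congr_ae ?_)) h3
    filter_upwards [Lp.coeFn_abs (f - g), Lp.coeFn_abs (f + g)] with x hx hx'
    rw [hx, hx', real_inner_eq_re_inner, RCLike.inner_apply]
    simp [mul_comm]
  refine (norm_integral_le_of_norm_le (h1.const_mul (lpNorm h ⊤ ν)) ?_).trans ?_
  · filter_upwards [ae_le_lpNorm_exponent_top hh, Lp.coeFn_sub f g, Lp.coeFn_add f g]
      with x hx hx1 hx2
    rw [hx1, hx2, Pi.sub_apply, Pi.add_apply, ← abs_mul,
      show h x * f x ^ 2 - h x * g x ^ 2 = h x * ((f x - g x) * (f x + g x)) by ring, norm_mul,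
      Real.norm_eq_abs ((f x - g x) * (f x + g x))]
    gcongr
  · rw [integral_const_mul]
    exact mul_le_mul_of_nonneg_left h2 lpNorm_nonneg

end Lebesgue

/-! ### Sobolev inequalities contained in positive infima -/

section SobolevBounds

variable {N : ℕ} {s : ℝ}

/-- A set unbounded below has `sInf` equal to 0 by convention, so positivity certifies boundedness
below. -/
theorem csInf_le_of_sInf_pos {X : Set ℝ} (h : 0 < sInf X) {x : ℝ} (hx : x ∈ X) : sInf X ≤ x := by
  refine csInf_le ?_ hx
  by_contra hb
  rw [Real.sInf_of_not_bddBelow hb] at h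
  exact lt_irrefl _ h

theorem critNorm_nonneg {Ω : Set (Eucl N)} (u : Hs N s Ω) : 0 ≤ critNorm u := ENNReal.toReal_nonneg

theorem critNorm_zero {Ω : Set (Eucl N)} : critNorm (0 : Hs N s Ω) = 0 := by
  have : eLpNorm (Hs.toL2 (0 : Hs N s Ω)) (ENNReal.ofReal (critExp N s)) (volume.restrict Ω) = 0 := by
    rw [map_zero, eLpNorm_congr_ae (Lp.coeFn_zero _ _ _), eLpNorm_zero]
  rw [critNorm, this, ENNReal.toReal_zero]

theorem energyWith_zero {Ω : Set (Eucl N)} (hs0 : 0 < s) (hs1 : s < 1) (h : Eucl N → ℝ) :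
    energyWith h (0 : Hs N s Ω) = 0 := by
  have h1 : (0 : Hs N s Ω).energy = 0 := by
    have := Hs.energy_smul 0 hs0 hs1 (0 : Hs N s Ω)
    rw [zero_smul] at this
    linarith
  have h2 : ∫ x in Ω, h x * (0 : Hs N s Ω) x ^ 2 = 0 := by
    refine integral_eq_zero_of_ae ?_
    have h3 : ((0 : Hs N s Ω) : Eucl N → ℝ) =ᵐ[volume.restrict Ω] 0 := by
      rw [map_zero]; exact Lp.coeFn_zero _ _ _
    filter_upwards [h3] with x hx
    rw [hx]
    simp
  rw [energyWith, h1, h2, add_zero]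

/-- An infinite norm becomes 0 under `toReal`, so a nonzero `critNorm` forces a finite one. -/
theorem memLp_critExp_of_critNorm_ne_zero {Ω : Set (Eucl N)} {u : Hs N s Ω}
    (h : u ≠ 0 → critNorm u ≠ 0) :
    MemLp u (ENNReal.ofReal (critExp N s)) (volume.restrict Ω) := by
  refine ⟨Lp.aestronglyMeasurable _, lt_top_iff_ne_top.2 fun h1 => ?_⟩
  by_cases hu : u = 0
  · rw [hu, map_zero, eLpNorm_congr_ae (Lp.coeFn_zero _ _ _), eLpNorm_zero] at h1
    exact ENNReal.zero_ne_top h1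
  · exact h hu (by rw [critNorm, h1, ENNReal.toReal_top])

/-- Were `critNorm u` zero, the quotient would be 0 by the convention for division, below the
positive infimum. Thus positivity already contains the embedding into the critical Lebesgue space.
-/
theorem sobolevConstRad_le {Ω : Set (Eucl N)} {h : Eucl N → ℝ}
    (hpos : 0 < sobolevConstRad N s Ω h) {u : Hs N s Ω} (hu : u ∈ Hs0rad N s Ω) (hu0 : u ≠ 0) :
    critNorm u ≠ 0 ∧ sobolevConstRad N s Ω h * critNorm u ^ 2 ≤ energyWith h u := by
  have h1 : sobolevConstRad N s Ω h ≤ sobolevQuotient h u :=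
    csInf_le_of_sInf_pos hpos ⟨u, hu, hu0, rfl⟩
  have h2 : critNorm u ≠ 0 := by
    intro h3
    rw [sobolevQuotient, h3, zero_pow two_ne_zero, div_zero] at h1
    linarith
  refine ⟨h2, ?_⟩
  have h3 : 0 < critNorm u ^ 2 := pow_pos ((critNorm_nonneg u).lt_of_ne' h2) 2
  rwa [sobolevQuotient, le_div_iff₀ h3] at h1

theorem sobolevConstRad_mul_le {Ω : Set (Eucl N)} (hs0 : 0 < s) (hs1 : s < 1) {h : Eucl N → ℝ}
    (hpos : 0 < sobolevConstRad N s Ω h) {u : Hs N s Ω} (hu : u ∈ Hs0rad N s Ω) :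
    sobolevConstRad N s Ω h * critNorm u ^ 2 ≤ energyWith h u := by
  by_cases hu0 : u = 0
  · rw [hu0, critNorm_zero, energyWith_zero hs0 hs1]
    simp
  · exact (sobolevConstRad_le hpos hu hu0).2

theorem memLp_critExp_of_mem_Hs0rad {Ω : Set (Eucl N)} {h : Eucl N → ℝ}
    (hpos : 0 < sobolevConstRad N s Ω h) {u : Hs N s Ω} (hu : u ∈ Hs0rad N s Ω) :
    MemLp u (ENNReal.ofReal (critExp N s)) (volume.restrict Ω) :=
  memLp_critExp_of_critNorm_ne_zero fun hu0 => (sobolevConstRad_le hpos hu hu0).1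

theorem sobolevConst_le {Ω : Set (Eucl N)} (hpos : 0 < sobolevConst N s Ω) {u : Hs N s Ω}
    (hu : u ∈ Hs0 N s Ω) (hu0 : u ≠ 0) :
    critNorm u ≠ 0 ∧ sobolevConst N s Ω * critNorm u ^ 2 ≤ u.energy := by
  have h1 : sobolevConst N s Ω ≤ u.energy / critNorm u ^ 2 :=
    csInf_le_of_sInf_pos hpos ⟨u, hu, hu0, rfl⟩
  have h2 : critNorm u ≠ 0 := by
    intro h3
    rw [h3, zero_pow two_ne_zero, div_zero] at h1
    linarith
  refine ⟨h2, ?_⟩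
  have h3 : 0 < critNorm u ^ 2 := pow_pos ((critNorm_nonneg u).lt_of_ne' h2) 2
  rwa [le_div_iff₀ h3] at h1

theorem sobolevConst_mul_le {Ω : Set (Eucl N)} (hs0 : 0 < s) (hs1 : s < 1)
    (hpos : 0 < sobolevConst N s Ω) {u : Hs N s Ω} (hu : u ∈ Hs0 N s Ω) :
    sobolevConst N s Ω * critNorm u ^ 2 ≤ u.energy := by
  by_cases hu0 : u = 0
  · rw [hu0, critNorm_zero]
    simpa using Hs.energy_nonneg hs0 hs1 (0 : Hs N s Ω)
  · exact (sobolevConst_le hpos hu hu0).2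

theorem two_lt_critExp (hs : 1 / 2 < s) (hN : 2 * s < (N : ℝ)) : 2 < critExp N s := by
  rw [critExp, lt_div_iff₀ (by linarith)]
  linarith

theorem critNorm_add_le (hs : 1 / 2 < s) (hN : 2 * s < (N : ℝ)) {Ω : Set (Eucl N)} {u v : Hs N s Ω}
    (hu : MemLp u (ENNReal.ofReal (critExp N s)) (volume.restrict Ω))
    (hv : MemLp v (ENNReal.ofReal (critExp N s)) (volume.restrict Ω)) :
    critNorm (u + v) ≤ critNorm u + critNorm v := by
  have hp : 1 ≤ ENNReal.ofReal (critExp N s) := by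
    rw [ENNReal.one_le_ofReal]
    linarith [two_lt_critExp hs hN]
  rw [critNorm, critNorm, critNorm, ← ENNReal.toReal_add hu.2.ne hv.2.ne]
  refine ENNReal.toReal_mono (ENNReal.add_ne_top.2 ⟨hu.2.ne, hv.2.ne⟩) ?_
  rw [map_add, eLpNorm_congr_ae (Lp.coeFn_add _ _)]
  exact eLpNorm_add_le hu.1 hv.1 hp

theorem critNorm_smul {Ω : Set (Eucl N)} (c : ℝ) (u : Hs N s Ω) :
    critNorm (c • u) = |c| * critNorm u := by
  rw [critNorm, map_smul, eLpNorm_congr_ae (Lp.coeFn_smul _ _), eLpNorm_const_smul,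
    ENNReal.toReal_mul, critNorm]
  simp

theorem critNorm_sub_comm {Ω : Set (Eucl N)} (u v : Hs N s Ω) :
    critNorm (u - v) = critNorm (v - u) := by
  rw [← neg_sub, ← neg_one_smul ℝ (v - u), critNorm_smul]
  simp

theorem abs_critNorm_sub_le (hs : 1 / 2 < s) (hN : 2 * s < (N : ℝ)) {Ω : Set (Eucl N)}
    {h : Eucl N → ℝ} (hpos : 0 < sobolevConstRad N s Ω h) {u v : Hs N s Ω}
    (hu : u ∈ Hs0rad N s Ω) (hv : v ∈ Hs0rad N s Ω) :
    |critNorm u - critNorm v| ≤ critNorm (u - v) := by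
  have h1 := critNorm_add_le hs hN (memLp_critExp_of_mem_Hs0rad hpos (Submodule.sub_mem _ hu hv))
    (memLp_critExp_of_mem_Hs0rad hpos hv)
  have h2 := critNorm_add_le hs hN (memLp_critExp_of_mem_Hs0rad hpos (Submodule.sub_mem _ hv hu))
    (memLp_critExp_of_mem_Hs0rad hpos hu)
  rw [sub_add_cancel] at h1 h2
  rw [critNorm_sub_comm v u] at h2
  rw [abs_le]
  constructor <;> linarith

theorem abs_energyWith_sub_energy_le {Ω : Set (Eucl N)} {h : Eucl N → ℝ}
    (hh : MemLp h ⊤ (volume.restrict Ω)) (u : Hs N s Ω) :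
    |energyWith h u - u.energy| ≤ lpNorm h ⊤ (volume.restrict Ω) * ‖Hs.toL2 u‖ ^ 2 := by
  have h1 := abs_integral_mul_sq_sub_le hh (Hs.toL2 u) 0
  have h2 : ∫ x in Ω, h x * (0 : Lp ℝ 2 (volume.restrict Ω)) x ^ 2 = 0 := by
    refine integral_eq_zero_of_ae ?_
    filter_upwards [Lp.coeFn_zero ℝ 2 (volume.restrict Ω)] with x hx
    rw [hx]
    simp
  rw [h2, sub_zero, sub_zero, add_zero, ← sq] at h1
  rw [energyWith, add_sub_cancel_left]
  exact h1

/-- The infimum bounds the critical norm by the full form, and the potential is at most its sup norm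
times the L² mass. This makes critical norms bounded and continuous along strong limits. -/
theorem exists_critNorm_le (hs0 : 0 < s) (hs1 : s < 1) {Ω : Set (Eucl N)} {h : Eucl N → ℝ}
    (hh : MemLp h ⊤ (volume.restrict Ω)) (hpos : 0 < sobolevConstRad N s Ω h) :
    ∃ C, 0 ≤ C ∧ ∀ u ∈ Hs0rad N s Ω, critNorm u ≤ C * ‖u‖ := by
  set S := sobolevConstRad N s Ω h with hS
  set M := lpNorm h ⊤ (volume.restrict Ω) with hM
  have hM0 : 0 ≤ M := lpNorm_nonneg
  refine ⟨Real.sqrt ((1 + M) / S), Real.sqrt_nonneg _, fun u hu => ?_⟩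
  refine le_of_sq_le_sq ?_ (by positivity)
  rw [mul_pow, Real.sq_sqrt (by positivity), div_mul_eq_mul_div, le_div_iff₀ hpos, mul_comm]
  have h1 := sobolevConstRad_mul_le hs0 hs1 hpos hu
  have h2 := (abs_le.1 (abs_energyWith_sub_energy_le hh u)).2
  have h3 := Hs.energy_le_norm_sq hs0 hs1 u
  have h4 : ‖Hs.toL2 u‖ ^ 2 ≤ ‖u‖ ^ 2 := by gcongr; exact Hs.norm_toL2_le u
  have h5 : M * ‖Hs.toL2 u‖ ^ 2 ≤ M * ‖u‖ ^ 2 := by gcongr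
  linarith

end SobolevBounds


/-! ### Localization and comparison with the whole space -/

section Cutoff

variable {N : ℕ} {s : ℝ}

/-- In polar coordinates the density is t^(1-2s) near 0, integrable since s < 1, and t^(-1-2s) at
infinity, integrable since s > 0. -/
theorem integrable_cutoff_kernel (hN : 0 < N) (hs0 : 0 < s) (hs1 : s < 1) (L : ℝ) :
    Integrable (fun z : Eucl N =>
      (if ‖z‖ ≤ 1 then L * ‖z‖ ^ (2 - ((N : ℝ) + 2 * s)) else ‖z‖ ^ (-((N : ℝ) + 2 * s)))) := by
  have := nontrivial_eucl hN
  rw [integrable_fun_norm_addHaar (volume : Measure (Eucl N)) (f := fun t : ℝ =>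
    (if t ≤ 1 then L * t ^ (2 - ((N : ℝ) + 2 * s)) else t ^ (-((N : ℝ) + 2 * s)))),
    finrank_euclideanSpace_fin, ← Ioc_union_Ioi_eq_Ioi zero_le_one]
  have hcast : ((N - 1 : ℕ) : ℝ) = N - 1 := by rw [Nat.cast_sub hN]; norm_num
  refine IntegrableOn.union ?_ ?_
  · have h1 : IntegrableOn (fun t : ℝ => L * t ^ (1 - 2 * s)) (Ioc 0 1) :=
      ((intervalIntegrable_iff_integrableOn_Ioc_of_le zero_le_one).1
        (intervalIntegral.intervalIntegrable_rpow' (by linarith))).const_mul L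
    refine h1.congr_fun (fun t ht => ?_) measurableSet_Ioc
    simp only [if_pos ht.2, smul_eq_mul]
    rw [mul_left_comm, ← Real.rpow_natCast t (N - 1), ← Real.rpow_add ht.1, hcast]
    congr 2
    ring
  · have h1 : IntegrableOn (fun t : ℝ => t ^ (-1 - 2 * s)) (Ioi 1) :=
      integrableOn_Ioi_rpow_of_lt (by linarith) one_pos
    refine h1.congr_fun (fun t (ht : 1 < t) => ?_) measurableSet_Ioi
    have ht0 : 0 < t := by linarith
    simp only [if_neg (not_le.2 ht), smul_eq_mul]
    rw [← Real.rpow_natCast t (N - 1), ← Real.rpow_add ht0, hcast]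
    congr 1
    ring

/-- For a Lipschitz function with values in `[0, 1]`, the inner Gagliardo integral is bounded. -/
theorem exists_lintegral_gagliardoIntegrand_le (hN : 0 < N) (hs0 : 0 < s) (hs1 : s < 1)
    {η : Eucl N → ℝ} {L : ℝ} (hL : ∀ x y, |η x - η y| ≤ L * ‖x - y‖) (h0 : ∀ x, 0 ≤ η x)
    (h1 : ∀ x, η x ≤ 1) :
    ∃ M : ℝ, 0 ≤ M ∧ ∀ x, ∫⁻ y, ENNReal.ofReal (gagliardoIntegrand N s η (x, y)) ≤
      ENNReal.ofReal M := by
  set k : Eucl N → ℝ := fun z =>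
    (if ‖z‖ ≤ 1 then L ^ 2 * ‖z‖ ^ (2 - ((N : ℝ) + 2 * s)) else ‖z‖ ^ (-((N : ℝ) + 2 * s))) with hk
  have hk0 : ∀ z, 0 ≤ k z := fun z => by
    simp only [hk]; split_ifs <;> positivity
  have hki : Integrable k := integrable_cutoff_kernel hN hs0 hs1 (L ^ 2)
  refine ⟨∫ z, k z, integral_nonneg hk0, fun x => ?_⟩
  rw [ofReal_integral_eq_lintegral_ofReal hki (Eventually.of_forall hk0),
    ← lintegral_sub_left_eq_self (fun z => ENNReal.ofReal (k z)) x]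
  refine lintegral_mono fun y => ENNReal.ofReal_le_ofReal ?_
  unfold gagliardoIntegrand
  simp only [hk]
  rcases eq_or_ne x y with rfl | hxy
  · rw [sub_self (η x), zero_pow two_ne_zero, zero_div]
    exact hk0 _
  have hpos : 0 < ‖x - y‖ := norm_pos_iff.2 (sub_ne_zero.2 hxy)
  split_ifs with h
  · rw [Real.rpow_sub hpos, mul_div_assoc']
    gcongr
    have : ‖x - y‖ ^ (2 : ℝ) = ‖x - y‖ ^ 2 := by norm_cast
    rw [this, ← mul_pow, ← sq_abs]
    gcongr
    exact hL x y
  · rw [Real.rpow_neg hpos.le, ← one_div]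
    gcongr
    rw [← sq_abs]
    refine pow_le_one₀ (abs_nonneg _) ?_
    rw [abs_le]
    constructor <;> linarith [h0 x, h0 y, h1 x, h1 y]

theorem aestronglyMeasurable_cutoff_product {φ η : Eucl N → ℝ} (hφ : Continuous φ)
    (hη : Continuous η) (ν : Measure (Eucl N × Eucl N)) :
    AEStronglyMeasurable (fun p : Eucl N × Eucl N => φ p.1 * gagliardoQuot N s η p) ν := by
  have h1 : Measurable (gagliardoQuot N s η) := by
    unfold gagliardoQuot
    have := hη.measurable
    fun_prop
  exact ((hφ.measurable.comp measurable_fst).mul h1).aestronglyMeasurable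

/-- Integrating in y first leaves only the L² norm of φ, so the commutator produced by a cutoff is
of lower order. -/
theorem eLpNorm_cutoff_product_le {φ η : Eucl N → ℝ} (hφ : Continuous φ)
    (hη : Continuous η) {M : ℝ}
    (hM : ∀ x, ∫⁻ y, ENNReal.ofReal (gagliardoIntegrand N s η (x, y)) ≤ ENNReal.ofReal M) :
    eLpNorm (fun p : Eucl N × Eucl N => φ p.1 * gagliardoQuot N s η p) 2
      (volume.prod volume) ≤ ENNReal.ofReal (Real.sqrt M) * eLpNorm φ 2 volume := by
  have hsq : ∀ (a : ℝ), ‖a‖ₑ ^ (2 : ℝ) = ENNReal.ofReal (a ^ 2) := fun a => by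
    rw [Real.enorm_eq_ofReal_abs, ENNReal.rpow_ofNat, ← ENNReal.ofReal_pow (abs_nonneg a), sq_abs]
  have hFm := (measurable_gagliardoIntegrand (s := s) hη.measurable)
  rw [eLpNorm_eq_lintegral_rpow_enorm_toReal (by norm_num) (by norm_num),
    eLpNorm_eq_lintegral_rpow_enorm_toReal (by norm_num) (by norm_num)]
  simp only [ENNReal.toReal_ofNat, hsq, mul_pow, gagliardoQuot_sq]
  have h1 : ∫⁻ p, ENNReal.ofReal (φ p.1 ^ 2 * gagliardoIntegrand N s η p)
      ∂((volume : Measure (Eucl N)).prod volume) ≤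
      ENNReal.ofReal M * ∫⁻ x, ENNReal.ofReal (φ x ^ 2) := by
    rw [lintegral_prod _ (by
      refine Measurable.aemeasurable (Measurable.ennreal_ofReal ?_)
      exact ((hφ.measurable.comp measurable_fst).pow_const 2).mul hFm),
      ← lintegral_const_mul' _ _ ENNReal.ofReal_ne_top]
    refine lintegral_mono fun x => ?_
    simp only [ENNReal.ofReal_mul (sq_nonneg (φ x))]
    rw [lintegral_const_mul' _ _ ENNReal.ofReal_ne_top, mul_comm]
    exact mul_le_mul_left (hM x) _
  calc _ ≤ (ENNReal.ofReal M * ∫⁻ x, ENNReal.ofReal (φ x ^ 2)) ^ (1 / (2 : ℝ)) := by gcongr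
    _ = _ := by
        rw [ENNReal.mul_rpow_of_nonneg _ _ (by norm_num)]
        congr 1
        rcases le_total 0 M with h | h
        · rw [ENNReal.ofReal_rpow_of_nonneg h (by norm_num), Real.sqrt_eq_rpow]
        · rw [Real.sqrt_eq_zero_of_nonpos h, ENNReal.ofReal_of_nonpos h, ENNReal.ofReal_zero,
            ENNReal.zero_rpow_of_pos (by norm_num)]

theorem eLpNorm_restrict_unitBall_eq {φ : Eucl N → ℝ} (hφ : ∀ x, x ∉ unitBall N → φ x = 0)
    (p : ℝ≥0∞) : eLpNorm φ p (volume.restrict (unitBall N)) = eLpNorm φ p volume := by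
  rw [← eLpNorm_indicator_eq_eLpNorm_restrict
    (show MeasurableSet (unitBall N) from measurableSet_ball)]
  congr 1
  refine indicator_eq_self.2 fun x hx => ?_
  by_contra h
  exact hx (hφ x h)

/-- The energy on `ℝ^N` of a localized function is controlled by the energy on the ball. -/
theorem eLpNorm_gagliardoQuot_mul_le {φ η : Eucl N → ℝ} (hφ : Continuous φ)
    (hη : Continuous η) (h0 : ∀ x, 0 ≤ η x) (h1 : ∀ x, η x ≤ 1)
    (hφ0 : ∀ x, x ∉ unitBall N → φ x = 0) (hη0 : ∀ x, x ∉ unitBall N → η x = 0) {M : ℝ}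
    (hM : ∀ x, ∫⁻ y, ENNReal.ofReal (gagliardoIntegrand N s η (x, y)) ≤ ENNReal.ofReal M) :
    eLpNorm (gagliardoQuot N s (fun x => η x * φ x)) 2 (volume.prod volume) ≤
      eLpNorm (gagliardoQuot N s φ) 2
        ((volume.restrict (unitBall N)).prod (volume.restrict (unitBall N))) +
      2 * (ENNReal.ofReal (Real.sqrt M) * eLpNorm φ 2 (volume.restrict (unitBall N))) := by
  set ν := (volume : Measure (Eucl N)).prod (volume : Measure (Eucl N)) with hν
  have hBB : MeasurableSet (unitBall N ×ˢ unitBall N) :=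
    measurableSet_ball.prod measurableSet_ball
  set g₀ := (unitBall N ×ˢ unitBall N).indicator (gagliardoQuot N s φ) with hg₀
  set a : Eucl N × Eucl N → ℝ := fun p => φ p.1 * gagliardoQuot N s η p with ha
  set b : Eucl N × Eucl N → ℝ := fun p => φ p.2 * gagliardoQuot N s η p.swap with hb
  have hqm : Measurable (gagliardoQuot N s φ) := by
    unfold gagliardoQuot
    have := hφ.measurable
    fun_prop
  have hg₀m : AEStronglyMeasurable g₀ ν := (hqm.indicator hBB).aestronglyMeasurable
  have ham : AEStronglyMeasurable a ν := aestronglyMeasurable_cutoff_product hφ hη ν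
  have hswap : MeasurePreserving Prod.swap ν ν := Measure.measurePreserving_swap
  have hba : b = a ∘ Prod.swap := rfl
  have hbm : AEStronglyMeasurable b ν := by
    rw [hba]; exact ham.comp_measurePreserving hswap
  have e0 : eLpNorm g₀ 2 ν = eLpNorm (gagliardoQuot N s φ) 2
        ((volume.restrict (unitBall N)).prod (volume.restrict (unitBall N))) := by
    rw [Measure.prod_restrict, hg₀, eLpNorm_indicator_eq_eLpNorm_restrict hBB]
  have ea := eLpNorm_cutoff_product_le hφ hη hM
  have eb : eLpNorm b 2 ν = eLpNorm a 2 ν := by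
    rw [hba]; exact eLpNorm_comp_measurePreserving ham hswap
  have hpt : ∀ p, ‖gagliardoQuot N s (fun x => η x * φ x) p‖ ≤
      ‖(fun q => |g₀ q| + |a q| + |b q|) p‖ := by
    rintro ⟨x, y⟩
    rw [Real.norm_of_nonneg (by positivity : 0 ≤ |g₀ (x, y)| + |a (x, y)| + |b (x, y)|),
      Real.norm_eq_abs]
    have hk : ‖y - x‖ = ‖x - y‖ := norm_sub_rev _ _
    set κ := ‖x - y‖ ^ (((N : ℝ) + 2 * s) / 2) with hκ
    have hκ0 : 0 ≤ κ := by positivity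
    have eW : gagliardoQuot N s (fun x => η x * φ x) (x, y) = (η x * φ x - η y * φ y) / κ := rfl
    have eA : |a (x, y)| = |φ x * (η x - η y)| / κ := by
      simp only [ha, gagliardoQuot]
      rw [← mul_div_assoc, abs_div, abs_of_nonneg hκ0]
    have eB : |b (x, y)| = |φ y * (η x - η y)| / κ := by
      simp only [hb, gagliardoQuot, Prod.swap, hk]
      rw [← mul_div_assoc, abs_div, abs_of_nonneg hκ0, abs_mul, abs_mul, abs_sub_comm]
    rw [eW, eA, eB, abs_div, abs_of_nonneg hκ0]
    -- Inside the ball use the product rule η(x)(φ(x) - φ(y)) + φ(y)(η(x) - η(y)) with η ≤ 1. If one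
    -- point lies outside, φ and η both vanish there and the numerator is a pure commutator term; so
    -- no difference of φ is needed off the square of the ball, and its energy enters with
    -- coefficient 1.
    have key : |η x * φ x - η y * φ y| / κ ≤ |g₀ (x, y)| + |φ y * (η x - η y)| / κ ∨
        |η x * φ x - η y * φ y| / κ ≤ |φ x * (η x - η y)| / κ + |φ y * (η x - η y)| / κ := by
      by_cases hx : x ∈ unitBall N
      · by_cases hy : y ∈ unitBall N
        · left
          have e3 : g₀ (x, y) = (φ x - φ y) / κ := by
            rw [hg₀, indicator_of_mem (show (x, y) ∈ unitBall N ×ˢ unitBall N from ⟨hx, hy⟩)]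
            rfl
          rw [e3, abs_div, abs_of_nonneg hκ0, ← add_div]
          gcongr
          calc |η x * φ x - η y * φ y| = |η x * (φ x - φ y) + φ y * (η x - η y)| := by ring_nf
            _ ≤ |η x * (φ x - φ y)| + |φ y * (η x - η y)| := abs_add_le _ _
            _ ≤ |φ x - φ y| + |φ y * (η x - η y)| := by
                refine add_le_add_left ?_ _
                rw [abs_mul, abs_of_nonneg (h0 x)]
                exact mul_le_of_le_one_left (abs_nonneg _) (h1 x)
        · right
          rw [hφ0 y hy, hη0 y hy]
          simp only [mul_zero, sub_zero, zero_mul, abs_zero, zero_div, add_zero]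
          rw [mul_comm]
      · right
        rw [hφ0 x hx, hη0 x hx, ← add_div]
        gcongr
        simp [mul_comm]
    have p1 : 0 ≤ |φ x * (η x - η y)| / κ := by positivity
    have p2 := abs_nonneg (g₀ (x, y))
    rcases key with h | h <;> linarith
  have hm0 : AEStronglyMeasurable (fun q => |g₀ q|) ν := hg₀m.norm
  have hma : AEStronglyMeasurable (fun q => |a q|) ν := ham.norm
  have hmb : AEStronglyMeasurable (fun q => |b q|) ν := hbm.norm
  have n0 : eLpNorm (fun q => |g₀ q|) 2 ν = eLpNorm g₀ 2 ν := eLpNorm_norm g₀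
  have na : eLpNorm (fun q => |a q|) 2 ν = eLpNorm a 2 ν := eLpNorm_norm a
  have nb : eLpNorm (fun q => |b q|) 2 ν = eLpNorm b 2 ν := eLpNorm_norm b
  rw [eLpNorm_restrict_unitBall_eq hφ0]
  calc eLpNorm (gagliardoQuot N s (fun x => η x * φ x)) 2 ν
      ≤ eLpNorm (fun q => |g₀ q| + |a q| + |b q|) 2 ν := eLpNorm_mono hpt
    _ ≤ eLpNorm (fun q => |g₀ q|) 2 ν + eLpNorm (fun q => |a q|) 2 ν +
          eLpNorm (fun q => |b q|) 2 ν := by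
        refine (eLpNorm_add_le (hm0.add hma) hmb (by norm_num)).trans ?_
        gcongr
        exact eLpNorm_add_le hm0 hma (by norm_num)
    _ ≤ _ := by
        rw [n0, na, nb, eb, e0, two_mul, add_assoc]
        gcongr

theorem Hs.sqrt_energy_eq (hs0 : 0 < s) (hs1 : s < 1) {Ω : Set (Eucl N)} {u : Hs N s Ω}
    {φ : Eucl N → ℝ} (h : u =ᵐ[volume.restrict Ω] φ) :
    Real.sqrt u.energy = Real.sqrt (fracConst N s / 2) * (eLpNorm (gagliardoQuot N s φ) 2
      ((volume.restrict Ω).prod (volume.restrict Ω))).toReal := by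
  rw [Hs.energy_eq_norm_sq hs0 hs1, Real.sqrt_sq (norm_nonneg _), Hs.graphIsometry_snd, norm_smul,
    Real.norm_of_nonneg (Real.sqrt_nonneg _), Lp.norm_toLp]
  congr 2
  refine eLpNorm_congr_ae ?_
  filter_upwards [ae_eq_fst h, ae_eq_snd h] with p h1 h2
  simp only [gagliardoQuot, h1, h2]

theorem Hs.norm_toL2_eq {Ω : Set (Eucl N)} {u : Hs N s Ω}
    {φ : Eucl N → ℝ} (h : u =ᵐ[volume.restrict Ω] φ) :
    ‖Hs.toL2 u‖ = (eLpNorm φ 2 (volume.restrict Ω)).toReal := by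
  rw [Lp.norm_def, eLpNorm_congr_ae h]

/-- Test functions of the unit ball, localized by `η`, as elements of `H^s_0(ℝ^N)`. -/
theorem exists_localization {φ η : Eucl N → ℝ} (hs0 : 0 < s) (hs1 : s < 1)
    (hφ : IsTestFunction (unitBall N) φ)
    (hη : ContDiff ℝ ∞ η) (h0 : ∀ x, 0 ≤ η x) (h1 : ∀ x, η x ≤ 1)
    (hη0 : ∀ x, x ∉ unitBall N → η x = 0) {M : ℝ}
    (hM : ∀ x, ∫⁻ y, ENNReal.ofReal (gagliardoIntegrand N s η (x, y)) ≤ ENNReal.ofReal M)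
    {u : Hs N s (unitBall N)} (hu : u =ᵐ[volume.restrict (unitBall N)] φ) :
    ∃ W ∈ Hs0 N s (univ : Set (Eucl N)), W =ᵐ[volume.restrict univ] (fun x => η x * φ x) ∧
      Real.sqrt W.energy ≤ Real.sqrt u.energy +
        Real.sqrt (fracConst N s / 2) * (2 * Real.sqrt M) * ‖Hs.toL2 u‖ := by
  have hφ0 : ∀ x, x ∉ unitBall N → φ x = 0 := fun x hx => by
    refine hφ.eq_zero_of_one_le ?_
    rw [unitBall, mem_ball_zero_iff] at hx
    exact not_lt.1 hx
  have hle := eLpNorm_gagliardoQuot_mul_le (s := s) hφ.1.continuous hη.continuous h0 h1 hφ0 hη0 hM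
  have hq : eLpNorm (gagliardoQuot N s φ) 2
      ((volume.restrict (unitBall N)).prod (volume.restrict (unitBall N))) ≠ ⊤ :=
    ((gagliardoQuot_memLp_iff hφ.1.continuous.aestronglyMeasurable).2
      (Hs.integrable_gagliardoIntegrand_of_ae hu)).2.ne
  have h2 : eLpNorm φ 2 (volume.restrict (unitBall N)) ≠ ⊤ := (hφ.memLp 2 _).2.ne
  have hr : ENNReal.ofReal (Real.sqrt M) * eLpNorm φ 2 (volume.restrict (unitBall N)) ≠ ⊤ :=
    ENNReal.mul_ne_top ENNReal.ofReal_ne_top h2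
  have hr2 : 2 * (ENNReal.ofReal (Real.sqrt M) * eLpNorm φ 2 (volume.restrict (unitBall N))) ≠ ⊤ :=
    ENNReal.mul_ne_top (by norm_num) hr
  set w : Eucl N → ℝ := fun x => η x * φ x with hw
  have hwt : IsTestFunction univ w :=
    ⟨hη.mul hφ.1, hφ.2.1.mul_left, subset_univ _⟩
  have hwc : Continuous w := hwt.1.continuous
  have hwL : MemLp w 2 (volume.restrict univ) := hwc.memLp_of_hasCompactSupport hwt.2.1
  have hQ : MemLp (gagliardoQuot N s w) 2 ((volume.restrict univ).prod (volume.restrict univ)) := by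
    refine ⟨gagliardoQuot_aesm hwc.aestronglyMeasurable, ?_⟩
    rw [Measure.restrict_univ]
    exact hle.trans_lt (lt_top_iff_ne_top.2 (ENNReal.add_ne_top.2 ⟨hq, hr2⟩))
  have hae : hwL.toLp w =ᵐ[volume.restrict univ] w := hwL.coeFn_toLp
  let W : Hs N s (univ : Set (Eucl N)) := ⟨hwL.toLp w,
    ((gagliardoQuot_memLp_iff hwc.aestronglyMeasurable).1 hQ).congr
      (gagliardoIntegrand_congr_ae hae).symm⟩
  have hW : W =ᵐ[volume.restrict univ] w := hae
  refine ⟨W, Submodule.le_topologicalClosure _ ⟨w, hwt, hW⟩, hW, ?_⟩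
  rw [Hs.sqrt_energy_eq hs0 hs1 hW, Hs.sqrt_energy_eq hs0 hs1 hu, Hs.norm_toL2_eq hu,
    Measure.restrict_univ]
  have h3 := ENNReal.toReal_mono (ENNReal.add_ne_top.2 ⟨hq, hr2⟩) hle
  rw [ENNReal.toReal_add hq hr2, ENNReal.toReal_mul, ENNReal.toReal_mul,
    ENNReal.toReal_ofReal (Real.sqrt_nonneg _), ENNReal.toReal_ofNat] at h3
  have h4 := mul_le_mul_of_nonneg_left h3 (Real.sqrt_nonneg (fracConst N s / 2))
  refine h4.trans (le_of_eq ?_)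
  ring

/-- The critical norm away from the origin is controlled by interpolation. -/
theorem exists_outer_norm_le (hs : 1 / 2 < s) (hs1 : s < 1) (hN : 2 * s < (N : ℝ)) {δ : ℝ}
    (hδ : 0 < δ) :
    ∃ C, 0 ≤ C ∧ ∀ u ∈ Hs0rad N s (unitBall N),
      (eLpNorm ({x | δ ≤ ‖x‖}.indicator u) (ENNReal.ofReal (critExp N s))
        (volume.restrict (unitBall N))).toReal ≤
      Real.sqrt (C * u.energy) ^ (1 - 2 / critExp N s) * ‖Hs.toL2 u‖ ^ (2 / critExp N s) := by
  have hN0 : 0 < N := by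
    have : (0 : ℝ) < N := by linarith
    exact_mod_cast this
  obtain ⟨C, hC, hCu⟩ := exists_ae_sq_le_energy (N := N) hN0 hs hs1 hδ
  refine ⟨C, hC, fun u hu => ?_⟩
  have hp := two_lt_critExp hs hN
  have h1 : ∀ᵐ x ∂(volume.restrict (unitBall N)),
      |{x | δ ≤ ‖x‖}.indicator u x| ≤ Real.sqrt (C * u.energy) := by
    filter_upwards [hCu u hu] with x hx
    by_cases h : x ∈ {x : Eucl N | δ ≤ ‖x‖}
    · rw [indicator_of_mem h]
      exact Real.abs_le_sqrt (hx h)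
    · rw [indicator_of_notMem h, abs_zero]
      exact Real.sqrt_nonneg _
  have h2 : eLpNorm ({x | δ ≤ ‖x‖}.indicator u) 2 (volume.restrict (unitBall N)) ≤
      eLpNorm u 2 (volume.restrict (unitBall N)) := eLpNorm_indicator_le _
  have h3 : eLpNorm u 2 (volume.restrict (unitBall N)) ≠ ⊤ := Lp.eLpNorm_ne_top _
  refine (toReal_eLpNorm_le_of_bound (Real.sqrt_nonneg _) hp h1
    (ne_top_of_le_ne_top h3 h2)).trans ?_
  gcongr
  rw [Lp.norm_def]
  exact ENNReal.toReal_mono h3 h2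

/-- Up to lower order terms, the Sobolev inequality on `H^s_{0,rad}` of the ball holds with the
optimal constant of the whole space. -/
theorem exists_sqrt_sobolevConst_mul_critNorm_le (hs : 1 / 2 < s) (hs1 : s < 1)
    (hN : 2 * s < (N : ℝ)) {h : Eucl N → ℝ} (hh : MemLp h ⊤ (volume.restrict (unitBall N)))
    (hpos : 0 < sobolevConstRad N s (unitBall N) h)
    (hpos' : 0 < sobolevConst N s (univ : Set (Eucl N))) :
    ∃ C₁ C₂, ∀ u ∈ Hs0rad N s (unitBall N),
      Real.sqrt (sobolevConst N s (univ : Set (Eucl N))) * critNorm u ≤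
        Real.sqrt u.energy + C₁ * ‖Hs.toL2 u‖ +
        Real.sqrt (sobolevConst N s (univ : Set (Eucl N))) *
          (Real.sqrt (C₂ * u.energy) ^ (1 - 2 / critExp N s) *
            ‖Hs.toL2 u‖ ^ (2 / critExp N s)) := by
  have hs0 : 0 < s := by linarith
  have hN0 : 0 < N := by
    have : (0 : ℝ) < N := by linarith
    exact_mod_cast this
  have hp := two_lt_critExp hs hN
  have hp1 : 1 ≤ ENNReal.ofReal (critExp N s) := by
    rw [ENNReal.one_le_ofReal]; linarith
  set S₀ := sobolevConst N s (univ : Set (Eucl N)) with hS₀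
  -- The cutoff is 1 up to radius 1/2, which matches the outer region below, and vanishes before the
  -- unit sphere.
  let η : ContDiffBump (0 : Eucl N) := ⟨1 / 2, 3 / 4, by norm_num, by norm_num⟩
  have hηs : ContDiff ℝ ∞ η := η.contDiff
  have hη0 : ∀ x, x ∉ unitBall N → η x = 0 := fun x hx => by
    refine η.zero_of_le_dist ?_
    rw [unitBall, Metric.mem_ball, not_lt] at hx
    exact le_trans (by norm_num) hx
  obtain ⟨L, hL⟩ := ContDiff.lipschitzWith_of_hasCompactSupport η.hasCompactSupport hηs (by simp)
  have hL' : ∀ x y, |η x - η y| ≤ (L : ℝ) * ‖x - y‖ := fun x y => by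
    have := hL.dist_le_mul x y
    rwa [Real.dist_eq, dist_eq_norm] at this
  obtain ⟨M, hM0, hM⟩ := exists_lintegral_gagliardoIntegrand_le hN0 hs0 hs1 hL'
    (fun x => η.nonneg) (fun x => η.le_one)
  obtain ⟨C₂, hC₂, hout⟩ := exists_outer_norm_le (N := N) hs hs1 hN (δ := 1 / 2) (by norm_num)
  set C₁ := Real.sqrt (fracConst N s / 2) * (2 * Real.sqrt M) with hC₁
  refine ⟨C₁, C₂, fun u hu => ?_⟩
  have htest : ∀ v ∈ radialTestSubspace N s (unitBall N),
      Real.sqrt S₀ * critNorm v ≤ Real.sqrt v.energy + C₁ * ‖Hs.toL2 v‖ +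
        Real.sqrt S₀ * (Real.sqrt (C₂ * v.energy) ^ (1 - 2 / critExp N s) *
            ‖Hs.toL2 v‖ ^ (2 / critExp N s)) := by
    intro v hv
    have hvm : v ∈ Hs0rad N s (unitBall N) := Submodule.le_topologicalClosure _ hv
    obtain ⟨φ, hφ, hr, hvφ⟩ := hv
    obtain ⟨W, hW, hWae, hWe⟩ := exists_localization hs0 hs1 hφ hηs (fun x => η.nonneg)
      (fun x => η.le_one) hη0 hM hvφ
    have h1 := sobolevConst_mul_le hs0 hs1 hpos' hW
    have h2 : Real.sqrt S₀ * critNorm W ≤ Real.sqrt W.energy := by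
      rw [← Real.sqrt_sq (critNorm_nonneg W), ← Real.sqrt_mul hpos'.le]
      exact Real.sqrt_le_sqrt h1
    have hWp : MemLp W (ENNReal.ofReal (critExp N s)) (volume.restrict univ) :=
      memLp_critExp_of_critNorm_ne_zero fun h0 => (sobolevConst_le hpos' hW h0).1
    have hwp : eLpNorm (fun x => η x * φ x) (ENNReal.ofReal (critExp N s)) volume ≠ ⊤ := by
      have := hWp.2.ne
      rwa [eLpNorm_congr_ae hWae, Measure.restrict_univ] at this
    have hWc : critNorm W =
        (eLpNorm (fun x => η x * φ x) (ENNReal.ofReal (critExp N s)) volume).toReal := by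
      rw [critNorm, eLpNorm_congr_ae hWae, Measure.restrict_univ]
    have hvp := memLp_critExp_of_mem_Hs0rad hpos hvm
    set o := eLpNorm ({x | 1 / 2 ≤ ‖x‖}.indicator v) (ENNReal.ofReal (critExp N s))
        (volume.restrict (unitBall N)) with ho
    have hoT : o ≠ ⊤ := ne_top_of_le_ne_top hvp.2.ne (eLpNorm_indicator_le _)
    -- Pointwise |v| ≤ |ηv| + |v| on {‖x‖ ≥ 1/2}: the first part is tested with the whole-space
    -- constant, the second is handled by interpolation.
    have h3 : critNorm v ≤ critNorm W + o.toReal := by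
      rw [hWc, critNorm, ← ENNReal.toReal_add hwp hoT]
      refine ENNReal.toReal_mono (ENNReal.add_ne_top.2 ⟨hwp, hoT⟩) ?_
      have hind : AEStronglyMeasurable ({x : Eucl N | 1 / 2 ≤ ‖x‖}.indicator (v : Eucl N → ℝ))
          (volume.restrict (unitBall N)) := by
        refine (Lp.aestronglyMeasurable _).indicator ?_
        exact measurableSet_le measurable_const continuous_norm.measurable
      have hwm : Continuous (fun x => η x * φ x) := hηs.continuous.mul hφ.1.continuous
      calc eLpNorm v (ENNReal.ofReal (critExp N s)) (volume.restrict (unitBall N))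
          ≤ eLpNorm (fun x => |η x * φ x| + |{x : Eucl N | 1 / 2 ≤ ‖x‖}.indicator
              (v : Eucl N → ℝ) x|) (ENNReal.ofReal (critExp N s))
              (volume.restrict (unitBall N)) := by
            refine eLpNorm_mono_ae ?_
            filter_upwards [hvφ] with x hx
            rw [Real.norm_of_nonneg (by positivity :
              0 ≤ |η x * φ x| + |{x : Eucl N | 1 / 2 ≤ ‖x‖}.indicator (v : Eucl N → ℝ) x|),
              Real.norm_eq_abs]
            by_cases hx2 : x ∈ {x : Eucl N | 1 / 2 ≤ ‖x‖}
            · rw [indicator_of_mem hx2]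
              linarith [abs_nonneg (η x * φ x)]
            · have : η x = 1 := by
                refine η.one_of_mem_closedBall ?_
                rw [mem_closedBall_zero_iff]
                exact (not_le.1 hx2).le
              rw [indicator_of_notMem hx2, this, one_mul, hx, abs_zero, add_zero]
        _ ≤ eLpNorm (fun x => |η x * φ x|) (ENNReal.ofReal (critExp N s))
              (volume.restrict (unitBall N)) +
            eLpNorm (fun x => |{x : Eucl N | 1 / 2 ≤ ‖x‖}.indicator (v : Eucl N → ℝ) x|)
              (ENNReal.ofReal (critExp N s)) (volume.restrict (unitBall N)) :=
            eLpNorm_add_le hwm.abs.aestronglyMeasurable hind.norm hp1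
        _ ≤ _ := by
            gcongr
            · exact (eLpNorm_norm (fun x => η x * φ x)).trans_le
                (eLpNorm_mono_measure _ Measure.restrict_le_self)
            · exact (eLpNorm_norm ({x : Eucl N | 1 / 2 ≤ ‖x‖}.indicator
                (v : Eucl N → ℝ))).le
    have h4 := hout v hvm
    have h5 := mul_le_mul_of_nonneg_left (h3.trans (add_le_add_right h4 _)) (Real.sqrt_nonneg S₀)
    rw [mul_add] at h5
    linarith
  obtain ⟨v, hv, hvu⟩ := mem_closure_iff_seq_limit.1
    (show u ∈ closure (radialTestSubspace N s (unitBall N) : Set (Hs N s (unitBall N))) from hu)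
  obtain ⟨K, hK0, hK⟩ := exists_critNorm_le hs0 hs1 hh hpos
  have hvm : ∀ n, v n ∈ Hs0rad N s (unitBall N) := fun n =>
    Submodule.le_topologicalClosure _ (hv n)
  -- Passing to the closure needs continuity of the critical norm, which the embedding with constant
  -- K supplies.
  have hcrit : Tendsto (fun n => critNorm (v n)) atTop (𝓝 (critNorm u)) := by
    rw [tendsto_iff_dist_tendsto_zero]
    have hz : Tendsto (fun n => K * ‖v n - u‖) atTop (𝓝 (K * 0)) :=
      (tendsto_iff_norm_sub_tendsto_zero.1 hvu).const_mul K
    rw [mul_zero] at hz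
    refine squeeze_zero (fun n => dist_nonneg) (fun n => ?_) hz
    rw [Real.dist_eq]
    exact (abs_critNorm_sub_le hs hN hpos (hvm n) hu).trans (hK _ (Submodule.sub_mem _ (hvm n) hu))
  have hen : Tendsto (fun n => (v n).energy) atTop (𝓝 u.energy) :=
    ((Hs.continuous_energy hs0 hs1).tendsto u).comp hvu
  have hL2 : Tendsto (fun n => ‖Hs.toL2 (v n)‖) atTop (𝓝 ‖Hs.toL2 u‖) :=
    ((Hs.continuous_toL2.norm).tendsto u).comp hvu
  have hq : 0 ≤ 1 - 2 / critExp N s := by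
    rw [sub_nonneg, div_le_one (by linarith)]; exact hp.le
  refine le_of_tendsto_of_tendsto' (hcrit.const_mul _)
    ((hen.sqrt.add (hL2.const_mul _)).add
      ((((hen.const_mul _).sqrt.rpow_const (Or.inr hq)).mul
        (hL2.rpow_const (Or.inr (by positivity)))).const_mul _)) fun n => htest _ (hv n)

end Cutoff


/-! ### Minimizing families along ultrafilters -/

section Compactness

variable {N : ℕ} {s : ℝ}

/-- Lets all bounded quantities have limits at once, in place of successive subsequences. -/
theorem Ultrafilter.exists_tendsto_of_mem_Icc {ι : Type*} (U : Ultrafilter ι) {f : ι → ℝ} {a b : ℝ}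
    (hf : ∀ i, f i ∈ Icc a b) : ∃ l, Tendsto f U (𝓝 l) := by
  obtain ⟨l, -, hl⟩ := (isCompact_Icc (a := a) (b := b)).ultrafilter_le_nhds (U.map f)
    (tendsto_principal.2 (Eventually.of_forall hf))
  exact ⟨l, hl⟩

theorem continuous_integral_mul_sq {α : Type*} [MeasurableSpace α] {ν : Measure α} {h : α → ℝ}
    (hh : MemLp h ⊤ ν) : Continuous fun f : Lp ℝ 2 ν => ∫ x, h x * f x ^ 2 ∂ν := by
  rw [continuous_iff_continuousAt]
  intro g
  rw [ContinuousAt, tendsto_iff_dist_tendsto_zero]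
  have h1 : Tendsto (fun f : Lp ℝ 2 ν => lpNorm h ⊤ ν * (‖f - g‖ * ‖f + g‖)) (𝓝 g)
      (𝓝 (lpNorm h ⊤ ν * (‖g - g‖ * ‖g + g‖))) :=
    Continuous.tendsto (by fun_prop) g
  rw [sub_self, norm_zero, zero_mul, mul_zero] at h1
  exact squeeze_zero (fun _ => dist_nonneg) (fun f => abs_integral_mul_sq_sub_le hh f g) h1

theorem continuous_energyWith (hs0 : 0 < s) (hs1 : s < 1) {Ω : Set (Eucl N)} {h : Eucl N → ℝ}
    (hh : MemLp h ⊤ (volume.restrict Ω)) : Continuous (energyWith (s := s) (Ω := Ω) h) :=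
  (Hs.continuous_energy hs0 hs1).add ((continuous_integral_mul_sq hh).comp Hs.continuous_toL2)

theorem energyWith_smul (hs0 : 0 < s) (hs1 : s < 1) {Ω : Set (Eucl N)} (h : Eucl N → ℝ) (c : ℝ)
    (u : Hs N s Ω) : energyWith h (c • u) = c ^ 2 * energyWith h u := by
  rw [energyWith, energyWith, Hs.energy_smul c hs0 hs1, mul_add, ← integral_const_mul]
  congr 1
  refine integral_congr_ae ?_
  rw [map_smul]
  filter_upwards [Lp.coeFn_smul c (Hs.toL2 u)] with x hx
  rw [hx, Pi.smul_apply, smul_eq_mul]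
  ring

theorem sobolevQuotient_smul (hs0 : 0 < s) (hs1 : s < 1) {Ω : Set (Eucl N)} (h : Eucl N → ℝ)
    {c : ℝ} (hc : c ≠ 0) (u : Hs N s Ω) :
    sobolevQuotient h (c • u) = sobolevQuotient h u := by
  rw [sobolevQuotient, energyWith_smul hs0 hs1, critNorm_smul, mul_pow, sq_abs, sobolevQuotient,
    mul_div_mul_left _ _ (pow_ne_zero 2 hc)]

theorem sobolevQuotient_mul_critNorm_sq (hs0 : 0 < s) (hs1 : s < 1) {Ω : Set (Eucl N)}
    {h : Eucl N → ℝ} (hpos : 0 < sobolevConstRad N s Ω h) {u : Hs N s Ω}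
    (hu : u ∈ Hs0rad N s Ω) : sobolevQuotient h u * critNorm u ^ 2 = energyWith h u := by
  by_cases hu0 : u = 0
  · rw [hu0, critNorm_zero, energyWith_zero hs0 hs1]
    simp
  · rw [sobolevQuotient, div_mul_cancel₀ _ (pow_ne_zero 2 (sobolevConstRad_le hpos hu hu0).1)]

/-- Weak convergence in `H^s_{0,rad}` implies convergence in `L²`. -/
theorem tendsto_toL2_of_weak (hN : 0 < N) (hs : 1 / 2 < s) (hs1 : s < 1) {ι : Type*}
    {l : Filter ι} {v : ι → Hs N s (unitBall N)} (hv : ∀ i, v i ∈ Hs0rad N s (unitBall N)) {R : ℝ}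
    (hR : ∀ i, ‖v i‖ ≤ R)
    (hw : ∀ y, Tendsto (fun i => inner ℝ (Hs.graphIsometry (v i)) y) l (𝓝 0)) :
    Tendsto (fun i => Hs.toL2 (v i)) l (𝓝 0) := by
  have hs0 : 0 < s := by linarith
  rw [tendsto_zero_iff_norm_tendsto_zero, Metric.tendsto_nhds]
  intro ε hε
  -- With this weight the energy term stays below ε²/2, as the energy is at most R². The rest is a
  -- finite sum of squares of weakly continuous functionals.
  obtain ⟨n, w, y, hy⟩ := exists_norm_toL2_sq_le_sum (N := N) hN hs hs1
    (ε := ε ^ 2 / 2 / (R ^ 2 + 1)) (by positivity)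
  have h1 : Tendsto (fun i => ∑ j ∈ Finset.range n, w j * (inner ℝ (y j) (Hs.toL2 (v i))) ^ 2) l
      (𝓝 (∑ j ∈ Finset.range n, w j * 0 ^ 2)) := by
    refine tendsto_finsetSum _ fun j _ => Tendsto.const_mul _ (Tendsto.pow ?_ 2)
    refine (hw (WithLp.toLp 2 (y j, 0))).congr fun i => ?_
    rw [WithLp.prod_inner_apply]
    change inner ℝ (Hs.toL2 (v i)) (y j) + inner ℝ _ (0 : Lp ℝ 2 _) = _
    rw [inner_zero_right, add_zero, real_inner_comm]
  simp only [zero_pow two_ne_zero, mul_zero, Finset.sum_const_zero] at h1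
  filter_upwards [h1.eventually (gt_mem_nhds (show (0 : ℝ) < ε ^ 2 / 2 by positivity))] with i hi
  rw [dist_zero_right, norm_norm]
  have h2 := hy (v i) (hv i)
  have h3 : ε ^ 2 / 2 / (R ^ 2 + 1) * (v i).energy ≤ ε ^ 2 / 2 := by
    rw [div_mul_eq_mul_div, div_le_iff₀ (by positivity)]
    have h4 : (v i).energy ≤ R ^ 2 + 1 := by
      have h5 := Hs.energy_le_norm_sq hs0 hs1 (v i)
      have h6 : ‖v i‖ ^ 2 ≤ R ^ 2 := pow_le_pow_left₀ (norm_nonneg _) (hR i) 2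
      linarith
    gcongr
  exact lt_of_pow_lt_pow_left₀ 2 hε.le (by linarith)

/-- For `p ≥ 2` the square of the `L^p` norm is at most the sum of the squares of the norms over
complementary sets. -/
theorem MeasureTheory.toReal_eLpNorm_sq_le_add {α : Type*} [MeasurableSpace α] {ν : Measure α}
    {f : α → ℝ} {p : ℝ} (hp : 2 ≤ p) (hf : MemLp f (ENNReal.ofReal p) ν) {A : Set α}
    (hA : MeasurableSet A) :
    (eLpNorm f (ENNReal.ofReal p) ν).toReal ^ 2 ≤
      (eLpNorm (A.indicator f) (ENNReal.ofReal p) ν).toReal ^ 2 +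
      (eLpNorm (Aᶜ.indicator f) (ENNReal.ofReal p) ν).toReal ^ 2 := by
  have hp0 : 0 < p := by linarith
  have hp' : ENNReal.ofReal p ≠ 0 := by simpa using hp0
  set x := eLpNorm (A.indicator f) (ENNReal.ofReal p) ν with hx
  set y := eLpNorm (Aᶜ.indicator f) (ENNReal.ofReal p) ν with hy
  have hxT : x ≠ ⊤ := (hf.indicator hA).2.ne
  have hyT : y ≠ ⊤ := (hf.indicator hA.compl).2.ne
  have hpow : ∀ g : α → ℝ, eLpNorm g (ENNReal.ofReal p) ν ^ p = ∫⁻ x, ‖g x‖ₑ ^ p ∂ν := fun g => by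
    rw [eLpNorm_eq_lintegral_rpow_enorm_toReal hp' ENNReal.ofReal_ne_top,
      ENNReal.toReal_ofReal hp0.le, ← ENNReal.rpow_mul, one_div, inv_mul_cancel₀ hp0.ne',
      ENNReal.rpow_one]
  have hind : ∀ B : Set α, MeasurableSet B →
      ∫⁻ x, ‖B.indicator f x‖ₑ ^ p ∂ν = ∫⁻ x in B, ‖f x‖ₑ ^ p ∂ν := fun B hB => by
    rw [← lintegral_indicator hB]
    refine lintegral_congr fun z => ?_
    by_cases hz : z ∈ B
    · rw [indicator_of_mem hz, indicator_of_mem hz]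
    · rw [indicator_of_notMem hz, indicator_of_notMem hz, enorm_zero, ENNReal.zero_rpow_of_pos hp0]
  have h1 : eLpNorm f (ENNReal.ofReal p) ν = (x ^ p + y ^ p) ^ (1 / p) := by
    rw [hx, hy, hpow, hpow, hind A hA, hind Aᶜ hA.compl, lintegral_add_compl _ hA, ← hpow,
      ← ENNReal.rpow_mul, mul_one_div_cancel hp0.ne', ENNReal.rpow_one]
  -- The p-th powers add over complementary sets, and the ℓ^p norm is at most the ℓ² norm for p ≥ 2.
  have h2 : eLpNorm f (ENNReal.ofReal p) ν ≤ (x ^ (2 : ℝ) + y ^ (2 : ℝ)) ^ (1 / (2 : ℝ)) := by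
    rw [h1]
    exact ENNReal.rpow_add_rpow_le x y (by norm_num) hp
  have h3 : eLpNorm f (ENNReal.ofReal p) ν ^ 2 ≤ x ^ 2 + y ^ 2 := by
    calc eLpNorm f (ENNReal.ofReal p) ν ^ 2
        ≤ ((x ^ (2 : ℝ) + y ^ (2 : ℝ)) ^ (1 / (2 : ℝ))) ^ 2 := by gcongr
      _ = x ^ 2 + y ^ 2 := by
        rw [← ENNReal.rpow_natCast, ← ENNReal.rpow_mul]
        simp
  have h4 := ENNReal.toReal_mono (ENNReal.add_ne_top.2
    ⟨ENNReal.pow_ne_top hxT, ENNReal.pow_ne_top hyT⟩) h3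
  rwa [ENNReal.toReal_add (ENNReal.pow_ne_top hxT) (ENNReal.pow_ne_top hyT), ENNReal.toReal_pow,
    ENNReal.toReal_pow, ENNReal.toReal_pow] at h4

/-- The critical norm of `u = z + v` splits up to the mass of `z` near the origin and of `v` away
from it. -/
theorem critNorm_add_sq_le (hs : 1 / 2 < s) (hN : 2 * s < (N : ℝ)) {Ω : Set (Eucl N)}
    {z v : Hs N s Ω} (hz : MemLp z (ENNReal.ofReal (critExp N s)) (volume.restrict Ω))
    (hv : MemLp v (ENNReal.ofReal (critExp N s)) (volume.restrict Ω)) (δ : ℝ) :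
    critNorm (z + v) ^ 2 ≤
      (critNorm v + (eLpNorm ((Metric.ball 0 δ).indicator z) (ENNReal.ofReal (critExp N s))
        (volume.restrict Ω)).toReal) ^ 2 +
      (critNorm z + (eLpNorm ({x | δ ≤ ‖x‖}.indicator v) (ENNReal.ofReal (critExp N s))
        (volume.restrict Ω)).toReal) ^ 2 := by
  have hp := two_lt_critExp hs hN
  set p := ENNReal.ofReal (critExp N s) with hpdef
  have hp1 : 1 ≤ p := by rw [hpdef, ENNReal.one_le_ofReal]; linarith
  have hA : MeasurableSet (Metric.ball (0 : Eucl N) δ) := measurableSet_ball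
  have hAc : (Metric.ball (0 : Eucl N) δ)ᶜ = {x | δ ≤ ‖x‖} := by
    ext x; simp
  have hadd : ((z + v : Hs N s Ω) : Eucl N → ℝ) =ᵐ[volume.restrict Ω]
      (z : Eucl N → ℝ) + (v : Eucl N → ℝ) := by
    rw [map_add]; exact Lp.coeFn_add _ _
  have h1 := toReal_eLpNorm_sq_le_add hp.le (hz.add hv) hA
  rw [critNorm, eLpNorm_congr_ae hadd]
  refine h1.trans (add_le_add ?_ ?_)
  · refine pow_le_pow_left₀ ENNReal.toReal_nonneg ?_ 2
    rw [indicator_add', critNorm, ← ENNReal.toReal_add hv.2.ne (hz.indicator hA).2.ne]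
    refine ENNReal.toReal_mono (ENNReal.add_ne_top.2 ⟨hv.2.ne, (hz.indicator hA).2.ne⟩) ?_
    refine (eLpNorm_add_le (hz.indicator hA).1 (hv.indicator hA).1 hp1).trans ?_
    rw [add_comm]
    gcongr
    exact eLpNorm_indicator_le _
  · refine pow_le_pow_left₀ ENNReal.toReal_nonneg ?_ 2
    have hvA := hv.indicator hA.compl
    rw [hAc] at hvA ⊢
    have hzA := hz.indicator hA.compl
    rw [hAc] at hzA
    rw [indicator_add', critNorm, ← ENNReal.toReal_add hz.2.ne hvA.2.ne]
    refine ENNReal.toReal_mono (ENNReal.add_ne_top.2 ⟨hz.2.ne, hvA.2.ne⟩) ?_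
    refine (eLpNorm_add_le hzA.1 hvA.1 hp1).trans ?_
    gcongr
    exact eLpNorm_indicator_le _

/-- Absolute continuity of the integral: the balls have volume of order δ^N, so a fixed function has
no concentrated mass at the origin. -/
theorem exists_eLpNorm_ball_indicator_le (hN : 0 < N) {Ω : Set (Eucl N)} {f : Eucl N → ℝ} {p : ℝ≥0∞}
    (hp1 : 1 ≤ p) (hp : p ≠ ⊤) (hf : MemLp f p (volume.restrict Ω)) {ε : ℝ} (hε : 0 < ε) :
    ∃ δ > 0, (eLpNorm ((Metric.ball 0 δ).indicator f) p (volume.restrict Ω)).toReal ≤ ε := by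
  obtain ⟨τ, hτ, h⟩ := hf.eLpNorm_indicator_le hp1 hp hε
  have h1 : Tendsto (fun δ : ℝ => δ ^ N * (volume : Measure (Eucl N)).real (unitBall N)) (𝓝[>] 0)
      (𝓝 (0 ^ N * (volume : Measure (Eucl N)).real (unitBall N))) :=
    (Continuous.tendsto (by fun_prop) 0).mono_left nhdsWithin_le_nhds
  rw [zero_pow hN.ne', zero_mul] at h1
  obtain ⟨δ, h2, h3⟩ := ((h1.eventually (gt_mem_nhds hτ)).and self_mem_nhdsWithin).exists
  refine ⟨δ, h3, ENNReal.toReal_le_of_le_ofReal hε.le (h _ measurableSet_ball ?_)⟩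
  refine (Measure.restrict_apply_le _ _).trans ?_
  rw [← ENNReal.ofReal_toReal (measure_ball_lt_top (μ := volume) (x := (0 : Eucl N)) (r := δ)).ne]
  refine ENNReal.ofReal_le_ofReal ?_
  have := volume_real_ball (N := N) hN (le_of_lt h3)
  rw [Measure.real] at this
  rw [this]
  exact h2.le

/-- Bounded minimizing families converge strongly along ultrafilters if the infimum lies below
the Sobolev constant of the whole space. -/
theorem exists_tendsto_of_minimizing (hs : 1 / 2 < s) (hs1 : s < 1)
    (hN : 2 * s < (N : ℝ)) {h : Eucl N → ℝ} (hh : MemLp h ⊤ (volume.restrict (unitBall N)))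
    (hpos : 0 < sobolevConstRad N s (unitBall N) h)
    (hlt : sobolevConstRad N s (unitBall N) h < sobolevConst N s (univ : Set (Eucl N)))
    {ι : Type*} (U : Ultrafilter ι) {u : ι → Hs N s (unitBall N)}
    (hu : ∀ i, u i ∈ Hs0rad N s (unitBall N)) {R : ℝ} (hR : ∀ i, ‖u i‖ ≤ R)
    (hmin : Tendsto (fun i => sobolevQuotient h (u i)) U
      (𝓝 (sobolevConstRad N s (unitBall N) h))) :
    ∃ z ∈ Hs0rad N s (unitBall N), Tendsto u U (𝓝 z) := by
  have hs0 : 0 < s := by linarith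
  have hN0 : 0 < N := by
    have : (0 : ℝ) < N := by linarith
    exact_mod_cast this
  have hp := two_lt_critExp hs hN
  have hp1 : 1 ≤ ENNReal.ofReal (critExp N s) := by
    rw [ENNReal.one_le_ofReal]; linarith
  have hq : 0 ≤ 1 - 2 / critExp N s := by
    rw [sub_nonneg, div_le_one (by linarith)]; exact hp.le
  have hq2 : 0 < 2 / critExp N s := by positivity
  set S := sobolevConstRad N s (unitBall N) h with hS
  set S₀ := sobolevConst N s (univ : Set (Eucl N)) with hS₀
  have hpos' : 0 < S₀ := hpos.trans hlt
  obtain ⟨z, hz, hweak⟩ := Hs.exists_weak_limit hs0 hs1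
    (Submodule.isClosed_topologicalClosure (radialTestSubspace N s (unitBall N))) U u hu R hR
  change z ∈ Hs0rad N s (unitBall N) at hz
  set v : ι → Hs N s (unitBall N) := fun i => u i - z with hv
  have hvm : ∀ i, v i ∈ Hs0rad N s (unitBall N) := fun i => Submodule.sub_mem _ (hu i) hz
  have huv : ∀ i, u i = z + v i := fun i => by rw [hv]; simp
  have hvR : ∀ i, ‖v i‖ ≤ R + ‖z‖ := fun i =>
    (norm_sub_le _ _).trans (by linarith [hR i])
  have hL2 := tendsto_toL2_of_weak hN0 hs hs1 hvm hvR hweak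
  have hL2n : Tendsto (fun i => ‖Hs.toL2 (v i)‖) U (𝓝 0) :=
    tendsto_zero_iff_norm_tendsto_zero.1 hL2
  obtain ⟨K, hK0, hK⟩ := exists_critNorm_le hs0 hs1 hh hpos
  obtain ⟨a, ha⟩ := U.exists_tendsto_of_mem_Icc (f := fun i => critNorm (v i)) (a := 0)
    (b := K * (R + ‖z‖)) fun i => ⟨critNorm_nonneg _, (hK _ (hvm i)).trans (by gcongr; exact hvR i)⟩
  obtain ⟨L, hL⟩ := U.exists_tendsto_of_mem_Icc (f := fun i => critNorm (u i)) (a := 0)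
    (b := K * R) fun i => ⟨critNorm_nonneg _, (hK _ (hu i)).trans (by gcongr; exact hR i)⟩
  obtain ⟨q, hqe⟩ := U.exists_tendsto_of_mem_Icc (f := fun i => (v i).energy) (a := 0)
    (b := (R + ‖z‖) ^ 2) fun i => ⟨Hs.energy_nonneg hs0 hs1 _,
      (Hs.energy_le_norm_sq hs0 hs1 _).trans (pow_le_pow_left₀ (norm_nonneg _) (hvR i) 2)⟩
  have ha0 : 0 ≤ a := ge_of_tendsto' ha fun i => critNorm_nonneg _
  have hq0 : 0 ≤ q := ge_of_tendsto' hqe fun i => Hs.energy_nonneg hs0 hs1 _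
  have henergy : Tendsto (fun i => (u i).energy) U (𝓝 (z.energy + q)) := by
    -- The cross term of the energy is weak convergence tested against (0, second component of z).
    have h1 : Tendsto (fun i => inner ℝ (Hs.graphIsometry z).snd (Hs.graphIsometry (v i)).snd) U
        (𝓝 0) := by
      refine (hweak (WithLp.toLp 2 (0, (Hs.graphIsometry z).snd))).congr fun i => ?_
      rw [WithLp.prod_inner_apply]
      change inner ℝ _ (0 : Lp ℝ 2 _) + inner ℝ (Hs.graphIsometry (v i)).snd _ = _
      rw [inner_zero_right, zero_add, real_inner_comm]
    have h2 := ((h1.const_mul 2).const_add z.energy).add hqe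
    rw [mul_zero, add_zero] at h2
    refine h2.congr fun i => ?_
    rw [huv, Hs.energy_add hs0 hs1]
  have hpot : Tendsto (fun i => ∫ x in unitBall N, h x * u i x ^ 2) U
      (𝓝 (∫ x in unitBall N, h x * z x ^ 2)) := by
    have h1 : Tendsto (fun i => Hs.toL2 (u i)) U (𝓝 (Hs.toL2 z)) := by
      have := hL2.const_add (Hs.toL2 z)
      rw [add_zero] at this
      refine this.congr fun i => ?_
      rw [← map_add, ← huv]
    exact ((continuous_integral_mul_sq hh).tendsto _).comp h1
  have e1 : S * L ^ 2 = z.energy + q + ∫ x in unitBall N, h x * z x ^ 2 := by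
    refine tendsto_nhds_unique (hmin.mul (hL.pow 2)) ((henergy.add hpot).congr fun i => ?_)
    exact (sobolevQuotient_mul_critNorm_sq hs0 hs1 hpos (hu i)).symm
  -- All correction terms of the comparison inequality carry a positive power of ‖v‖ in L² and
  -- vanish in the limit.
  have e2 : S₀ * a ^ 2 ≤ q := by
    obtain ⟨C₁, C₂, hC⟩ := exists_sqrt_sobolevConst_mul_critNorm_le hs hs1 hN hh hpos hpos'
    have h1 : Real.sqrt S₀ * a ≤ Real.sqrt q + C₁ * 0 + Real.sqrt S₀ *
        (Real.sqrt (C₂ * q) ^ (1 - 2 / critExp N s) * 0 ^ (2 / critExp N s)) :=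
      le_of_tendsto_of_tendsto' (ha.const_mul _) ((hqe.sqrt.add (hL2n.const_mul _)).add
        ((((hqe.const_mul _).sqrt.rpow_const (Or.inr hq)).mul
          (hL2n.rpow_const (Or.inr hq2.le))).const_mul _)) fun i => hC _ (hvm i)
    rw [Real.zero_rpow hq2.ne', mul_zero, mul_zero, mul_zero, add_zero, add_zero] at h1
    have h2 := pow_le_pow_left₀ (by positivity) h1 2
    rwa [mul_pow, Real.sq_sqrt hpos'.le, Real.sq_sqrt hq0] at h2
  have e3 : S * critNorm z ^ 2 ≤ z.energy + ∫ x in unitBall N, h x * z x ^ 2 :=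
    sobolevConstRad_mul_le hs0 hs1 hpos hz
  -- The radius δ is chosen first, so that z has critical norm at most ε in the ball; then v tends
  -- to 0 in the critical norm outside it, and ε is sent to 0 last.
  have e4 : L ^ 2 ≤ a ^ 2 + critNorm z ^ 2 := by
    have hzp := memLp_critExp_of_mem_Hs0rad hpos hz
    have h1 : ∀ ε > 0, L ^ 2 ≤ (a + ε) ^ 2 + critNorm z ^ 2 := by
      intro ε hε
      obtain ⟨δ, hδ, hδε⟩ := exists_eLpNorm_ball_indicator_le hN0 hp1 ENNReal.ofReal_ne_top hzp hε
      obtain ⟨C, hC, hout⟩ := exists_outer_norm_le (N := N) hs hs1 hN hδ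
      have ho : Tendsto (fun i => Real.sqrt (C * (v i).energy) ^ (1 - 2 / critExp N s) *
          ‖Hs.toL2 (v i)‖ ^ (2 / critExp N s)) U
          (𝓝 (Real.sqrt (C * q) ^ (1 - 2 / critExp N s) * 0 ^ (2 / critExp N s))) :=
        ((hqe.const_mul _).sqrt.rpow_const (Or.inr hq)).mul (hL2n.rpow_const (Or.inr hq2.le))
      rw [Real.zero_rpow hq2.ne', mul_zero] at ho
      have h2 := le_of_tendsto_of_tendsto' (hL.pow 2)
        (((ha.add_const ε).pow 2).add ((ho.const_add (critNorm z)).pow 2)) fun i => by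
          rw [huv i]
          refine (critNorm_add_sq_le hs hN hzp (memLp_critExp_of_mem_Hs0rad hpos (hvm i))
            δ).trans ?_
          have := critNorm_nonneg z
          have := critNorm_nonneg (v i)
          have := hout _ (hvm i)
          gcongr
      rwa [add_zero] at h2
    have h3 : Tendsto (fun ε : ℝ => (a + ε) ^ 2 + critNorm z ^ 2) (𝓝[>] 0)
        (𝓝 ((a + 0) ^ 2 + critNorm z ^ 2)) :=
      (Continuous.tendsto (by fun_prop) 0).mono_left nhdsWithin_le_nhds
    rw [add_zero] at h3
    refine ge_of_tendsto h3 ?_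
    filter_upwards [self_mem_nhdsWithin] with ε hε using h1 ε hε
  -- Combining the relations, S‖z‖² + S₀ a² ≤ S L² ≤ S a² + S‖z‖²; the strict gap S < S₀ rules out
  -- concentration.
  have ha2 : a ^ 2 = 0 := by
    have h1 := mul_le_mul_of_nonneg_left e4 hpos.le
    have h2 : (S₀ - S) * a ^ 2 ≤ 0 := by linarith
    have h3 : 0 < S₀ - S := sub_pos.2 hlt
    exact le_antisymm (by nlinarith) (sq_nonneg a)
  have hqz : q = 0 := by
    rw [ha2, zero_add] at e4
    have h1 := mul_le_mul_of_nonneg_left e4 hpos.le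
    linarith
  refine ⟨z, hz, ?_⟩
  rw [tendsto_iff_norm_sub_tendsto_zero]
  have h1 : Tendsto (fun i => Real.sqrt (‖Hs.toL2 (v i)‖ ^ 2 + (v i).energy)) U
      (𝓝 (Real.sqrt (0 ^ 2 + q))) := ((hL2n.pow 2).add hqe).sqrt
  rw [hqz, zero_pow two_ne_zero, add_zero, Real.sqrt_zero] at h1
  refine h1.congr fun i => ?_
  rw [← Hs.norm_sq_eq_toL2_add_energy hs0 hs1, Real.sqrt_sq (norm_nonneg _)]

/-- Normalized elements of `H^s_{0,rad}` are bounded. -/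
theorem exists_norm_le_of_normalized (hs : 1 / 2 < s) (hs1 : s < 1)
    (hN : 2 * s < (N : ℝ)) {h : Eucl N → ℝ} (hh : MemLp h ⊤ (volume.restrict (unitBall N)))
    (hpos : 0 < sobolevConstRad N s (unitBall N) h) :
    ∃ R, ∀ u ∈ Hs0rad N s (unitBall N), u.energy = 1 ∨ energyWith h u = 1 → ‖u‖ ≤ R := by
  have hs0 : 0 < s := by linarith
  have hN0 : 0 < N := by
    have : (0 : ℝ) < N := by linarith
    exact_mod_cast this
  have hp := two_lt_critExp hs hN
  set S := sobolevConstRad N s (unitBall N) h with hS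
  set M := lpNorm h ⊤ (volume.restrict (unitBall N)) with hM
  have hM0 : 0 ≤ M := lpNorm_nonneg
  obtain ⟨C, hC, hPoin⟩ := exists_poincare (N := N) hN0 hs hs1
  -- Hölder on the ball, which has finite volume.
  obtain ⟨V, hV0, hV⟩ : ∃ V, 0 ≤ V ∧ ∀ u ∈ Hs0rad N s (unitBall N),
      ‖Hs.toL2 u‖ ≤ V * critNorm u := by
    set e := 1 / (2 : ℝ≥0∞).toReal - 1 / (ENNReal.ofReal (critExp N s)).toReal with he
    have he0 : 0 ≤ e := by
      rw [he, ENNReal.toReal_ofReal (by linarith), ENNReal.toReal_ofNat, sub_nonneg]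
      exact one_div_le_one_div_of_le (by norm_num) hp.le
    have hvT : volume.restrict (unitBall N) univ ^ e ≠ ⊤ :=
      ENNReal.rpow_ne_top_of_nonneg he0 (measure_ne_top _ _)
    refine ⟨(volume.restrict (unitBall N) univ ^ e).toReal, ENNReal.toReal_nonneg, fun u hu => ?_⟩
    have hup := memLp_critExp_of_mem_Hs0rad hpos hu
    have h1 := eLpNorm_le_eLpNorm_mul_rpow_measure_univ (μ := volume.restrict (unitBall N))
      (p := 2) (q := ENNReal.ofReal (critExp N s))
      (by rw [← ENNReal.ofReal_ofNat]; exact ENNReal.ofReal_le_ofReal hp.le) hup.1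
    rw [Lp.norm_def, critNorm, mul_comm, ← ENNReal.toReal_mul]
    exact ENNReal.toReal_mono (ENNReal.mul_ne_top hup.2.ne hvT) h1
  refine ⟨Real.sqrt (max (C + 1) (1 + (1 + M) * (V ^ 2 / S))), fun u hu hn => ?_⟩
  refine Real.le_sqrt_of_sq_le ?_
  rw [Hs.norm_sq_eq_toL2_add_energy hs0 hs1]
  -- With unit energy, Poincaré bounds the L² norm. With unit full form, the infimum bounds the
  -- critical norm, hence the L² norm, and then the energy is at most 1 plus the sup norm of h times
  -- the L² mass.
  rcases hn with h1 | h1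
  · refine le_max_of_le_left ?_
    have := hPoin u hu
    rw [h1] at this ⊢
    linarith
  · refine le_max_of_le_right ?_
    have h2 := sobolevConstRad_mul_le hs0 hs1 hpos hu
    rw [h1] at h2
    have h3 := (abs_le.1 (abs_energyWith_sub_energy_le hh u)).1
    rw [h1] at h3
    have h4 : ‖Hs.toL2 u‖ ^ 2 ≤ V ^ 2 / S := by
      rw [le_div_iff₀ hpos]
      have h5 := pow_le_pow_left₀ (norm_nonneg _) (hV u hu) 2
      rw [mul_pow] at h5
      have h6 := mul_le_mul_of_nonneg_right h5 hpos.le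
      have h7 := mul_le_mul_of_nonneg_left h2 (sq_nonneg V)
      linarith
    have h8 := mul_le_mul_of_nonneg_left h4 (show 0 ≤ 1 + M by linarith)
    linarith

end Compactness

/-! ### Relative compactness and existence of a minimizer -/

theorem mainTheorem4 (N : ℕ) (s : ℝ) (hs_half : 1 / 2 < s) (hs_one : s < 1)
    (hN : 2 * s < (N : ℝ)) (h : Eucl N → ℝ) (hh : IsRadialLInfty (unitBall N) h)
    (hpos : 0 < sobolevConstRad N s (unitBall N) h)
    (hlt : sobolevConstRad N s (unitBall N) h < sobolevConst N s (Set.univ : Set (Eucl N))) :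
    (∀ u : ℕ → Hs0rad N s (unitBall N), IsMinimizingSeq h u →
      ((∀ k, (u k : Hs N s (unitBall N)).energy = 1) ∨
        (∀ k, energyWith h (u k : Hs N s (unitBall N)) = 1)) →
      IsCompact (closure (Set.range u))) ∧
    ∃ u : Hs0rad N s (unitBall N), u ≠ 0 ∧
      sobolevQuotient h (u : Hs N s (unitBall N)) = sobolevConstRad N s (unitBall N) h := by
  have hs0 : 0 < s := by linarith
  obtain ⟨R, hR⟩ := exists_norm_le_of_normalized hs_half hs_one hN hh.1 hpos
  have hHs := Hs.completeSpace (N := N) (Ω := unitBall N) hs0 hs_one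
  have hclosed : IsClosed (Hs0rad N s (unitBall N) : Set (Hs N s (unitBall N))) :=
    Submodule.isClosed_topologicalClosure _
  have hcomp : CompleteSpace (Hs0rad N s (unitBall N)) := hclosed.completeSpace_coe
  constructor
  · intro u hu hnorm
    have hb : ∀ k, ‖(u k : Hs N s (unitBall N))‖ ≤ R := fun k =>
      hR _ (u k).2 (hnorm.imp (fun h => h k) fun h => h k)
    refine TotallyBounded.isCompact_of_isClosed (TotallyBounded.closure ?_) isClosed_closure
    -- An ultrafilter containing the range is the image of an ultrafilter on the indices. That one
    -- is either principal, giving a constant limit, or finer than `atTop`, where the sequence is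
    -- minimizing.
    refine totallyBounded_iff_ultrafilter.2 fun f hf => ?_
    have hne : (comap u (f : Filter (Hs0rad N s (unitBall N)))).NeBot :=
      f.neBot.comap_of_range_mem (le_principal_iff.1 hf)
    set U := Ultrafilter.of (comap u (f : Filter (Hs0rad N s (unitBall N)))) with hU
    have hfU : (f : Filter (Hs0rad N s (unitBall N))) = map u U := by
      have h1 : (U.map u : Filter (Hs0rad N s (unitBall N))) ≤ f :=
        map_le_iff_le_comap.2 (Ultrafilter.of_le _)
      rw [← Ultrafilter.coe_map, Ultrafilter.eq_of_le h1]
    rw [hfU]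
    rcases U.le_cofinite_or_eq_pure with hU' | ⟨n, hn⟩
    · rw [Nat.cofinite_eq_atTop] at hU'
      obtain ⟨z, hz, hlim⟩ := exists_tendsto_of_minimizing hs_half hs_one hN hh.1 hpos hlt U
        (u := fun k => (u k : Hs N s (unitBall N))) (fun k => (u k).2) hb (hu.2.mono_left hU')
      have h2 : Tendsto u U (𝓝 ⟨z, hz⟩) := tendsto_subtype_rng.2 hlim
      exact cauchy_nhds.mono h2
    · rw [hn, Ultrafilter.coe_pure, map_pure]
      exact cauchy_pure
  · set X := {q | ∃ u ∈ Hs0rad N s (unitBall N), u ≠ 0 ∧ q = sobolevQuotient h u} with hX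
    have hXS : sobolevConstRad N s (unitBall N) h = sInf X := rfl
    -- The empty set has `sInf` equal to 0, so positivity again excludes the degenerate case.
    have hXne : X.Nonempty := by
      by_contra hne
      rw [hXS, not_nonempty_iff_eq_empty.1 hne, Real.sInf_empty] at hpos
      exact lt_irrefl _ hpos
    have hXb : BddBelow X := by
      by_contra hb
      rw [hXS, Real.sInf_of_not_bddBelow hb] at hpos
      exact lt_irrefl _ hpos
    obtain ⟨q, -, hq, hqX⟩ := exists_seq_tendsto_sInf hXne hXb
    choose v hvm hv0 hvq using hqX
    have hE : ∀ k, 0 < energyWith h (v k) := fun k => by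
      obtain ⟨h1, h2⟩ := sobolevConstRad_le hpos (hvm k) (hv0 k)
      refine lt_of_lt_of_le (mul_pos hpos ?_) h2
      exact pow_pos ((critNorm_nonneg _).lt_of_ne' h1) 2
    -- The quotient is invariant under scaling and the full form is positive on nonzero elements, so
    -- the second normalization can be imposed.
    set c : ℕ → ℝ := fun k => (Real.sqrt (energyWith h (v k)))⁻¹ with hc
    have hc0 : ∀ k, c k ≠ 0 := fun k => inv_ne_zero (Real.sqrt_pos.2 (hE k)).ne'
    set w : ℕ → Hs N s (unitBall N) := fun k => c k • v k with hw
    have hwm : ∀ k, w k ∈ Hs0rad N s (unitBall N) := fun k => Submodule.smul_mem _ _ (hvm k)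
    have hwE : ∀ k, energyWith h (w k) = 1 := fun k => by
      simp only [hw, hc]
      rw [energyWith_smul hs0 hs_one, inv_pow, Real.sq_sqrt (hE k).le, inv_mul_cancel₀ (hE k).ne']
    have hwq : Tendsto (fun k => sobolevQuotient h (w k)) atTop
        (𝓝 (sobolevConstRad N s (unitBall N) h)) := by
      rw [hXS]
      refine hq.congr fun k => ?_
      rw [hvq, sobolevQuotient_smul hs0 hs_one h (hc0 k)]
    have hU : (hyperfilter ℕ : Filter ℕ) ≤ atTop := by
      rw [← Nat.cofinite_eq_atTop]; exact hyperfilter_le_cofinite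
    obtain ⟨z, hz, hlim⟩ := exists_tendsto_of_minimizing hs_half hs_one hN hh.1 hpos hlt
      (hyperfilter ℕ) hwm (fun k => hR _ (hwm k) (Or.inr (hwE k))) (hwq.mono_left hU)
    -- The normalization survives strong convergence, which is what keeps the limit from being zero.
    have hzE : energyWith h z = 1 := by
      have h1 := ((continuous_energyWith hs0 hs_one hh.1).tendsto z).comp hlim
      refine (tendsto_nhds_unique h1 (tendsto_const_nhds.congr fun k => ?_))
      exact (hwE k).symm
    have hz0 : z ≠ 0 := by
      rintro rfl
      rw [energyWith_zero hs0 hs_one] at hzE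
      exact zero_ne_one hzE
    obtain ⟨K, hK0, hK⟩ := exists_critNorm_le hs0 hs_one hh.1 hpos
    have hcrit : Tendsto (fun k => critNorm (w k)) (hyperfilter ℕ) (𝓝 (critNorm z)) := by
      rw [tendsto_iff_dist_tendsto_zero]
      have h1 := (tendsto_iff_norm_sub_tendsto_zero.1 hlim).const_mul K
      rw [mul_zero] at h1
      refine squeeze_zero (fun n => dist_nonneg) (fun n => ?_) h1
      rw [Real.dist_eq]
      exact (abs_critNorm_sub_le hs_half hN hpos (hwm n) hz).trans
        (hK _ (Submodule.sub_mem _ (hwm n) hz))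
    have hzc : critNorm z ^ 2 ≠ 0 := pow_ne_zero 2 (sobolevConstRad_le hpos hz hz0).1
    refine ⟨⟨z, hz⟩, fun h0 => hz0 (congrArg Subtype.val h0), ?_⟩
    have h2 : Tendsto (fun k => sobolevQuotient h (w k)) (hyperfilter ℕ)
        (𝓝 (energyWith h z / critNorm z ^ 2)) :=
      (((continuous_energyWith hs0 hs_one hh.1).tendsto z).comp hlim).div (hcrit.pow 2) hzc
    exact tendsto_nhds_unique h2 (hwq.mono_left hU)

end
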